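/- Let $n\ge 3$, $\Bbbk\in\{\mathbb R,\mathbb C\}$, let $I\subseteq\mathbb R$ be an interval with more than one point (open, closed or half-open, bounded or not), let $\gamma: I\to\Bbbk$ be a continuous injection, and put $\Lambda=\gamma(I)$. Let $\mathcal H$ be the space of normal $n\times n$ matrices over $\Bbbk$ all of whose complex eigenvalues lie in $\Lambda$. For $X\in\mathcal H$ write $\lambda_1(X),\dots,\lambda_n(X)$ for the eigenvalues of $X$, repeated according to multiplicity and ordered so that $\gamma^{-1}(\lambda_1(X))\le\dots\le\gamma^{-1}(\lambda_n(X))$. Call a map $\phi:\mathcal H\to M_n(\mathbb C)$ commutativity-preserving if $XY=YX$ implies $\phi(X)\phi(Y)=\phi(Y)\phi(X)$, and spectrum-preserving if $X$ and $\phi(X)$ have the same set of complex eigenvalues for every $X\in\mathcal H$. Consider the following two types of maps $\phi:\mathcal H\to M_n(\mathbb C)$: (a) there is $T\in GL_n(\mathbb C)$ such that $\phi(X)=TXT^{-1}$ for all $X\in\mathcal H$, or $\phi(X)=TX^{t}T^{-1}$ for all $X\in\mathcal H$; (b) there is $T\in GL_n(\mathbb C)$ such that $\phi(X)=T\,\mathrm{diag}(\lambda_1(X),\dots,\lambda_n(X))\,T^{-1}$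 for all $X\in\mathcal H$. Then every continuous, commutativity- and spectrum-preserving map $\phi:\mathcal H\to M_n(\mathbb C)$ is of type (a) or (b). Conversely, every map of type (a) is continuous, commutativity- and spectrum-preserving, and every map of type (b) is commutativity- and spectrum-preserving; a map of type (b) is continuous if and only if $\gamma$ is a homeomorphism onto its image $\Lambda$. In particular, the continuous commutativity- and spectrum-preserving maps are precisely the maps of types (a) and (b) when $\gamma$ is a homeomorphism onto $\Lambda$ (for example when $\Bbbk=\mathbb R$ or $I$ is compact), and precisely the maps of type (a) otherwise. -/

import Mathlib

namespace CurveSpectrum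

/-- The complex matrix with the same entries as `X`. For `𝕜 = ℝ` the map `RCLike.map 𝕜 ℂ` is the
inclusion of the reals, for `𝕜 = ℂ` it is the identity. -/
noncomputable def toC {𝕜 : Type*} [RCLike 𝕜] {n : ℕ} (X : Matrix (Fin n) (Fin n) 𝕜) :
    Matrix (Fin n) (Fin n) ℂ :=
  X.map (RCLike.map 𝕜 ℂ)

/-- The set of normal `n × n` matrices over `𝕜` whose (complex) spectrum is contained in `Λ ⊆ 𝕜`.
For `𝕜 = ℝ` the spectrum is still the set of all complex eigenvalues. -/
def normalMatrices {𝕜 : Type*} [RCLike 𝕜] (n : ℕ) (Λ : Set 𝕜) :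
    Set (Matrix (Fin n) (Fin n) 𝕜) :=
  {X | IsStarNormal X ∧ spectrum ℂ (toC X) ⊆ RCLike.map 𝕜 ℂ '' Λ}

/-- `φ` sends commuting pairs to commuting pairs. -/
def PreservesCommutativity {𝕜 : Type*} [RCLike 𝕜] {n : ℕ} {Λ : Set 𝕜}
    (φ : normalMatrices n Λ → Matrix (Fin n) (Fin n) ℂ) : Prop :=
  ∀ X Y : normalMatrices n Λ, Commute X.1 Y.1 → Commute (φ X) (φ Y)

/-- `φ X` and `X` have the same spectrum, for every `X`. -/
def PreservesSpectrum {𝕜 : Type*} [RCLike 𝕜] {n : ℕ} {Λ : Set 𝕜}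
    (φ : normalMatrices n Λ → Matrix (Fin n) (Fin n) ℂ) : Prop :=
  ∀ X : normalMatrices n Λ, spectrum ℂ (φ X) = spectrum ℂ (toC X.1)

/-- `φ` is a conjugation `X ↦ T X T⁻¹` or a transpose conjugation `X ↦ T Xᵗ T⁻¹`, for some
complex invertible `T`. -/
def IsConjOrTransposeConj {𝕜 : Type*} [RCLike 𝕜] {n : ℕ} {Λ : Set 𝕜}
    (φ : normalMatrices n Λ → Matrix (Fin n) (Fin n) ℂ) : Prop :=
  ∃ T : Matrix.GeneralLinearGroup (Fin n) ℂ,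
    (∀ X : normalMatrices n Λ, φ X = T.1 * toC X.1 * T⁻¹.1) ∨
    (∀ X : normalMatrices n Λ, φ X = T.1 * (toC X.1).transpose * T⁻¹.1)

/-- `φ` is `X ↦ T diag(λ₁(X), …, λₙ(X)) T⁻¹` for some complex invertible `T`, where
`λᵢ(X) = γ (tᵢ)` with `t₁ ≤ ⋯ ≤ tₙ` are the eigenvalues of `X`, counted with multiplicity. -/
def IsSpectrumOrdering {𝕜 : Type*} [RCLike 𝕜] {n : ℕ} {I : Set ℝ} (γ : I → 𝕜)
    (φ : normalMatrices n (Set.range γ) → Matrix (Fin n) (Fin n) ℂ) : Prop :=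
  ∃ T : Matrix.GeneralLinearGroup (Fin n) ℂ,
    ∀ X : normalMatrices n (Set.range γ), ∃ t : Fin n → I, Monotone t ∧
      X.1.charpoly = ∏ i, (Polynomial.X - Polynomial.C (γ (t i))) ∧
      φ X = T.1 * Matrix.diagonal (fun i => RCLike.map 𝕜 ℂ (γ (t i))) * T⁻¹.1

end CurveSpectrum

/-!
A normal matrix over `𝕜` with spectrum in `Λ = γ(I)` is `∑ γ(tᵢ) uᵢuᵢ*` for an orthonormal frame
`u₁, …, uₙ` of `𝕜ⁿ` and parameters `t₁ ≤ ⋯ ≤ tₙ` in `I` (`exists_monotone_frameDiag_eq`). The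
classification of the continuous preservers `φ` has four steps.

*Fixed frame.* For a fixed frame the matrices `∑ γ(tᵢ) uᵢuᵢ*` commute, and for `t₁ < ⋯ < tₙ` the
eigenvalues are distinct, so `φ` is simultaneously diagonalized by some `S`. The diagonal entries
are the `γ(tᵢ)` in some order; as the set of strictly increasing tuples is connected, the order is
always the same, and the limits `t₁ ≤ ⋯ ≤ tₙ` inherit it
(`IsPreserver.exists_diagonalization`). For `t = (a, …, a, b, …, b)` with `a < b` this shows that
an affine modification `Ψ` of `φ` maps the projection onto `⟨u₁, …, u_k⟩` to an idempotent of rank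
`k`, increasing with `k`. The differences of consecutive ones, the *steps*, are rank-one
idempotents that determine `φ` on the frame (`IsPreserver.isFlagMap`,
`IsPreserver.apply_frameDiag`).

*Dichotomy.* Interchanging two neighbouring frame vectors either fixes or interchanges the two
corresponding steps, because the steps before and after commute. Which of the two happens is
independent of the frame by connectedness (`IsFlagMap.swap_fixes_iff`), and of the place by the
braid relation (`IsFlagMap.swap_fixes_succ`). If the steps are fixed, they depend neither on the
order of the frame nor, since two frame vectors can be changed within their plane without affecting
a flag at most places, on the frame (`IsFlagMap.flag_const`): `φ` is `X ↦ T diag(λᵢ(X)) T⁻¹`. If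
they are interchanged, the step at `uᵢ` is `f(uᵢ) = Ψ(uᵢuᵢ*)` (`IsFlagMap.flagStep_eq`).

*Maps of lines.* In the second case `f` is a continuous map from lines to rank-one idempotents that
sends orthogonal frames to resolutions of the identity. A connectedness argument on the angle
between two lines shows that products of idempotents vanish only for orthogonal lines
(`IsLineMap.mul_ne_zero`). This permits the use of affine coordinates: writing orthogonality of
`(1, z, w)` and `(1, z', w')` in the coordinates of the images gives functional equations
(`IsLineMap.coordRatio_div_add_div`, `IsLineMap.coordRatio_comm`) that force `f` to be given, in a
suitable basis, by a continuous ring homomorphism `𝕜 → ℂ` (`IsLineMap.exists_apply_eq`). This is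
the inclusion or its conjugate, and for the Hermitian matrices `xx*` conjugation is transposition.

*Continuity of the ordered eigenvalues.* If `γ` is an embedding, continuity follows from that of
the characteristic polynomial, as the order of the eigenvalues passes to limits. Conversely, the
largest and the smallest eigenvalue of `diag(γ(t), γ(r), …, γ(r))` are `γ(max t r)` and
`γ(min t r)`; if they are continuous in `γ(t)`, then `t > r` and `t < r` are open conditions on
`γ(t)`, whence `γ⁻¹` is continuous.
-/

namespace CurveSpectrum

open Polynomial

variable {𝕜 : Type*} [RCLike 𝕜] {n : ℕ}

/-! ### Frames and matrices diagonal in a frame -/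

/-- The canonical map `RCLike.map 𝕜 ℂ` as a ring homomorphism. -/
noncomputable def complexEmbedding (𝕜 : Type*) [RCLike 𝕜] : 𝕜 →+* ℂ where
  toFun := RCLike.map 𝕜 ℂ
  map_one' := by simp
  map_zero' := by simp
  map_add' x y := by rw [map_add]
  map_mul' x y := by
    rcases RCLike.I_mul_I (K := 𝕜) with h | h
    · have him : ∀ z : 𝕜, RCLike.im z = 0 := fun z => RCLike.im_eq_zero h z
      simp [him]
    · apply Complex.ext <;> simp

theorem complexEmbedding_apply (x : 𝕜) : complexEmbedding 𝕜 x = RCLike.map 𝕜 ℂ x := rfl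

theorem continuous_complexEmbedding : Continuous (complexEmbedding 𝕜) :=
  (RCLike.map 𝕜 ℂ).continuous

theorem complexEmbedding_injective : Function.Injective (complexEmbedding 𝕜) :=
  RingHom.injective _

theorem toC_eq_mapMatrix (X : Matrix (Fin n) (Fin n) 𝕜) :
    toC X = (complexEmbedding 𝕜).mapMatrix X := rfl

theorem toC_mul (X Y : Matrix (Fin n) (Fin n) 𝕜) : toC (X * Y) = toC X * toC Y := by
  simp only [toC_eq_mapMatrix, map_mul]

theorem toC_smul (c : 𝕜) (X : Matrix (Fin n) (Fin n) 𝕜) :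
    toC (c • X) = complexEmbedding 𝕜 c • toC X := by
  ext i j; simp [toC_eq_mapMatrix]

theorem toC_sum {ι : Type*} (s : Finset ι) (X : ι → Matrix (Fin n) (Fin n) 𝕜) :
    toC (∑ i ∈ s, X i) = ∑ i ∈ s, toC (X i) := by
  simp only [toC_eq_mapMatrix, map_sum]

theorem continuous_toC : Continuous (toC : Matrix (Fin n) (Fin n) 𝕜 → _) :=
  continuous_id.matrix_map (RCLike.map 𝕜 ℂ).continuous

theorem charpoly_toC (X : Matrix (Fin n) (Fin n) 𝕜) :
    (toC X).charpoly = X.charpoly.map (complexEmbedding 𝕜) := by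
  rw [toC_eq_mapMatrix, RingHom.mapMatrix_apply, Matrix.charpoly_map]

/-- The matrix whose columns are the members of the family `U`. -/
def columns (U : Fin n → EuclideanSpace 𝕜 (Fin n)) : Matrix (Fin n) (Fin n) 𝕜 :=
  Matrix.of fun a i => U i a

/-- The matrix with eigenvalues `d i` and eigenvectors `U i`, for an orthonormal family `U`. -/
def frameDiag (U : Fin n → EuclideanSpace 𝕜 (Fin n)) (d : Fin n → 𝕜) :
    Matrix (Fin n) (Fin n) 𝕜 :=
  columns U * Matrix.diagonal d * (columns U).conjTranspose

theorem conjTranspose_columns_mul {U : Fin n → EuclideanSpace 𝕜 (Fin n)} (hU : Orthonormal 𝕜 U) :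
    (columns U).conjTranspose * columns U = 1 := by
  ext i j
  have h := orthonormal_iff_ite.1 hU i j
  rw [PiLp.inner_apply] at h
  simp only [Matrix.mul_apply, Matrix.conjTranspose_apply, columns, Matrix.of_apply,
    Matrix.one_apply]
  rw [← h]
  refine Finset.sum_congr rfl fun a _ => ?_
  simp [mul_comm]

theorem columns_mul_conjTranspose {U : Fin n → EuclideanSpace 𝕜 (Fin n)} (hU : Orthonormal 𝕜 U) :
    columns U * (columns U).conjTranspose = 1 :=
  mul_eq_one_comm.1 (conjTranspose_columns_mul hU)

theorem frameDiag_one {U : Fin n → EuclideanSpace 𝕜 (Fin n)} (hU : Orthonormal 𝕜 U) :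
    frameDiag U (fun _ => 1) = 1 := by
  rw [frameDiag, Matrix.diagonal_one, mul_one, columns_mul_conjTranspose hU]

theorem frameDiag_mul {U : Fin n → EuclideanSpace 𝕜 (Fin n)} (hU : Orthonormal 𝕜 U)
    (d e : Fin n → 𝕜) : frameDiag U d * frameDiag U e = frameDiag U (fun i => d i * e i) := by
  have h : frameDiag U d * frameDiag U e = columns U * Matrix.diagonal d *
      ((columns U).conjTranspose * columns U) * Matrix.diagonal e *
        (columns U).conjTranspose := by
    simp only [frameDiag, mul_assoc]
  rw [h, conjTranspose_columns_mul hU, mul_one, mul_assoc (columns U), Matrix.diagonal_mul_diagonal]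
  rfl

theorem frameDiag_add (U : Fin n → EuclideanSpace 𝕜 (Fin n)) (d e : Fin n → 𝕜) :
    frameDiag U (fun i => d i + e i) = frameDiag U d + frameDiag U e := by
  simp only [frameDiag]
  rw [← Matrix.diagonal_add, mul_add, add_mul]

theorem frameDiag_smul (U : Fin n → EuclideanSpace 𝕜 (Fin n)) (c : 𝕜) (d : Fin n → 𝕜) :
    frameDiag U (fun i => c * d i) = c • frameDiag U d := by
  have : Matrix.diagonal (fun i => c * d i) = c • Matrix.diagonal d := by
    rw [← Matrix.diagonal_smul]; rfl
  simp only [frameDiag, this, Matrix.mul_smul, Matrix.smul_mul]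

theorem frameDiag_star (U : Fin n → EuclideanSpace 𝕜 (Fin n)) (d : Fin n → 𝕜) :
    star (frameDiag U d) = frameDiag U (star d) := by
  simp only [frameDiag, Matrix.star_eq_conjTranspose, Matrix.conjTranspose_mul,
    Matrix.conjTranspose_conjTranspose, Matrix.diagonal_conjTranspose, mul_assoc]

theorem frameDiag_commute {U : Fin n → EuclideanSpace 𝕜 (Fin n)} (hU : Orthonormal 𝕜 U)
    (d e : Fin n → 𝕜) : Commute (frameDiag U d) (frameDiag U e) := by
  simp only [Commute, SemiconjBy, frameDiag_mul hU, mul_comm]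

/-- The matrix `x x*`; for a unit vector it is the orthogonal projection onto the line of `x`. -/
def dyad (x : EuclideanSpace 𝕜 (Fin n)) : Matrix (Fin n) (Fin n) 𝕜 :=
  Matrix.of fun a b => x a * star (x b)

theorem frameDiag_eq_sum (U : Fin n → EuclideanSpace 𝕜 (Fin n)) (d : Fin n → 𝕜) :
    frameDiag U d = ∑ i, d i • dyad (U i) := by
  ext a b
  rw [frameDiag, Matrix.mul_apply]
  simp only [Matrix.mul_diagonal, columns, Matrix.of_apply,
    Matrix.conjTranspose_apply, Matrix.sum_apply, Matrix.smul_apply, dyad, smul_eq_mul]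
  exact Finset.sum_congr rfl fun i _ => by ring

theorem dyad_smul (c : 𝕜) (x : EuclideanSpace 𝕜 (Fin n)) :
    dyad (c • x) = (c * star c) • dyad x := by
  ext a b
  simp only [dyad, Matrix.of_apply, Matrix.smul_apply, PiLp.smul_apply, smul_eq_mul, star_mul']
  ring

theorem continuous_dyad : Continuous (dyad : EuclideanSpace 𝕜 (Fin n) → _) := by
  refine continuous_matrix fun a b => ?_
  simp only [dyad, Matrix.of_apply]
  fun_prop

theorem isUnit_columns {U : Fin n → EuclideanSpace 𝕜 (Fin n)} (hU : Orthonormal 𝕜 U) :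
    ∃ V : (Matrix (Fin n) (Fin n) 𝕜)ˣ, V.1 = columns U ∧ V⁻¹.1 = (columns U).conjTranspose :=
  ⟨⟨columns U, (columns U).conjTranspose, columns_mul_conjTranspose hU,
    conjTranspose_columns_mul hU⟩, rfl, rfl⟩

theorem charpoly_frameDiag {U : Fin n → EuclideanSpace 𝕜 (Fin n)} (hU : Orthonormal 𝕜 U)
    (d : Fin n → 𝕜) : (frameDiag U d).charpoly = ∏ i, (X - C (d i)) := by
  obtain ⟨V, hV, hV'⟩ := isUnit_columns hU
  rw [frameDiag, ← hV', ← hV, Matrix.coe_units_inv, Matrix.charpoly_units_conj,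
    Matrix.charpoly_diagonal]

theorem spectrum_eq_range_of_charpoly {M : Matrix (Fin n) (Fin n) ℂ} {d : Fin n → ℂ}
    (h : M.charpoly = ∏ i, (X - C (d i))) : spectrum ℂ M = Set.range d := by
  ext z
  rw [Matrix.mem_spectrum_iff_isRoot_charpoly, h, IsRoot, eval_prod, Finset.prod_eq_zero_iff]
  simp [sub_eq_zero, eq_comm]

theorem spectrum_toC_of_charpoly {M : Matrix (Fin n) (Fin n) 𝕜} {d : Fin n → 𝕜}
    (h : M.charpoly = ∏ i, (X - C (d i))) :
    spectrum ℂ (toC M) = Set.range fun i => complexEmbedding 𝕜 (d i) := by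
  apply spectrum_eq_range_of_charpoly
  rw [charpoly_toC, h, Polynomial.map_prod]
  simp

theorem frameDiag_mem_normalMatrices {U : Fin n → EuclideanSpace 𝕜 (Fin n)}
    (hU : Orthonormal 𝕜 U) {d : Fin n → 𝕜} {Λ : Set 𝕜} (hd : ∀ i, d i ∈ Λ) :
    frameDiag U d ∈ normalMatrices n Λ := by
  refine ⟨⟨?_⟩, ?_⟩
  · rw [frameDiag_star]; exact frameDiag_commute hU _ _
  · rw [spectrum_toC_of_charpoly (charpoly_frameDiag hU d)]
    rintro _ ⟨i, rfl⟩
    exact ⟨d i, hd i, rfl⟩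

/-! ### Unitary diagonalization of normal matrices -/

open scoped ComplexOrder in
/-- An eigenvector of a normal matrix is an eigenvector of its adjoint. -/
theorem conjTranspose_mulVec_of_mulVec {M : Matrix (Fin n) (Fin n) 𝕜} (hM : IsStarNormal M)
    {v : Fin n → 𝕜} {c : 𝕜} (hv : M.mulVec v = c • v) :
    M.conjTranspose.mulVec v = star c • v := by
  set N := M - c • (1 : Matrix (Fin n) (Fin n) 𝕜) with hN
  have hNv : N.mulVec v = 0 := by
    rw [hN, Matrix.sub_mulVec, hv, Matrix.smul_mulVec, Matrix.one_mulVec, sub_self]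
  have hNs : N.conjTranspose = M.conjTranspose - star c • (1 : Matrix (Fin n) (Fin n) 𝕜) := by
    rw [hN, Matrix.conjTranspose_sub, Matrix.conjTranspose_smul, Matrix.conjTranspose_one]
  have hcomm : N * N.conjTranspose = N.conjTranspose * N := by
    have h := hM.star_comm_self
    simp only [Commute, SemiconjBy, Matrix.star_eq_conjTranspose] at h
    rw [hNs, hN]
    simp only [sub_mul, mul_sub, h, Matrix.smul_mul, Matrix.mul_smul, one_mul, mul_one,
      smul_smul, mul_comm c]
    abel
  have h0 : N.conjTranspose.mulVec v = 0 := by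
    have : (star (N.conjTranspose.mulVec v)) ⬝ᵥ (N.conjTranspose.mulVec v) = 0 := by
      rw [Matrix.star_mulVec, Matrix.conjTranspose_conjTranspose, ← Matrix.dotProduct_mulVec,
        Matrix.mulVec_mulVec, hcomm, ← Matrix.mulVec_mulVec, hNv, Matrix.mulVec_zero,
        dotProduct_zero]
    exact dotProduct_star_self_eq_zero.1 this
  rw [hNs, Matrix.sub_mulVec, Matrix.smul_mulVec, Matrix.one_mulVec, sub_eq_zero] at h0
  exact h0

/-- An endomorphism annihilated by a product of linear factors on a nonzero invariant subspace has
an eigenvector there. -/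
theorem exists_eigenvector_of_aeval_prod_eq_zero {V : Type*} [AddCommGroup V] [Module 𝕜 V]
    (T : Module.End 𝕜 V) (W : Submodule 𝕜 V) (hW : ∀ x ∈ W, T x ∈ W) (s : Multiset 𝕜) :
    ∀ x ∈ W, x ≠ 0 → aeval T ((s.map fun c => X - C c).prod) x = 0 →
      ∃ y ∈ W, y ≠ 0 ∧ ∃ c : 𝕜, T y = c • y := by
  induction s using Multiset.induction with
  | empty => intro x _ hx h; simp at h; exact absurd h hx
  | cons c s ih =>
    intro x hxW hx h
    by_cases hc : T x = c • x
    · exact ⟨x, hxW, hx, c, hc⟩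
    · refine ih (T x - c • x) (W.sub_mem (hW x hxW) (W.smul_mem c hxW)) (sub_ne_zero.2 hc) ?_
      rw [Multiset.map_cons, Multiset.prod_cons, mul_comm, map_mul] at h
      simpa [Algebra.algebraMap_eq_smul_one] using h

theorem exists_orthonormal_eigenvectors {M : Matrix (Fin n) (Fin n) 𝕜} (hM : IsStarNormal M)
    (hs : M.charpoly.Splits) (k : ℕ) (hk : k ≤ n) :
    ∃ v : Fin k → EuclideanSpace 𝕜 (Fin n), Orthonormal 𝕜 v ∧
      ∀ i, ∃ c : 𝕜, M.mulVec (v i).ofLp = c • (v i).ofLp := by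
  induction k with
  | zero => exact ⟨Fin.elim0, ⟨fun i => i.elim0, fun i => i.elim0⟩, fun i => i.elim0⟩
  | succ k ih =>
    obtain ⟨v, hv, hev⟩ := ih (by omega)
    set W : Submodule 𝕜 (EuclideanSpace 𝕜 (Fin n)) := (Submodule.span 𝕜 (Set.range v))ᗮ with hWdef
    set T : Module.End 𝕜 (EuclideanSpace 𝕜 (Fin n)) := Matrix.toLpLin 2 2 M with hT
    have hTapp : ∀ x, T x = WithLp.toLp 2 (M.mulVec x.ofLp) := fun x => rfl
    have hmem : ∀ x, x ∈ W ↔ ∀ i, inner 𝕜 (v i) x = 0 := by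
      intro x
      rw [hWdef, Submodule.mem_orthogonal]
      refine ⟨fun h i => h _ (Submodule.subset_span ⟨i, rfl⟩), fun h u hu => ?_⟩
      induction hu using Submodule.span_induction with
      | mem y hy => obtain ⟨i, rfl⟩ := hy; exact h i
      | zero => simp
      | add y z _ _ hy hz => rw [inner_add_left, hy, hz, add_zero]
      | smul c y _ hy => rw [inner_smul_left, hy, mul_zero]
    have hW : ∀ x ∈ W, T x ∈ W := by
      intro x hx
      rw [hmem] at hx ⊢
      intro i
      obtain ⟨c, hc⟩ := hev i
      have h1 := conjTranspose_mulVec_of_mulVec hM hc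
      have h2 := hx i
      rw [EuclideanSpace.inner_eq_star_dotProduct] at h2 ⊢
      rw [hTapp, dotProduct_comm, Matrix.dotProduct_mulVec,
        ← Matrix.conjTranspose_conjTranspose M, ← Matrix.star_mulVec, h1, star_smul,
        smul_dotProduct, dotProduct_comm, h2, smul_zero]
    have hne : ∃ x ∈ W, x ≠ 0 := by
      have hlt : Submodule.span 𝕜 (Set.range v) ≠ ⊤ := by
        intro h
        have h1 := finrank_range_le_card (R := 𝕜) v
        rw [Set.finrank, h, finrank_top, finrank_euclideanSpace] at h1
        simp at h1
        omega
      have : W ≠ ⊥ := by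
        intro h
        exact hlt (Submodule.orthogonal_eq_bot_iff.1 h)
      exact (Submodule.ne_bot_iff _).1 this
    obtain ⟨x, hxW, hx⟩ := hne
    have hann : aeval T ((M.charpoly.roots.map fun c => X - C c).prod) x = 0 := by
      have h1 : (M.charpoly.roots.map fun c => X - C c).prod = M.charpoly :=
        (hs.eq_prod_roots_of_monic M.charpoly_monic).symm
      have h2 : aeval T M.charpoly = 0 := by
        have h3 : T = Matrix.toLpLinAlgEquiv 2 M := rfl
        rw [h3, Polynomial.aeval_algHom_apply, Matrix.aeval_self_charpoly, map_zero]
      rw [h1, h2, LinearMap.zero_apply]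
    obtain ⟨y, hyW, hy, c, hyc⟩ :=
      exists_eigenvector_of_aeval_prod_eq_zero T W hW _ x hxW hx hann
    have hyn : (‖y‖ : 𝕜) ≠ 0 := by simpa using hy
    set w : EuclideanSpace 𝕜 (Fin n) := (‖y‖ : 𝕜)⁻¹ • y with hw
    have hwW := (hmem w).1 (W.smul_mem _ hyW)
    have hwn : ‖w‖ = 1 := by rw [hw]; exact norm_smul_inv_norm hy
    refine ⟨Fin.snoc v w, ?_, ?_⟩
    · rw [orthonormal_iff_ite]
      intro i j
      refine Fin.lastCases ?_ (fun i => ?_) i <;> refine Fin.lastCases ?_ (fun j => ?_) j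
      · simp [hwn]
      · have := hwW j
        rw [← inner_conj_symm, map_eq_zero] at this
        simp [this, (Fin.castSucc_lt_last j).ne']
      · simp [hwW i, (Fin.castSucc_lt_last i).ne]
      · simpa using orthonormal_iff_ite.1 hv i j
    · intro i
      refine Fin.lastCases ?_ (fun i => ?_) i
      · refine ⟨c, ?_⟩
        have h1 : T w = c • w := by rw [hw, map_smul, hyc, smul_comm]
        rw [hTapp] at h1
        have := congrArg WithLp.ofLp h1
        simpa using this
      · simpa using hev i

theorem exists_frameDiag_eq {M : Matrix (Fin n) (Fin n) 𝕜} (hM : IsStarNormal M)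
    (hs : M.charpoly.Splits) :
    ∃ U : Fin n → EuclideanSpace 𝕜 (Fin n), Orthonormal 𝕜 U ∧ ∃ d, M = frameDiag U d := by
  obtain ⟨U, hU, h⟩ := exists_orthonormal_eigenvectors hM hs n le_rfl
  choose d hd using h
  refine ⟨U, hU, d, ?_⟩
  have h1 : M * columns U = columns U * Matrix.diagonal d := by
    ext a i
    have := congrFun (hd i) a
    rw [Matrix.mul_diagonal, Matrix.mul_apply]
    simp only [columns, Matrix.of_apply]
    simpa [Matrix.mulVec, dotProduct, mul_comm] using this
  rw [frameDiag, ← h1, mul_assoc, columns_mul_conjTranspose hU, mul_one]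

/-- Every member of `normalMatrices n (range γ)` is unitarily (over `𝕜`) similar to a diagonal
matrix whose eigenvalues are ordered along the curve. -/
theorem exists_monotone_frameDiag_eq {I : Set ℝ} {γ : I → 𝕜}
    {M : Matrix (Fin n) (Fin n) 𝕜} (hM : M ∈ normalMatrices n (Set.range γ)) :
    ∃ U : Fin n → EuclideanSpace 𝕜 (Fin n), Orthonormal 𝕜 U ∧
      ∃ t : Fin n → I, Monotone t ∧ M = frameDiag U (fun i => γ (t i)) := by
  have hsplit : M.charpoly.Splits := by
    refine Splits.of_splits_map (complexEmbedding 𝕜) (IsAlgClosed.splits _) fun z hz => ?_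
    rw [← charpoly_toC, mem_roots (Matrix.charpoly_monic _).ne_zero,
      ← Matrix.mem_spectrum_iff_isRoot_charpoly] at hz
    obtain ⟨x, -, hx⟩ := hM.2 hz
    exact ⟨x, hx⟩
  obtain ⟨U, hU, d, rfl⟩ := exists_frameDiag_eq hM.1 hsplit
  have hd : ∀ i, ∃ t : I, γ t = d i := by
    intro i
    have h1 := hM.2
    rw [spectrum_toC_of_charpoly (charpoly_frameDiag hU d)] at h1
    obtain ⟨_, ⟨t, rfl⟩, ht⟩ := h1 ⟨i, rfl⟩
    exact ⟨t, complexEmbedding_injective ht⟩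
  choose t ht using hd
  refine ⟨U ∘ Tuple.sort t, hU.comp _ (Tuple.sort t).injective, t ∘ Tuple.sort t,
    Tuple.monotone_sort t, ?_⟩
  rw [frameDiag_eq_sum, frameDiag_eq_sum]
  simp only [Function.comp, ht]
  exact (Equiv.sum_comp (Tuple.sort t) fun i => d i • dyad (U i)).symm

/-! ### Images of matrices with a common eigenframe -/

/-- If a continuous function selects, at every point, one of finitely many continuous functions
with pairwise distinct values, then on a preconnected space it selects the same one everywhere. -/
theorem eq_of_selection {S ι : Type*} [TopologicalSpace S] [PreconnectedSpace S] [Finite ι]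
    {c : S → ℂ} {g : ι → S → ℂ} (hc : Continuous c) (hg : ∀ i, Continuous (g i))
    (hinj : ∀ x, Function.Injective fun i => g i x) (hsel : ∀ x, ∃ i, c x = g i x) {i : ι} {x₀ : S}
    (h₀ : c x₀ = g i x₀) (x : S) : c x = g i x := by
  have hcl : IsClosed {x | c x = g i x} := isClosed_eq hc (hg i)
  have hop : IsOpen {x | c x = g i x} := by
    have : {x | c x = g i x}ᶜ = ⋃ j ∈ {j | j ≠ i}, {x | c x = g j x} := by
      ext y
      simp only [Set.mem_compl_iff, Set.mem_ofPred_eq, Set.mem_iUnion, exists_prop]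
      constructor
      · intro h
        obtain ⟨j, hj⟩ := hsel y
        exact ⟨j, fun hji => h (hji ▸ hj), hj⟩
      · rintro ⟨j, hji, hj⟩ h
        exact hji (hinj y (hj.symm.trans h))
    rw [← isClosed_compl_iff, this]
    exact (Set.toFinite _).isClosed_biUnion fun j _ => isClosed_eq hc (hg j)
  have h := (show IsClopen _ from ⟨hcl, hop⟩).eq_univ ⟨x₀, h₀⟩
  exact (Set.eq_univ_iff_forall.1 h) x

theorem exists_eq_conj_diagonal {M : Matrix (Fin n) (Fin n) ℂ} {μ : Fin n → ℂ}
    (hμ : Function.Injective μ) (hM : ∀ i, μ i ∈ spectrum ℂ M) :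
    ∃ S : (Matrix (Fin n) (Fin n) ℂ)ˣ, M = S.1 * Matrix.diagonal μ * S⁻¹.1 := by
  have h : ∀ i, ∃ v, Module.End.HasEigenvector (Matrix.toLin' M) (μ i) v := by
    intro i
    have h1 := hM i
    rw [← Matrix.spectrum_toLin', ← Module.End.hasEigenvalue_iff_mem_spectrum] at h1
    exact h1.exists_hasEigenvector
  choose v hv using h
  have hli := Module.End.eigenvectors_linearIndependent' (Matrix.toLin' M) μ hμ v hv
  set V : Matrix (Fin n) (Fin n) ℂ := Matrix.of fun a i => v i a with hV
  have hunit : IsUnit V := by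
    rw [← Matrix.linearIndependent_cols_iff_isUnit]
    exact hli
  obtain ⟨S, hS⟩ := hunit
  refine ⟨S, ?_⟩
  have h1 : M * V = V * Matrix.diagonal μ := by
    ext a i
    have := congrFun (hv i).apply_eq_smul a
    rw [Matrix.mul_diagonal, Matrix.mul_apply, hV]
    simpa [Matrix.mulVec, dotProduct, mul_comm] using this
  rw [hS, ← h1, mul_assoc, ← hS, Units.mul_inv, mul_one]

theorem eq_conj_diagonal_of_commute {S : (Matrix (Fin n) (Fin n) ℂ)ˣ} {μ : Fin n → ℂ}
    (hμ : Function.Injective μ) {N : Matrix (Fin n) (Fin n) ℂ}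
    (h : Commute N (S.1 * Matrix.diagonal μ * S⁻¹.1)) :
    N = S.1 * Matrix.diagonal (fun i => (S⁻¹.1 * N * S.1) i i) * S⁻¹.1 := by
  set K := S⁻¹.1 * N * S.1 with hK
  have hN : N = S.1 * K * S⁻¹.1 := by simp [hK, mul_assoc]
  have hc : K * Matrix.diagonal μ = Matrix.diagonal μ * K := by
    have h1 := h.eq
    have h2 : S⁻¹.1 * (N * (S.1 * Matrix.diagonal μ * S⁻¹.1)) * S.1 = K * Matrix.diagonal μ := by
      simp [hK, mul_assoc]
    have h3 : S⁻¹.1 * ((S.1 * Matrix.diagonal μ * S⁻¹.1) * N) * S.1 = Matrix.diagonal μ * K := by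
      simp [hK, mul_assoc]
    rw [← h2, ← h3, h1]
  have hd : K = Matrix.diagonal fun i => K i i := by
    ext i j
    by_cases hij : i = j
    · subst hij; simp
    · have h1 := congrFun (congrFun hc i) j
      rw [Matrix.mul_diagonal, Matrix.diagonal_mul] at h1
      rw [Matrix.diagonal_apply_ne _ hij]
      have h2 : K i j * (μ j - μ i) = 0 := by linear_combination h1
      exact (mul_eq_zero.1 h2).resolve_right (sub_ne_zero.2 fun h => hij (hμ h).symm)
  rw [← hd, ← hN]

theorem spectrum_conj (S : (Matrix (Fin n) (Fin n) ℂ)ˣ) (M : Matrix (Fin n) (Fin n) ℂ) :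
    spectrum ℂ (S.1 * M * S⁻¹.1) = spectrum ℂ M :=
  spectrum.units_conjugate

/-- A continuous map preserving commutativity and spectrum, extended in an arbitrary way to all
matrices. -/
structure IsPreserver {I : Set ℝ} (γ : I → 𝕜)
    (ψ : Matrix (Fin n) (Fin n) 𝕜 → Matrix (Fin n) (Fin n) ℂ) : Prop where
  continuousOn : ContinuousOn ψ (normalMatrices n (Set.range γ))
  commute : ∀ X ∈ normalMatrices n (Set.range γ), ∀ Y ∈ normalMatrices n (Set.range γ),
    Commute X Y → Commute (ψ X) (ψ Y)
  spectrum_eq : ∀ X ∈ normalMatrices n (Set.range γ), spectrum ℂ (ψ X) = spectrum ℂ (toC X)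

theorem exists_strictMono {I : Set ℝ} (hI : I.OrdConnected) (hI' : I.Nontrivial) (n : ℕ) :
    ∃ t : Fin n → I, StrictMono t := by
  obtain ⟨a, ha, b, hb, hab⟩ := hI'.exists_lt
  refine ⟨fun i => ⟨a + (i : ℝ) / n * (b - a), hI.out ha hb ⟨?_, ?_⟩⟩, fun i j hij => ?_⟩
  · have : 0 ≤ (i : ℝ) / n * (b - a) := mul_nonneg (by positivity) (by linarith)
    linarith
  · have h1 : (i : ℝ) / n ≤ 1 := div_le_one_of_le₀ (by exact_mod_cast i.2.le) (by positivity)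
    nlinarith
  · have hn : (0 : ℝ) < n := by exact_mod_cast (Nat.zero_le _).trans_lt i.2
    have h1 : (i : ℝ) / n < (j : ℝ) / n := by
      gcongr
      exact_mod_cast hij
    refine Subtype.mk_lt_mk.2 ?_
    nlinarith

/-- Along a fixed orthonormal frame a preserver is simultaneously diagonalized. On eigenvalues in
strictly increasing order the diagonal entries are constrained to be the eigenvalues, and they
cannot be permuted because the set of increasing tuples is connected; weakly increasing tuples are
limits of these. -/
theorem IsPreserver.exists_diagonalization {I : Set ℝ} (hI : I.OrdConnected) (hI' : I.Nontrivial)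
    {γ : I → 𝕜} (hγ : Continuous γ) (hγ' : Function.Injective γ)
    {ψ : Matrix (Fin n) (Fin n) 𝕜 → Matrix (Fin n) (Fin n) ℂ} (hψ : IsPreserver γ ψ)
    {U : Fin n → EuclideanSpace 𝕜 (Fin n)} (hU : Orthonormal 𝕜 U) :
    ∃ S : (Matrix (Fin n) (Fin n) ℂ)ˣ, ∀ t : Fin n → I, Monotone t →
      ψ (frameDiag U fun i => γ (t i)) =
        S.1 * Matrix.diagonal (fun i => complexEmbedding 𝕜 (γ (t i))) * S⁻¹.1 := by
  obtain ⟨t₀, ht₀⟩ := exists_strictMono hI hI' n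
  have hmem : ∀ t : Fin n → I, frameDiag U (fun i => γ (t i)) ∈ normalMatrices n (Set.range γ) :=
    fun t => frameDiag_mem_normalMatrices hU fun i => ⟨t i, rfl⟩
  have hspec : ∀ t : Fin n → I, spectrum ℂ (ψ (frameDiag U fun i => γ (t i))) =
      Set.range fun i => complexEmbedding 𝕜 (γ (t i)) := fun t => by
    rw [hψ.spectrum_eq _ (hmem t), spectrum_toC_of_charpoly (charpoly_frameDiag hU _)]
  have hinj : ∀ t : Fin n → I, StrictMono t →
      Function.Injective fun i => complexEmbedding 𝕜 (γ (t i)) := fun t ht =>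
    complexEmbedding_injective.comp (hγ'.comp ht.injective)
  obtain ⟨S, hS⟩ := exists_eq_conj_diagonal (hinj t₀ ht₀)
    (M := ψ (frameDiag U fun i => γ (t₀ i))) (fun i => by rw [hspec]; exact ⟨i, rfl⟩)
  -- the diagonal entries in the basis given by `S`
  set c : (Fin n → I) → Fin n → ℂ :=
    fun t i => (S⁻¹.1 * ψ (frameDiag U fun i => γ (t i)) * S.1) i i with hc
  have hdiag : ∀ t, ψ (frameDiag U fun i => γ (t i)) =
      S.1 * Matrix.diagonal (c t) * S⁻¹.1 := fun t => by
    apply eq_conj_diagonal_of_commute (hinj t₀ ht₀)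
    rw [← hS]
    exact hψ.commute _ (hmem t) _ (hmem t₀) (frameDiag_commute hU _ _)
  have hsel : ∀ t i, ∃ j, c t i = complexEmbedding 𝕜 (γ (t j)) := fun t i => by
    have h1 := hspec t
    rw [hdiag t, spectrum_conj, spectrum_diagonal] at h1
    have h2 : c t i ∈ Set.range (c t) := ⟨i, rfl⟩
    rw [h1] at h2
    obtain ⟨j, hj⟩ := h2
    exact ⟨j, hj.symm⟩
  have hcont : Continuous fun t : Fin n → I => ψ (frameDiag U fun i => γ (t i)) := by
    refine hψ.continuousOn.comp_continuous ?_ hmem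
    simp only [frameDiag_eq_sum]
    fun_prop
  have hccont : ∀ i, Continuous fun t => c t i := fun i =>
    ((continuous_const.matrix_mul hcont).matrix_mul continuous_const).matrix_elem i i
  refine ⟨S, fun t ht => ?_⟩
  rw [hdiag t]
  congr 3
  ext i
  -- the segment from `t` to `t₀` runs through strictly increasing tuples
  set p : Set.Icc (0 : ℝ) 1 → Fin n → I := fun s i =>
    ⟨(1 - s.1) * (t i).1 + s.1 * (t₀ i).1,
      hI.convex (t i).2 (t₀ i).2 (sub_nonneg.2 s.2.2) s.2.1 (by ring)⟩ with hp
  have hpc : Continuous p := by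
    refine continuous_pi fun i => Continuous.subtype_mk ?_ _
    fun_prop
  have hpm : ∀ s : Set.Icc (0 : ℝ) 1, 0 < s.1 → StrictMono (p s) := by
    intro s hs i j hij
    refine Subtype.mk_lt_mk.2 ?_
    have h1 : (t i).1 ≤ (t j).1 := ht hij.le
    have h2 : (t₀ i).1 < (t₀ j).1 := ht₀ hij
    have h3 := s.2.2
    nlinarith
  let ι : Set.Ioc (0 : ℝ) 1 → Set.Icc (0 : ℝ) 1 := fun s => ⟨s.1, s.2.1.le, s.2.2⟩
  have hι : Continuous ι := continuous_subtype_val.subtype_mk _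
  have hone : p ⟨1, by simp⟩ = t₀ := by
    ext i; simp [hp]
  have hzero : p ⟨0, by simp⟩ = t := by
    ext i; simp [hp]
  have : PreconnectedSpace (Set.Ioc (0 : ℝ) 1) :=
    isPreconnected_iff_preconnectedSpace.1 isPreconnected_Ioc
  have heq : ∀ s : Set.Ioc (0 : ℝ) 1, c (p (ι s)) i = complexEmbedding 𝕜 (γ (p (ι s) i)) := by
    refine eq_of_selection (g := fun i s => complexEmbedding 𝕜 (γ (p (ι s) i)))
      ((hccont i).comp (hpc.comp hι))
      (fun i => continuous_complexEmbedding.comp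
        (hγ.comp ((continuous_apply i).comp (hpc.comp hι))))
      (fun s => hinj _ (hpm _ s.2.1)) (fun s => hsel _ _) (x₀ := ⟨1, by simp⟩) ?_
    have h1 : c t₀ i = complexEmbedding 𝕜 (γ (t₀ i)) := by
      simp only [hc]
      rw [hS]
      simp [mul_assoc]
    rw [← hone] at h1
    exact h1
  have hcl : IsClosed {s : Set.Icc (0 : ℝ) 1 | c (p s) i = complexEmbedding 𝕜 (γ (p s i))} :=
    isClosed_eq ((hccont i).comp hpc)
      (continuous_complexEmbedding.comp (hγ.comp ((continuous_apply i).comp hpc)))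
  have h0 : (⟨0, by simp⟩ : Set.Icc (0 : ℝ) 1) ∈
      closure {s : Set.Icc (0 : ℝ) 1 | c (p s) i = complexEmbedding 𝕜 (γ (p s i))} := by
    have hu : Filter.Tendsto (fun k : ℕ => (⟨1 / ((k : ℝ) + 1), by positivity, by
        rw [div_le_one (by positivity)]; linarith [(Nat.cast_nonneg k : (0 : ℝ) ≤ k)]⟩ :
          Set.Icc (0 : ℝ) 1)) Filter.atTop (nhds ⟨0, by simp⟩) := by
      rw [tendsto_subtype_rng]
      exact tendsto_one_div_add_atTop_nhds_zero_nat
    refine mem_closure_of_tendsto hu (Filter.Eventually.of_forall fun k => ?_)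
    exact heq ⟨1 / ((k : ℝ) + 1), by positivity, by
      rw [div_le_one (by positivity)]; linarith [(Nat.cast_nonneg k : (0 : ℝ) ≤ k)]⟩
  rw [hcl.closure_eq] at h0
  have h1 : c (p ⟨0, by simp⟩) i = complexEmbedding 𝕜 (γ (p ⟨0, by simp⟩ i)) := h0
  rwa [hzero] at h1

/-! ### Idempotents of rank one -/

/-- A (not necessarily self-adjoint) idempotent matrix of rank one. -/
def IsRankOneIdempotent (R : Matrix (Fin n) (Fin n) ℂ) : Prop :=
  ∃ u v : Fin n → ℂ, R = Matrix.vecMulVec u v ∧ v ⬝ᵥ u = 1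

namespace IsRankOneIdempotent

variable {R R' : Matrix (Fin n) (Fin n) ℂ}

theorem trace_eq_one (h : IsRankOneIdempotent R) : R.trace = 1 := by
  obtain ⟨u, v, rfl, huv⟩ := h
  rw [Matrix.trace_vecMulVec, dotProduct_comm, huv]

theorem ne_zero (h : IsRankOneIdempotent R) : R ≠ 0 := fun h0 => by
  have := h.trace_eq_one
  simp [h0] at this

theorem mul_self (h : IsRankOneIdempotent R) : R * R = R := by
  obtain ⟨u, v, rfl, huv⟩ := h
  rw [Matrix.vecMulVec_mul_vecMulVec, huv, one_smul]

theorem mul_mul_self (h : IsRankOneIdempotent R) (M : Matrix (Fin n) (Fin n) ℂ) :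
    R * M * R = (M * R).trace • R := by
  obtain ⟨u, v, rfl, huv⟩ := h
  rw [mul_assoc, Matrix.mul_vecMulVec M u v, Matrix.vecMulVec_mul_vecMulVec,
    Matrix.vecMulVec_smul, Matrix.trace_vecMulVec, dotProduct_comm]

theorem mul_eq_zero_or (h : IsRankOneIdempotent R) {A B : Matrix (Fin n) (Fin n) ℂ}
    (h0 : A * R * B = 0) : A * R = 0 ∨ R * B = 0 := by
  obtain ⟨u, v, rfl, -⟩ := h
  rw [Matrix.mul_vecMulVec, Matrix.vecMulVec_mul, Matrix.vecMulVec_eq_zero] at h0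
  rcases h0 with h0 | h0
  · left; rw [Matrix.mul_vecMulVec, h0, Matrix.zero_vecMulVec]
  · right; rw [Matrix.vecMulVec_mul, h0, Matrix.vecMulVec_zero]

/-- Commuting rank-one idempotents are equal or have product zero. -/
theorem eq_of_commute (h : IsRankOneIdempotent R) (h' : IsRankOneIdempotent R')
    (hc : Commute R R') (hne : R * R' ≠ 0) : R = R' := by
  have h1 : R * R' = (R' * R).trace • R := by
    rw [← h.mul_mul_self, mul_assoc, ← hc.eq, ← mul_assoc, h.mul_self]
  have h2 : R * R' = (R * R').trace • R' := by
    rw [← h'.mul_mul_self, ← hc.eq, mul_assoc, h'.mul_self]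
  rw [← hc.eq] at h1
  have hne' : (R * R').trace ≠ 0 := fun h0 => hne (by rw [h1, h0, zero_smul])
  exact smul_right_injective _ hne' (h1.symm.trans h2)

theorem conj (h : IsRankOneIdempotent R) (S : (Matrix (Fin n) (Fin n) ℂ)ˣ) :
    IsRankOneIdempotent (S.1 * R * S⁻¹.1) := by
  obtain ⟨u, v, rfl, huv⟩ := h
  refine ⟨S.1.mulVec u, Matrix.vecMul v S⁻¹.1, ?_, ?_⟩
  · rw [Matrix.mul_vecMulVec, Matrix.vecMulVec_mul]
  · rw [← Matrix.dotProduct_mulVec, Matrix.mulVec_mulVec, Units.inv_mul, Matrix.one_mulVec, huv]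

theorem transpose (h : IsRankOneIdempotent R) : IsRankOneIdempotent R.transpose := by
  obtain ⟨u, v, rfl, huv⟩ := h
  exact ⟨v, u, Matrix.transpose_vecMulVec _ _, by rw [dotProduct_comm, huv]⟩

end IsRankOneIdempotent

theorem isRankOneIdempotent_single (i : Fin n) :
    IsRankOneIdempotent (Matrix.diagonal (Pi.single i 1)) := by
  refine ⟨Pi.single i 1, Pi.single i 1, ?_, by simp⟩
  rw [Matrix.diagonal_single, Matrix.single_eq_single_vecMulVec_single]

/-! ### Orthonormal frames -/

/-- A partially defined orthonormal frame can be completed. -/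
theorem exists_frame (v : Fin n → EuclideanSpace 𝕜 (Fin n)) (s : Set (Fin n))
    (hv : ∀ i ∈ s, ∀ j ∈ s, inner 𝕜 (v i) (v j) = if i = j then (1 : 𝕜) else 0) :
    ∃ U : Fin n → EuclideanSpace 𝕜 (Fin n), Orthonormal 𝕜 U ∧ ∀ i ∈ s, U i = v i := by
  have h : Orthonormal 𝕜 (s.domRestrict v) := by
    rw [orthonormal_iff_ite]
    intro i j
    simp only [Set.domRestrict_apply, hv i i.2 j j.2, Subtype.ext_iff]
  obtain ⟨b, hb⟩ := h.exists_orthonormalBasis_extension_of_card_eq (by simp)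
  exact ⟨b, b.orthonormal, hb⟩

theorem sum_inner_smul {U : Fin n → EuclideanSpace 𝕜 (Fin n)} (hU : Orthonormal 𝕜 U)
    (x : EuclideanSpace 𝕜 (Fin n)) : ∑ i, inner 𝕜 (U i) x • U i = x := by
  have h : Orthonormal 𝕜 ((Set.univ : Set (Fin n)).domRestrict U) :=
    hU.comp _ Subtype.val_injective
  obtain ⟨b, hb⟩ := h.exists_orthonormalBasis_extension_of_card_eq (by simp)
  have : (b : Fin n → EuclideanSpace 𝕜 (Fin n)) = U := funext fun i => hb i trivial
  rw [← this]
  exact b.sum_repr' x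

theorem sum_dyad {U : Fin n → EuclideanSpace 𝕜 (Fin n)} (hU : Orthonormal 𝕜 U) :
    ∑ i, dyad (U i) = 1 := by
  have := frameDiag_one hU
  rw [frameDiag_eq_sum] at this
  simpa using this

/-- A function of frames that is unchanged under modifications of two frame vectors is constant.
The last `n - k` vectors are adjusted one after the other: to replace the vector `x` at place `k`
by `y`, a unit vector orthogonal to both is first moved to place `0` and then swapped in. -/
theorem eq_of_two_step {Y : Type*} (hn : 3 ≤ n) (F : (Fin n → EuclideanSpace 𝕜 (Fin n)) → Y)
    (hF : ∀ U V, Orthonormal 𝕜 U → Orthonormal 𝕜 V → ∀ i j, i ≠ j →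
      (∀ l, l ≠ i → l ≠ j → U l = V l) → F U = F V)
    {U V : Fin n → EuclideanSpace 𝕜 (Fin n)} (hU : Orthonormal 𝕜 U) (hV : Orthonormal 𝕜 V) :
    F U = F V := by
  suffices h : ∀ k ≤ n, ∀ U V, Orthonormal 𝕜 U → Orthonormal 𝕜 V →
      (∀ j : Fin n, k ≤ j → U j = V j) → F U = F V from
    h n le_rfl U V hU hV fun j hj => absurd j.2 (by omega)
  intro k
  induction k with
  | zero => intro _ U V hU hV h; rw [funext fun j => h j (Nat.zero_le _)]
  | succ k ih =>
    intro hk U V hU hV h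
    set i0 : Fin n := ⟨0, by omega⟩ with hi0
    set i1 : Fin n := ⟨1, by omega⟩ with hi1
    by_cases hk2 : k < 2
    · refine hF U V hU hV i0 i1 (by simp [hi0, hi1]) fun l hl0 hl1 => h l ?_
      simp only [hi0, hi1, ne_eq, Fin.ext_iff] at hl0 hl1
      omega
    set ik : Fin n := ⟨k, by omega⟩ with hik
    have hk0 : ik ≠ i0 := by simp [hik, hi0]; omega
    -- a unit vector orthogonal to `U k`, `V k` and the vectors after place `k`
    obtain ⟨z, hz, hzV, hzU⟩ : ∃ z : EuclideanSpace 𝕜 (Fin n), ‖z‖ = 1 ∧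
        inner 𝕜 z (V ik) = 0 ∧ ∀ j : Fin n, k ≤ j → inner 𝕜 z (U j) = 0 := by
      set g : {j : Fin n // j ≠ i1} → EuclideanSpace 𝕜 (Fin n) :=
        fun j => if j.1 = i0 then V ik else U j.1 with hg
      have hlt : Submodule.span 𝕜 (Set.range g) ≠ ⊤ := by
        intro h
        have h1 := finrank_range_le_card (R := 𝕜) g
        rw [Set.finrank, h, finrank_top, finrank_euclideanSpace] at h1
        simp at h1
        omega
      have hne : (Submodule.span 𝕜 (Set.range g))ᗮ ≠ ⊥ := fun h =>
        hlt (Submodule.orthogonal_eq_bot_iff.1 h)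
      obtain ⟨y, hyW, hy⟩ := (Submodule.ne_bot_iff _).1 hne
      have hyg : ∀ j, inner 𝕜 y (g j) = 0 := fun j =>
        (Submodule.mem_orthogonal' _ _).1 hyW _ (Submodule.subset_span ⟨j, rfl⟩)
      refine ⟨(‖y‖ : 𝕜)⁻¹ • y, norm_smul_inv_norm hy, ?_, fun j hj => ?_⟩
      · have := hyg ⟨i0, by simp [hi0, hi1]⟩
        simp only [hg, if_true] at this
        rw [inner_smul_left, this, mul_zero]
      · have hj1 : j ≠ i1 := by simp only [hi1, ne_eq, Fin.ext_iff]; omega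
        have hj0 : j ≠ i0 := by simp only [hi0, ne_eq, Fin.ext_iff]; omega
        have := hyg ⟨j, hj1⟩
        simp only [hg, hj0, if_false] at this
        rw [inner_smul_left, this, mul_zero]
    have key : ∀ W : Fin n → EuclideanSpace 𝕜 (Fin n), Orthonormal 𝕜 W →
        (∀ j : Fin n, k ≤ j → inner 𝕜 z (W j) = 0) →
        ∃ W', Orthonormal 𝕜 W' ∧ W' ik = z ∧ (∀ j : Fin n, k + 1 ≤ j → W' j = W j) ∧
          F W = F W' := by
      intro W hW hzW
      obtain ⟨W₁, hW₁, hs⟩ := exists_frame (Function.update W i0 z) (insert i0 {j | k ≤ j.1}) (by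
        have hj0 : ∀ j : Fin n, k ≤ j → j ≠ i0 := fun j hj => by
          simp only [hi0, ne_eq, Fin.ext_iff]; omega
        have hone : inner 𝕜 z z = (1 : 𝕜) := by rw [inner_self_eq_norm_sq_to_K, hz]; simp
        rintro i (rfl | hi) j (rfl | hj)
        · simp only [Function.update_self, hone, if_true]
        · simp [hj0 j hj, (hj0 j hj).symm, hzW j hj]
        · have := hzW i hi
          rw [← inner_conj_symm, map_eq_zero] at this
          simp [hj0 i hi, this]
        · simp [hj0 i hi, hj0 j hj, orthonormal_iff_ite.1 hW])
      refine ⟨W₁ ∘ Equiv.swap i0 ik, hW₁.comp _ (Equiv.swap i0 ik).injective, ?_, ?_, ?_⟩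
      · simp [hs i0 (Or.inl rfl)]
      · intro j hj
        have hj0 : j ≠ i0 := by simp only [hi0, ne_eq, Fin.ext_iff]; omega
        have hjk : j ≠ ik := by simp only [hik, ne_eq, Fin.ext_iff]; omega
        have hjs := hs j (Or.inr (show k ≤ j.1 by omega))
        simp [Equiv.swap_apply_of_ne_of_ne hj0 hjk, hjs, hj0]
      · have e1 : F W = F W₁ := by
          refine ih (by omega) W W₁ hW hW₁ fun j hj => ?_
          have hj0 : j ≠ i0 := by simp only [hi0, ne_eq, Fin.ext_iff]; omega
          rw [hs j (Or.inr hj), Function.update_of_ne hj0]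
        rw [e1]
        refine hF _ _ hW₁ (hW₁.comp _ (Equiv.swap i0 ik).injective) i0 ik hk0.symm
          fun l h0 h1 => ?_
        simp [Equiv.swap_apply_of_ne_of_ne h0 h1]
    obtain ⟨U', hU', hU'k, hU'j, hUF⟩ := key U hU hzU
    obtain ⟨V', hV', hV'k, hV'j, hVF⟩ := key V hV fun j hj => by
      rcases Nat.eq_or_lt_of_le hj with h1 | h1
      · have : j = ik := Fin.ext h1.symm
        rw [this, hzV]
      · rw [← h j h1, hzU j hj]
    rw [hUF, hVF]
    refine ih (by omega) U' V' hU' hV' fun j hj => ?_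
    rcases Nat.eq_or_lt_of_le hj with h1 | h1
    · have : j = ik := Fin.ext h1.symm
      rw [this, hU'k, hV'k]
    · rw [hU'j j h1, hV'j j h1, h j h1]

theorem isPreconnected_unitSphere :
    IsPreconnected (Metric.sphere (0 : EuclideanSpace 𝕜 (Fin 2)) 1) := by
  refine isPreconnected_sphere ?_ 0 1
  have hli : LinearIndependent ℝ (EuclideanSpace.basisFun (Fin 2) 𝕜).toBasis :=
    (EuclideanSpace.basisFun (Fin 2) 𝕜).toBasis.linearIndependent.restrict_scalars
      (smul_left_injective ℝ one_ne_zero)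
  have h := hli.cardinal_lift_le_rank
  have h2 : (2 : Cardinal) ≤ Module.rank ℝ (EuclideanSpace 𝕜 (Fin 2)) := by simpa using h
  exact lt_of_lt_of_le (by norm_num) h2

/-- Replace the frame vectors `U a`, `U b` by `x₀ U a + x₁ U b` and
`- conj x₁ U a + conj x₀ U b`. -/
noncomputable def rotateFrame (U : Fin n → EuclideanSpace 𝕜 (Fin n)) (a b : Fin n)
    (x : EuclideanSpace 𝕜 (Fin 2)) : Fin n → EuclideanSpace 𝕜 (Fin n) :=
  fun l => if l = a then x 0 • U a + x 1 • U b else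
    if l = b then -star (x 1) • U a + star (x 0) • U b else U l

theorem continuous_rotateFrame (U : Fin n → EuclideanSpace 𝕜 (Fin n)) (a b : Fin n) :
    Continuous (rotateFrame U a b) := by
  refine continuous_pi fun l => ?_
  unfold rotateFrame
  split_ifs <;> fun_prop

theorem orthonormal_rotateFrame {U : Fin n → EuclideanSpace 𝕜 (Fin n)} (hU : Orthonormal 𝕜 U)
    {a b : Fin n} (hab : a ≠ b) {x : EuclideanSpace 𝕜 (Fin 2)} (hx : ‖x‖ = 1) :
    Orthonormal 𝕜 (rotateFrame U a b x) := by
  have h := orthonormal_iff_ite.1 hU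
  have hx' : star (x 0) * x 0 + star (x 1) * x 1 = 1 := by
    have : inner 𝕜 x x = (1 : 𝕜) := by rw [inner_self_eq_norm_sq_to_K, hx]; simp
    rw [PiLp.inner_apply, Fin.sum_univ_two, RCLike.inner_apply, RCLike.inner_apply] at this
    simp only [RCLike.star_def]
    linear_combination this
  have hx'' : x 0 * star (x 0) + x 1 * star (x 1) = 1 := by linear_combination hx'
  rw [orthonormal_iff_ite]
  intro i j
  simp only [RCLike.star_def] at hx' hx''
  have hba := hab.symm
  by_cases hia : i = a
  · subst hia
    by_cases hja : j = i
    · subst hja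
      simp only [rotateFrame, if_true, inner_add_left, inner_add_right, inner_smul_left,
        inner_smul_right, h, hab, hba, if_false]
      linear_combination hx'
    by_cases hjb : j = b
    · subst hjb
      simp only [rotateFrame, if_true, inner_add_left, inner_add_right, inner_smul_left,
        inner_smul_right, h, hab, hba, if_false, RCLike.star_def]
      ring
    · simp only [rotateFrame, if_true, inner_add_left, inner_smul_left, h, if_false, hja, hjb,
        Ne.symm hja, Ne.symm hjb, mul_zero, add_zero]
  by_cases hib : i = b
  · subst hib
    by_cases hja : j = a
    · subst hja
      simp only [rotateFrame, if_true, inner_add_left, inner_add_right, inner_smul_left,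
        inner_smul_right, h, hab, hba, if_false, RCLike.star_def, map_neg, RCLike.conj_conj]
      ring
    by_cases hjb : j = i
    · subst hjb
      simp only [rotateFrame, if_true, inner_add_left, inner_add_right, inner_smul_left,
        inner_smul_right, h, hab, hba, if_false, RCLike.star_def, map_neg, RCLike.conj_conj]
      linear_combination hx'
    · simp only [rotateFrame, if_true, inner_add_left, inner_smul_left, h, if_false, hja, hjb, hba,
        Ne.symm hja, Ne.symm hjb, mul_zero, add_zero]
  by_cases hja : j = a
  · subst hja
    simp only [rotateFrame, if_true, inner_add_right, inner_smul_right, h, if_false, hia, hib,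
      mul_zero, add_zero]
  by_cases hjb : j = b
  · subst hjb
    simp only [rotateFrame, if_true, inner_add_right, inner_smul_right, h, if_false, hia, hib, hba,
      mul_zero, add_zero]
  · simp only [rotateFrame, if_false, hia, hib, hja, hjb, h]

/-- A frame that agrees with `U` off two indices is, up to the phase of one of its vectors, a
rotation of `U`. -/
theorem exists_rotateFrame {U V : Fin n → EuclideanSpace 𝕜 (Fin n)} (hU : Orthonormal 𝕜 U)
    (hV : Orthonormal 𝕜 V) {a b : Fin n} (hab : a ≠ b) (h : ∀ l, l ≠ a → l ≠ b → U l = V l) :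
    ∃ x : EuclideanSpace 𝕜 (Fin 2), ‖x‖ = 1 ∧ ∀ l, dyad (rotateFrame U a b x l) = dyad (V l) := by
  set x : EuclideanSpace 𝕜 (Fin 2) := !₂[inner 𝕜 (U a) (V a), inner 𝕜 (U b) (V a)] with hx
  have hVa : V a = x 0 • U a + x 1 • U b := by
    rw [← sum_inner_smul hU (V a), ← Finset.add_sum_erase _ _ (Finset.mem_univ a),
      Finset.sum_eq_single b]
    · simp [hx]
    · intro l hl hlb
      have hla := Finset.ne_of_mem_erase hl
      rw [h l hla hlb, orthonormal_iff_ite.1 hV, if_neg hla, zero_smul]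
    · intro hb
      exact absurd (Finset.mem_erase.2 ⟨hab.symm, Finset.mem_univ b⟩) hb
  have hxn : ‖x‖ = 1 := by
    have h1 : ‖V a‖ ^ 2 = ‖x‖ ^ 2 := by
      have e := orthonormal_iff_ite.1 hU
      have h2 : inner 𝕜 (V a) (V a) = inner 𝕜 x x := by
        rw [hVa, PiLp.inner_apply x x, Fin.sum_univ_two, RCLike.inner_apply, RCLike.inner_apply]
        simp only [inner_add_left, inner_add_right, inner_smul_left, inner_smul_right, e, hab,
          hab.symm, if_true, if_false]
        ring
      rw [inner_self_eq_norm_sq_to_K, inner_self_eq_norm_sq_to_K] at h2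
      exact_mod_cast h2
    rw [hV.1 a, one_pow] at h1
    exact (pow_eq_one_iff_of_nonneg (norm_nonneg x) two_ne_zero).1 h1.symm
  refine ⟨x, hxn, ?_⟩
  set W := rotateFrame U a b x with hW
  have hWon : Orthonormal 𝕜 W := orthonormal_rotateFrame hU hab hxn
  have hWa : W a = V a := by rw [hVa]; simp [hW, rotateFrame]
  have hWl : ∀ l, l ≠ b → dyad (W l) = dyad (V l) := by
    intro l hlb
    by_cases hla : l = a
    · rw [hla, hWa]
    · rw [← h l hla hlb]; simp [hW, rotateFrame, hla, hlb]
  intro l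
  by_cases hlb : l = b
  · subst hlb
    have h1 := (sum_dyad hWon).trans (sum_dyad hV).symm
    rw [← Finset.add_sum_erase _ _ (Finset.mem_univ l),
      ← Finset.add_sum_erase _ (fun i => dyad (V i)) (Finset.mem_univ l),
      Finset.sum_congr rfl fun i hi => hWl i (Finset.ne_of_mem_erase hi)] at h1
    exact add_right_cancel h1
  · exact hWl l hlb

/-! ### Maps on flags -/

/-- The orthogonal projection onto the span of the first `k` vectors of the frame `U`. -/
def initialProj (U : Fin n → EuclideanSpace 𝕜 (Fin n)) (k : ℕ) : Matrix (Fin n) (Fin n) 𝕜 :=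
  frameDiag U fun i => if (i : ℕ) < k then 1 else 0

theorem initialProj_eq_sum (U : Fin n → EuclideanSpace 𝕜 (Fin n)) (k : ℕ) :
    initialProj U k = ∑ i : Fin n, if (i : ℕ) < k then dyad (U i) else 0 := by
  rw [initialProj, frameDiag_eq_sum]
  simp only [ite_smul, one_smul, zero_smul]

theorem initialProj_congr {U V : Fin n → EuclideanSpace 𝕜 (Fin n)}
    (h : ∀ l, dyad (U l) = dyad (V l)) (k : ℕ) : initialProj U k = initialProj V k := by
  simp only [initialProj_eq_sum, h]

theorem initialProj_one (U : Fin n → EuclideanSpace 𝕜 (Fin n)) (hn : 0 < n) :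
    initialProj U 1 = dyad (U ⟨0, hn⟩) := by
  rw [initialProj_eq_sum, Finset.sum_eq_single ⟨0, hn⟩]
  · simp
  · intro i _ hi
    rw [if_neg]
    simp only [ne_eq, Fin.ext_iff] at hi
    omega
  · simp

theorem initialProj_eq_of_agree {U V : Fin n → EuclideanSpace 𝕜 (Fin n)} (hU : Orthonormal 𝕜 U)
    (hV : Orthonormal 𝕜 V) {a b : Fin n} (h : ∀ l, l ≠ a → l ≠ b → U l = V l) {k : ℕ}
    (hk : (a : ℕ) < k ↔ (b : ℕ) < k) : initialProj U k = initialProj V k := by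
  by_cases hb : (b : ℕ) < k
  · have ha := hk.2 hb
    have key : ∀ W : Fin n → EuclideanSpace 𝕜 (Fin n), Orthonormal 𝕜 W →
        initialProj W k = 1 - ∑ i : Fin n, if (i : ℕ) < k then 0 else dyad (W i) := by
      intro W hW
      rw [initialProj_eq_sum, eq_sub_iff_add_eq, ← Finset.sum_add_distrib, ← sum_dyad hW]
      refine Finset.sum_congr rfl fun i _ => ?_
      split_ifs <;> simp
    rw [key U hU, key V hV]
    congr 1
    refine Finset.sum_congr rfl fun i _ => ?_
    split_ifs with hi
    · rfl
    · rw [h i (fun e => hi (e ▸ ha)) (fun e => hi (e ▸ hb))]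
  · have ha : ¬ (a : ℕ) < k := fun ha => hb (hk.1 ha)
    rw [initialProj_eq_sum, initialProj_eq_sum]
    refine Finset.sum_congr rfl fun i _ => ?_
    split_ifs with hi
    · rw [h i (fun e => ha (e ▸ hi)) (fun e => hb (e ▸ hi))]
    · rfl

/-- A map from initial projections of frames to complex matrices that sends every flag of
subspaces to a flag of commuting idempotents with ranks `0, 1, …, n`, is continuous and preserves
commutativity. -/
structure IsFlagMap (Ψ : Matrix (Fin n) (Fin n) 𝕜 → Matrix (Fin n) (Fin n) ℂ) : Prop where
  exists_conj : ∀ U, Orthonormal 𝕜 U → ∃ S : (Matrix (Fin n) (Fin n) ℂ)ˣ, ∀ k : ℕ,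
    Ψ (initialProj U k) =
      S.1 * Matrix.diagonal (fun i : Fin n => if (i : ℕ) < k then 1 else 0) * S⁻¹.1
  continuousOn : ContinuousOn Ψ {P | ∃ U, Orthonormal 𝕜 U ∧ ∃ k, P = initialProj U k}
  commute : ∀ U V, Orthonormal 𝕜 U → Orthonormal 𝕜 V → ∀ k l,
    Commute (initialProj U k) (initialProj V l) →
      Commute (Ψ (initialProj U k)) (Ψ (initialProj V l))

/-- The `i`-th step of the flag of idempotents associated with the frame `U`. -/
def flagStep (Ψ : Matrix (Fin n) (Fin n) 𝕜 → Matrix (Fin n) (Fin n) ℂ)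
    (U : Fin n → EuclideanSpace 𝕜 (Fin n)) (i : Fin n) : Matrix (Fin n) (Fin n) ℂ :=
  Ψ (initialProj U (i + 1)) - Ψ (initialProj U i)

theorem flagStep_eq_conj {Ψ : Matrix (Fin n) (Fin n) 𝕜 → Matrix (Fin n) (Fin n) ℂ}
    {U : Fin n → EuclideanSpace 𝕜 (Fin n)} {S : (Matrix (Fin n) (Fin n) ℂ)ˣ}
    (hS : ∀ k : ℕ, Ψ (initialProj U k) =
      S.1 * Matrix.diagonal (fun i : Fin n => if (i : ℕ) < k then 1 else 0) * S⁻¹.1) (i : Fin n) :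
    flagStep Ψ U i = S.1 * Matrix.diagonal (Pi.single i 1) * S⁻¹.1 := by
  rw [flagStep, hS, hS, ← sub_mul, ← mul_sub, Matrix.diagonal_sub]
  congr 3
  ext j
  rcases lt_trichotomy j.1 i.1 with h | h | h
  · have : j ≠ i := Fin.ne_of_lt h
    simp [this, h, Nat.lt_succ_of_lt h]
  · have : j = i := Fin.ext h
    simp [this]
  · have : j ≠ i := (Fin.ne_of_lt h).symm
    have h2 : ¬ j.1 < i.1 + 1 := by omega
    simp [this, h.not_gt, h2]

namespace IsFlagMap

variable {Ψ : Matrix (Fin n) (Fin n) 𝕜 → Matrix (Fin n) (Fin n) ℂ}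
  {U : Fin n → EuclideanSpace 𝕜 (Fin n)}

theorem isRankOneIdempotent_flagStep (hΨ : IsFlagMap Ψ) (hU : Orthonormal 𝕜 U) (i : Fin n) :
    IsRankOneIdempotent (flagStep Ψ U i) := by
  obtain ⟨S, hS⟩ := hΨ.exists_conj U hU
  rw [flagStep_eq_conj hS]
  exact (isRankOneIdempotent_single i).conj S

theorem flagStep_mul_flag (hΨ : IsFlagMap Ψ) (hU : Orthonormal 𝕜 U) (i : Fin n) (k : ℕ) :
    flagStep Ψ U i * Ψ (initialProj U k) = if (i : ℕ) < k then flagStep Ψ U i else 0 := by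
  obtain ⟨S, hS⟩ := hΨ.exists_conj U hU
  rw [flagStep_eq_conj hS, hS]
  simp only [mul_assoc, Units.inv_mul_cancel_left]
  rw [← mul_assoc (Matrix.diagonal _), Matrix.diagonal_mul_diagonal]
  split_ifs with h
  · congr 3
    ext j
    by_cases hj : j = i
    · subst hj; simp [h]
    · simp [hj]
  · have : (fun j => (Pi.single i 1 : Fin n → ℂ) j * if (j : ℕ) < k then (1 : ℂ) else 0) = 0 := by
      ext j
      by_cases hj : j = i
      · subst hj; simp [h]
      · simp [hj]
    rw [this, Matrix.diagonal_zero', zero_mul, mul_zero]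

theorem flagStep_mul_flagStep (hΨ : IsFlagMap Ψ) (hU : Orthonormal 𝕜 U) {i j : Fin n}
    (hij : i ≠ j) : flagStep Ψ U i * flagStep Ψ U j = 0 := by
  rw [flagStep.eq_def Ψ U j, mul_sub, hΨ.flagStep_mul_flag hU, hΨ.flagStep_mul_flag hU]
  have : (i : ℕ) < j + 1 ↔ (i : ℕ) < j := by
    have := Fin.val_ne_of_ne hij
    omega
  simp only [this, sub_self]

theorem flagStep_injective (hΨ : IsFlagMap Ψ) (hU : Orthonormal 𝕜 U) {i j : Fin n}
    (h : flagStep Ψ U i = flagStep Ψ U j) : i = j := by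
  by_contra hij
  have h1 := hΨ.flagStep_mul_flagStep hU hij
  rw [← h, (hΨ.isRankOneIdempotent_flagStep hU i).mul_self] at h1
  exact (hΨ.isRankOneIdempotent_flagStep hU i).ne_zero h1

theorem flag_eq_sum (hΨ : IsFlagMap Ψ) (hU : Orthonormal 𝕜 U) (k : ℕ) :
    Ψ (initialProj U k) = ∑ i : Fin n, if (i : ℕ) < k then flagStep Ψ U i else 0 := by
  obtain ⟨S, hS⟩ := hΨ.exists_conj U hU
  simp only [← hΨ.flagStep_mul_flag hU]
  rw [← Finset.sum_mul]
  have : ∑ i, flagStep Ψ U i = 1 := by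
    simp only [flagStep_eq_conj hS]
    rw [← Finset.sum_mul, ← Finset.mul_sum]
    have : ∑ i : Fin n, Matrix.diagonal (Pi.single i (1 : ℂ)) = 1 := by
      ext a b
      simp only [Matrix.sum_apply, Matrix.diagonal_apply, Matrix.one_apply]
      split_ifs <;> simp [Pi.single_apply]
    rw [this, mul_one, Units.mul_inv]
  rw [this, one_mul]

theorem sum_flagStep (hΨ : IsFlagMap Ψ) (hU : Orthonormal 𝕜 U) : ∑ i, flagStep Ψ U i = 1 := by
  have h := hΨ.flag_eq_sum hU n
  obtain ⟨S, hS⟩ := hΨ.exists_conj U hU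
  rw [hS] at h
  simp only [Fin.is_lt, if_true, Matrix.diagonal_one, mul_one, Units.mul_inv] at h
  exact h.symm

theorem commute_flagStep (hΨ : IsFlagMap Ψ) (hU : Orthonormal 𝕜 U) (σ : Equiv.Perm (Fin n))
    (i j : Fin n) : Commute (flagStep Ψ (U ∘ σ) i) (flagStep Ψ U j) := by
  have hUσ : Orthonormal 𝕜 (U ∘ σ) := hU.comp _ σ.injective
  have h : ∀ k l, Commute (Ψ (initialProj (U ∘ σ) k)) (Ψ (initialProj U l)) := by
    intro k l
    refine hΨ.commute _ _ hUσ hU k l ?_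
    have : initialProj (U ∘ σ) k =
        frameDiag U fun i => if ((σ.symm i : Fin n) : ℕ) < k then 1 else 0 := by
      rw [initialProj_eq_sum, frameDiag_eq_sum]
      conv_rhs => rw [← Equiv.sum_comp σ]
      simp
    rw [this]
    exact frameDiag_commute hU _ _
  exact ((h _ _).sub_right (h _ _)).sub_left ((h _ _).sub_right (h _ _))

/-- Exchanging two consecutive frame vectors affects at most the two corresponding steps. -/
theorem flag_swap (hU : Orthonormal 𝕜 U) {i j : Fin n} (hij : (j : ℕ) = i + 1) {k : ℕ}
    (hk : k ≠ j) : initialProj (U ∘ Equiv.swap i j) k = initialProj U k := by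
  refine initialProj_eq_of_agree (a := i) (b := j) (hU.comp _ (Equiv.swap i j).injective) hU
    (fun l h1 h2 => by simp [Equiv.swap_apply_of_ne_of_ne h1 h2]) (by omega)

theorem flagStep_swap_of_ne (hU : Orthonormal 𝕜 U) {i j : Fin n} (hij : (j : ℕ) = i + 1)
    {l : Fin n} (hli : l ≠ i) (hlj : l ≠ j) :
    flagStep Ψ (U ∘ Equiv.swap i j) l = flagStep Ψ U l := by
  have h1 := Fin.val_ne_of_ne hli
  have h2 := Fin.val_ne_of_ne hlj
  rw [flagStep, flagStep, flag_swap hU hij (by omega), flag_swap hU hij (by omega)]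

theorem flagStep_swap_add (hU : Orthonormal 𝕜 U) {i j : Fin n} (hij : (j : ℕ) = i + 1) :
    flagStep Ψ (U ∘ Equiv.swap i j) i + flagStep Ψ (U ∘ Equiv.swap i j) j =
      flagStep Ψ U i + flagStep Ψ U j := by
  have h : ∀ V : Fin n → EuclideanSpace 𝕜 (Fin n), flagStep Ψ V i + flagStep Ψ V j =
      Ψ (initialProj V (j + 1)) - Ψ (initialProj V i) := by
    intro V
    simp only [flagStep, hij]
    abel
  rw [h, h, flag_swap hU hij (by omega), flag_swap hU hij (by omega)]

/-- Exchanging two consecutive frame vectors either leaves all steps unchanged or exchanges the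
two corresponding steps. -/
theorem flagStep_swap (hΨ : IsFlagMap Ψ) (hU : Orthonormal 𝕜 U) {i j : Fin n}
    (hij : (j : ℕ) = i + 1) :
    (flagStep Ψ (U ∘ Equiv.swap i j) i = flagStep Ψ U i ∧
      flagStep Ψ (U ∘ Equiv.swap i j) j = flagStep Ψ U j) ∨
    (flagStep Ψ (U ∘ Equiv.swap i j) i = flagStep Ψ U j ∧
      flagStep Ψ (U ∘ Equiv.swap i j) j = flagStep Ψ U i) := by
  have hne : i ≠ j := fun h => by rw [h] at hij; omega
  have hUs : Orthonormal 𝕜 (U ∘ Equiv.swap i j) := hU.comp _ (Equiv.swap i j).injective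
  have hadd := flagStep_swap_add (Ψ := Ψ) hU hij
  set R := flagStep Ψ (U ∘ Equiv.swap i j) i with hR
  have hRr : IsRankOneIdempotent R := hΨ.isRankOneIdempotent_flagStep hUs i
  have hmul : R * flagStep Ψ U i + R * flagStep Ψ U j = R := by
    rw [← mul_add, ← hadd, mul_add, hRr.mul_self, hR, hΨ.flagStep_mul_flagStep hUs hne, add_zero]
  by_cases h0 : R * flagStep Ψ U i = 0
  · right
    have h1 : R * flagStep Ψ U j ≠ 0 := fun h => hRr.ne_zero (by rw [← hmul, h0, h, add_zero])
    have h2 := hRr.eq_of_commute (hΨ.isRankOneIdempotent_flagStep hU j)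
      (hΨ.commute_flagStep hU _ _ _) h1
    refine ⟨h2, ?_⟩
    rw [h2, add_comm (flagStep Ψ U i)] at hadd
    exact add_left_cancel hadd
  · left
    have h2 := hRr.eq_of_commute (hΨ.isRankOneIdempotent_flagStep hU i)
      (hΨ.commute_flagStep hU _ _ _) h0
    refine ⟨h2, ?_⟩
    rw [h2] at hadd
    exact add_left_cancel hadd

theorem initialProj_mem (hU : Orthonormal 𝕜 U) (k : ℕ) :
    initialProj U k ∈ {P | ∃ U, Orthonormal 𝕜 U ∧ ∃ k, P = initialProj U k} := ⟨U, hU, k, rfl⟩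

theorem continuous_flagStep (hΨ : IsFlagMap Ψ) {S : Type*} [TopologicalSpace S]
    {W : S → Fin n → EuclideanSpace 𝕜 (Fin n)} (hW : Continuous W)
    (hWo : ∀ s, Orthonormal 𝕜 (W s)) (i : Fin n) : Continuous fun s => flagStep Ψ (W s) i := by
  have h : ∀ k, Continuous fun s => Ψ (initialProj (W s) k) := by
    intro k
    refine hΨ.continuousOn.comp_continuous ?_ fun s => initialProj_mem (hWo s) k
    simp only [initialProj, frameDiag_eq_sum]
    exact continuous_finsetSum _ fun i _ => Continuous.const_smul
      (continuous_dyad.comp ((continuous_apply i).comp hW)) (if (i : ℕ) < k then (1 : 𝕜) else 0)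
  exact (h _).sub (h _)

/-- Whether an exchange of two consecutive frame vectors exchanges the corresponding steps does not
depend on the frame: the trace of the product of the old and the new step takes the values `1` and
`0` in the two cases and varies continuously. -/
theorem swap_fixes_iff (hΨ : IsFlagMap Ψ) (hn : 3 ≤ n) (hU : Orthonormal 𝕜 U)
    {V : Fin n → EuclideanSpace 𝕜 (Fin n)} (hV : Orthonormal 𝕜 V) {i j : Fin n}
    (hij : (j : ℕ) = i + 1) :
    (flagStep Ψ (U ∘ Equiv.swap i j) i = flagStep Ψ U i) =
      (flagStep Ψ (V ∘ Equiv.swap i j) i = flagStep Ψ V i) := by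
  have hne : i ≠ j := fun h => by rw [h] at hij; omega
  refine eq_of_two_step hn (fun W => flagStep Ψ (W ∘ Equiv.swap i j) i = flagStep Ψ W i) ?_ hU hV
  intro U V hU hV a b hab h
  obtain ⟨x, hx, hxV⟩ := exists_rotateFrame hU hV hab h
  set W : Metric.sphere (0 : EuclideanSpace 𝕜 (Fin 2)) 1 → Fin n → EuclideanSpace 𝕜 (Fin n) :=
    fun x => rotateFrame U a b x with hWdef
  have hW : Continuous W := (continuous_rotateFrame U a b).comp continuous_subtype_val
  have hWo : ∀ x, Orthonormal 𝕜 (W x) := fun x =>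
    orthonormal_rotateFrame hU hab (mem_sphere_zero_iff_norm.1 x.2)
  set τ : Metric.sphere (0 : EuclideanSpace 𝕜 (Fin 2)) 1 → ℂ := fun x =>
    (flagStep Ψ (W x ∘ Equiv.swap i j) i * flagStep Ψ (W x) i).trace with hτ
  have hτc : Continuous τ := by
    refine Continuous.matrix_trace (Continuous.matrix_mul ?_ (hΨ.continuous_flagStep hW hWo i))
    refine hΨ.continuous_flagStep (continuous_pi fun l => ?_)
      (fun s => (hWo s).comp _ (Equiv.swap i j).injective) i
    exact (continuous_apply _).comp hW
  have hτ1 : ∀ y, flagStep Ψ (W y ∘ Equiv.swap i j) i = flagStep Ψ (W y) i → τ y = 1 := by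
    intro y hy
    simp only [hτ, hy]
    rw [(hΨ.isRankOneIdempotent_flagStep (hWo y) i).mul_self]
    exact (hΨ.isRankOneIdempotent_flagStep (hWo y) i).trace_eq_one
  have hτ0 : ∀ y, ¬ flagStep Ψ (W y ∘ Equiv.swap i j) i = flagStep Ψ (W y) i → τ y = 0 := by
    intro y hy
    have h2 := (hΨ.flagStep_swap (hWo y) hij).resolve_left fun h => hy h.1
    simp only [hτ, h2.1]
    rw [hΨ.flagStep_mul_flagStep (hWo y) hne.symm, Matrix.trace_zero]
  have hiff : ∀ y, (flagStep Ψ (W y ∘ Equiv.swap i j) i = flagStep Ψ (W y) i) ↔ τ y = 1 :=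
    fun y => ⟨hτ1 y, fun h => by
      by_contra hy
      rw [hτ0 y hy] at h
      exact zero_ne_one h⟩
  have : PreconnectedSpace (Metric.sphere (0 : EuclideanSpace 𝕜 (Fin 2)) 1) :=
    isPreconnected_iff_preconnectedSpace.1 isPreconnected_unitSphere
  have hconst : ∀ y z, τ y = 1 → τ z = 1 := by
    intro y z hy
    refine eq_of_selection (g := fun (b : Bool) _ => if b then (1 : ℂ) else 0) (i := true) (x₀ := y)
      hτc (fun _ => continuous_const) ?_ ?_ (by simpa using hy) z |>.trans (by simp)
    · intro _ b c hbc
      cases b <;> cases c <;> simp_all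
    · intro w
      by_cases hw : flagStep Ψ (W w ∘ Equiv.swap i j) i = flagStep Ψ (W w) i
      · exact ⟨true, by simpa using hτ1 w hw⟩
      · exact ⟨false, by simpa using hτ0 w hw⟩
  let y : Metric.sphere (0 : EuclideanSpace 𝕜 (Fin 2)) 1 :=
    ⟨EuclideanSpace.single 0 1, by simp⟩
  let z : Metric.sphere (0 : EuclideanSpace 𝕜 (Fin 2)) 1 := ⟨x, by simpa using hx⟩
  have hy : W y = U := by
    ext l : 1
    simp only [hWdef, rotateFrame, y]
    split_ifs with h1 h2
    · simp [h1]
    · simp [h2]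
    · rfl
  have hz1 : flagStep Ψ (W z ∘ Equiv.swap i j) i = flagStep Ψ (V ∘ Equiv.swap i j) i := by
    have h1 : ∀ k, initialProj (W z ∘ Equiv.swap i j) k = initialProj (V ∘ Equiv.swap i j) k :=
      initialProj_congr fun l => hxV _
    simp only [flagStep, h1]
  have hz2 : flagStep Ψ (W z) i = flagStep Ψ V i := by
    have h1 : ∀ k, initialProj (W z) k = initialProj V k := initialProj_congr fun l => hxV _
    simp only [flagStep, h1]
  have e1 := hiff y
  have e2 := hiff z
  rw [hy] at e1
  rw [hz1, hz2] at e2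
  exact propext (e1.trans ((Iff.intro (hconst y z) (hconst z y)).trans e2.symm))

end IsFlagMap

theorem exists_perm_apply_eq {α : Type*} [DecidableEq α] {p q a b : α}
    (hpq : p ≠ q) (hab : a ≠ b) : ∃ σ : Equiv.Perm α, σ p = a ∧ σ q = b := by
  refine ⟨(Equiv.swap q (Equiv.swap p a b)).trans (Equiv.swap p a), ?_, ?_⟩
  · have h : p ≠ Equiv.swap p a b := fun h => by
      have := congrArg (Equiv.swap p a) h
      simp at this
      exact hab this
    simp [Equiv.swap_apply_of_ne_of_ne hpq h]
  · simp

namespace IsFlagMap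

variable {Ψ : Matrix (Fin n) (Fin n) 𝕜 → Matrix (Fin n) (Fin n) ℂ}
  {U : Fin n → EuclideanSpace 𝕜 (Fin n)}

/-- If exchanging the frame vectors `i`, `i + 1` never affects the steps, then the same holds for
`i + 1`, `i + 2`. Otherwise the second exchange always exchanges steps, and the braid relation
between the two exchanges is violated. -/
theorem swap_fixes_succ (hΨ : IsFlagMap Ψ) (hn : 3 ≤ n) {a b c : Fin n} (hab : (b : ℕ) = a + 1)
    (hbc : (c : ℕ) = b + 1)
    (h : ∀ U, Orthonormal 𝕜 U → flagStep Ψ (U ∘ Equiv.swap a b) a = flagStep Ψ U a)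
    (U : Fin n → EuclideanSpace 𝕜 (Fin n)) (hU : Orthonormal 𝕜 U) :
    flagStep Ψ (U ∘ Equiv.swap b c) b = flagStep Ψ U b := by
  by_contra hne
  have hab' : a ≠ b := fun e => by rw [e] at hab; omega
  have hbc' : b ≠ c := fun e => by rw [e] at hbc; omega
  have hac' : a ≠ c := fun e => by rw [e] at hab; omega
  have ho : ∀ (V : Fin n → EuclideanSpace 𝕜 (Fin n)) (i j : Fin n), Orthonormal 𝕜 V →
      Orthonormal 𝕜 (V ∘ Equiv.swap i j) := fun V i j hV => hV.comp _ (Equiv.swap i j).injective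
  have hfix : ∀ V, Orthonormal 𝕜 V → flagStep Ψ (V ∘ Equiv.swap a b) b = flagStep Ψ V b := by
    intro V hV
    have h1 := flagStep_swap_add (Ψ := Ψ) hV hab
    rw [h V hV] at h1
    exact add_left_cancel h1
  have hswap : ∀ V, Orthonormal 𝕜 V →
      flagStep Ψ (V ∘ Equiv.swap b c) b = flagStep Ψ V c ∧
        flagStep Ψ (V ∘ Equiv.swap b c) c = flagStep Ψ V b := by
    intro V hV
    refine (hΨ.flagStep_swap hV hbc).resolve_left fun h1 => hne ?_
    rw [hΨ.swap_fixes_iff hn hU hV hbc]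
    exact h1.1
  have hbraid : ((U ∘ Equiv.swap a b) ∘ Equiv.swap b c) ∘ Equiv.swap a b =
      ((U ∘ Equiv.swap b c) ∘ Equiv.swap a b) ∘ Equiv.swap b c := by
    have : ∀ x, Equiv.swap a b (Equiv.swap b c (Equiv.swap a b x)) =
        Equiv.swap b c (Equiv.swap a b (Equiv.swap b c x)) := by
      intro x
      simp only [Equiv.swap_apply_def]
      grind
    ext x : 1
    simp only [Function.comp, this]
  have h1 : flagStep Ψ (((U ∘ Equiv.swap a b) ∘ Equiv.swap b c) ∘ Equiv.swap a b) b =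
      flagStep Ψ U c := by
    rw [hfix _ (ho _ _ _ (ho _ _ _ hU)), (hswap _ (ho _ _ _ hU)).1,
      flagStep_swap_of_ne hU hab hac'.symm hbc'.symm]
  have h2 : flagStep Ψ (((U ∘ Equiv.swap b c) ∘ Equiv.swap a b) ∘ Equiv.swap b c) b =
      flagStep Ψ U b := by
    rw [(hswap _ (ho _ _ _ (ho _ _ _ hU))).1, flagStep_swap_of_ne (ho _ _ _ hU) hab hac'.symm
      hbc'.symm, (hswap _ hU).2]
  rw [hbraid, h2] at h1
  exact hbc' (hΨ.flagStep_injective hU h1)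

/-- If exchanging the first two frame vectors does not affect the first step, the flag map is
constant: it is invariant under permutations of the frame, so two vectors to be modified may be
placed in positions where the modification does not alter a given member of the flag. -/
theorem flag_const (hΨ : IsFlagMap Ψ) (hn : 3 ≤ n)
    (h : ∀ U, Orthonormal 𝕜 U → flagStep Ψ (U ∘ Equiv.swap (⟨0, by omega⟩ : Fin n) ⟨1, by omega⟩)
      ⟨0, by omega⟩ = flagStep Ψ U ⟨0, by omega⟩)
    {V : Fin n → EuclideanSpace 𝕜 (Fin n)} (hU : Orthonormal 𝕜 U) (hV : Orthonormal 𝕜 V) (k : ℕ) :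
    Ψ (initialProj U k) = Ψ (initialProj V k) := by
  have hfix : ∀ i : ℕ, ∀ hi : i + 1 < n, ∀ U, Orthonormal 𝕜 U →
      flagStep Ψ (U ∘ Equiv.swap (⟨i, by omega⟩ : Fin n) ⟨i + 1, hi⟩) ⟨i, by omega⟩ =
        flagStep Ψ U ⟨i, by omega⟩ := by
    intro i
    induction i with
    | zero => intro _; exact h
    | succ i ih => intro hi; exact hΨ.swap_fixes_succ hn rfl rfl (ih (by omega))
  -- invariance of the flag under transpositions of neighbours, hence under all permutations
  have hswap : ∀ i : ℕ, ∀ hi : i + 1 < n, ∀ U, Orthonormal 𝕜 U → ∀ k,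
      Ψ (initialProj (U ∘ Equiv.swap (⟨i, by omega⟩ : Fin n) ⟨i + 1, hi⟩) k) =
        Ψ (initialProj U k) := by
    intro i hi U hU k
    by_cases hk : k = i + 1
    · have h1 := hfix i hi U hU
      have h2 : Ψ (initialProj (U ∘ Equiv.swap (⟨i, by omega⟩ : Fin n) ⟨i + 1, hi⟩) i) =
          Ψ (initialProj U i) := by
        rw [flag_swap hU rfl (by simp)]
      simp only [flagStep, h2] at h1
      rw [hk]
      exact sub_left_injective h1
    · rw [flag_swap hU rfl (by simpa using hk)]
  have hperm : ∀ σ : Equiv.Perm (Fin n), ∀ U, Orthonormal 𝕜 U → ∀ k,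
      Ψ (initialProj (U ∘ σ) k) = Ψ (initialProj U k) := by
    obtain ⟨m, rfl⟩ : ∃ m, n = m + 1 := ⟨n - 1, by omega⟩
    intro σ
    have hσ : σ ∈ Submonoid.closure (Set.range fun i : Fin m => Equiv.swap i.castSucc i.succ) := by
      rw [Equiv.Perm.mclosure_swap_castSucc_succ]; trivial
    induction hσ using Submonoid.closure_induction with
    | mem σ hσ =>
      obtain ⟨i, rfl⟩ := hσ
      exact hswap i (by omega)
    | one => intro U _ k; rfl
    | mul σ τ _ _ hσ hτ =>
      intro U hU k
      exact (hτ (U ∘ σ) (hU.comp _ σ.injective) k).trans (hσ U hU k)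
  refine congrFun (eq_of_two_step hn (fun W k => Ψ (initialProj W k)) ?_ hU hV) k
  intro U V hU hV a b hab hUV
  ext1 k
  -- if the modified vectors sit at places `p` and `p + 1`, only the `p + 1`st idempotent can change
  have key : ∀ p : ℕ, ∀ hp : p + 1 < n, k ≠ p + 1 →
      Ψ (initialProj U k) = Ψ (initialProj V k) := by
    intro p hp hk
    obtain ⟨σ, hσa, hσb⟩ := exists_perm_apply_eq
      (p := (⟨p, by omega⟩ : Fin n)) (q := ⟨p + 1, hp⟩) (by simp) hab
    rw [← hperm σ U hU, ← hperm σ V hV,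
      initialProj_eq_of_agree (hU.comp _ σ.injective) (hV.comp _ σ.injective)
        (a := ⟨p, by omega⟩) (b := ⟨p + 1, hp⟩) (fun l h1 h2 => ?_) (by simp only; omega)]
    refine hUV _ (fun e => h1 ?_) fun e => h2 ?_
    · rw [← hσa] at e; exact σ.injective e
    · rw [← hσb] at e; exact σ.injective e
  by_cases hk : k = 1
  · exact key 1 (by omega) (by omega)
  · exact key 0 (by omega) hk

/-- If exchanging the first two frame vectors exchanges the first two steps, then every step
depends on the corresponding frame vector only, through one and the same map. By induction, the
first step of the frame with `U j` moved to the front lies in the `j + 1`st member of the flag and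
annihilates the previous steps, hence is the step at `j`. -/
theorem flagStep_eq (hΨ : IsFlagMap Ψ) (hn : 3 ≤ n)
    (h : ∀ U, Orthonormal 𝕜 U → flagStep Ψ (U ∘ Equiv.swap (⟨0, by omega⟩ : Fin n) ⟨1, by omega⟩)
      ⟨0, by omega⟩ ≠ flagStep Ψ U ⟨0, by omega⟩)
    (hU : Orthonormal 𝕜 U) (j : Fin n) : flagStep Ψ U j = Ψ (dyad (U j)) := by
  set i0 : Fin n := ⟨0, by omega⟩ with hi0
  set i1 : Fin n := ⟨1, by omega⟩ with hi1
  have hi01 : i0 ≠ i1 := by simp [hi0, hi1]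
  have hzero : ∀ U, Orthonormal 𝕜 U → Ψ (initialProj U 0) = 0 := by
    intro U hU
    rw [hΨ.flag_eq_sum hU]
    simp
  have hfirst : ∀ U, Orthonormal 𝕜 U → flagStep Ψ U i0 = Ψ (dyad (U i0)) := by
    intro U hU
    simp only [flagStep, hi0, hzero U hU, sub_zero, zero_add]
    rw [initialProj_one U (by omega)]
  have horth : ∀ U : Fin n → EuclideanSpace 𝕜 (Fin n), Orthonormal 𝕜 U → ∀ i j, i ≠ j →
      Ψ (dyad (U i)) * Ψ (dyad (U j)) = 0 := by
    intro U hU i j hij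
    obtain ⟨σ, hσ0, hσ1⟩ := exists_perm_apply_eq hi01 hij.symm
    have hUσ : Orthonormal 𝕜 (U ∘ σ) := hU.comp _ σ.injective
    have h1 := hfirst _ hUσ
    have h2 := hfirst _ (hUσ.comp _ (Equiv.swap i0 i1).injective)
    have h3 := (hΨ.flagStep_swap hUσ (i := i0) (j := i1) rfl).resolve_left fun h4 => h _ hUσ h4.1
    simp only [Function.comp, Equiv.swap_apply_left, hσ0, hσ1] at h1 h2
    rw [← h1, ← h2]
    refine (congrArg (· * _) h3.1).trans ?_
    exact hΨ.flagStep_mul_flagStep hUσ hi01.symm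
  obtain ⟨j, hj⟩ := j
  induction j using Nat.strong_induction_on with
  | _ j ih =>
    set J : Fin n := ⟨j, hj⟩ with hJ
    set V := U ∘ Equiv.swap i0 J with hV
    have hVo : Orthonormal 𝕜 V := hU.comp _ (Equiv.swap i0 J).injective
    have hR : flagStep Ψ V i0 = Ψ (dyad (U J)) := by rw [hfirst V hVo]; simp [hV]
    have hRr := hΨ.isRankOneIdempotent_flagStep hVo i0
    have hc := hΨ.commute_flagStep hU (Equiv.swap i0 J) i0 J
    have h1 : flagStep Ψ V i0 * Ψ (initialProj U (j + 1)) = flagStep Ψ V i0 := by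
      have : initialProj U (j + 1) = initialProj V (j + 1) :=
        initialProj_eq_of_agree (a := i0) (b := J) hU hVo
          (fun l h1 h2 => by simp [hV, Equiv.swap_apply_of_ne_of_ne h1 h2]) (by simp [hi0, hJ])
      rw [this, hΨ.flagStep_mul_flag hVo, if_pos (by simp [hi0])]
    have h2 : flagStep Ψ V i0 * Ψ (initialProj U j) = 0 := by
      rw [hΨ.flag_eq_sum hU, Finset.mul_sum]
      refine Finset.sum_eq_zero fun l _ => ?_
      split_ifs with hl
      · rw [hR, ih l.1 hl l.2, horth U hU _ _ (Fin.ne_of_gt hl)]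
      · rw [mul_zero]
    have h3 : flagStep Ψ V i0 * flagStep Ψ U J = flagStep Ψ V i0 := by
      rw [flagStep.eq_def Ψ U J, mul_sub, h1, h2, sub_zero]
    rw [← hR]
    exact (hRr.eq_of_commute (hΨ.isRankOneIdempotent_flagStep hU J) hc
      (by rw [h3]; exact hRr.ne_zero)).symm

/-- A flag map is constant, or all its steps are given by one map on lines. -/
theorem dichotomy (hΨ : IsFlagMap Ψ) (hn : 3 ≤ n) :
    (∀ U V : Fin n → EuclideanSpace 𝕜 (Fin n), Orthonormal 𝕜 U → Orthonormal 𝕜 V →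
      ∀ k, Ψ (initialProj U k) = Ψ (initialProj V k)) ∨
    (∀ U, Orthonormal 𝕜 U → ∀ j, flagStep Ψ U j = Ψ (dyad (U j))) := by
  by_cases h : ∀ U, Orthonormal 𝕜 U → flagStep Ψ (U ∘ Equiv.swap (⟨0, by omega⟩ : Fin n)
      ⟨1, by omega⟩) ⟨0, by omega⟩ = flagStep Ψ U ⟨0, by omega⟩
  · exact Or.inl fun U V hU hV k => hΨ.flag_const hn h hU hV k
  · push Not at h
    obtain ⟨V, hV, hne⟩ := h
    refine Or.inr fun U hU j => hΨ.flagStep_eq hn (fun W hW => ?_) hU j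
    rw [ne_eq, hΨ.swap_fixes_iff hn hW hV rfl]
    exact hne

end IsFlagMap

/-! ### Orthogonality-preserving maps on lines -/

/-- A continuous assignment of rank-one idempotents to the lines of `𝕜ⁿ`, represented by nonzero
vectors, that sends orthogonal lines to idempotents with product zero, and such that the idempotent
of a line in the plane of two orthogonal lines is dominated by the sum of their idempotents. -/
structure IsLineMap (f : EuclideanSpace 𝕜 (Fin n) → Matrix (Fin n) (Fin n) ℂ) : Prop where
  rankOne : ∀ x, x ≠ 0 → IsRankOneIdempotent (f x)
  orthogonal : ∀ x y, x ≠ 0 → y ≠ 0 → inner 𝕜 x y = 0 → f x * f y = 0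
  sum_mul : ∀ x y, x ≠ 0 → y ≠ 0 → inner 𝕜 x y = 0 → (f x + f y) * f (x + y) = f (x + y)
  mul_sum : ∀ x y, x ≠ 0 → y ≠ 0 → inner 𝕜 x y = 0 → f (x + y) * (f x + f y) = f (x + y)
  smul : ∀ (c : 𝕜) x, c ≠ 0 → x ≠ 0 → f (c • x) = f x
  continuousOn : ContinuousOn f {0}ᶜ

namespace IsLineMap

variable {f : EuclideanSpace 𝕜 (Fin n) → Matrix (Fin n) (Fin n) ℂ}

theorem transpose (hf : IsLineMap f) : IsLineMap fun x => (f x).transpose where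
  rankOne x hx := (hf.rankOne x hx).transpose
  orthogonal x y hx hy h := by
    rw [← Matrix.transpose_mul, hf.orthogonal y x hy hx (inner_eq_zero_symm.1 h),
      Matrix.transpose_zero]
  sum_mul x y hx hy h := by
    rw [← Matrix.transpose_add, ← Matrix.transpose_mul, hf.mul_sum x y hx hy h]
  mul_sum x y hx hy h := by
    rw [← Matrix.transpose_add, ← Matrix.transpose_mul, hf.sum_mul x y hx hy h]
  smul c x hc hx := by rw [hf.smul c x hc hx]
  continuousOn := continuous_id.matrix_transpose.comp_continuousOn hf.continuousOn

theorem conj (hf : IsLineMap f) (S : (Matrix (Fin n) (Fin n) ℂ)ˣ) :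
    IsLineMap fun x => S⁻¹.1 * f x * S.1 where
  rankOne x hx := (hf.rankOne x hx).conj S⁻¹
  orthogonal x y hx hy h := by
    have := hf.orthogonal x y hx hy h
    simp [mul_assoc, ← mul_assoc (f x) (f y), this]
  sum_mul x y hx hy h := by
    have := hf.sum_mul x y hx hy h
    rw [← add_mul, ← mul_add]
    simp only [mul_assoc, Units.mul_inv_cancel_left]
    rw [← mul_assoc (f x + f y), this]
  mul_sum x y hx hy h := by
    have := hf.mul_sum x y hx hy h
    rw [← add_mul, ← mul_add]
    simp only [mul_assoc, Units.mul_inv_cancel_left]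
    rw [← mul_assoc (f (x + y)), this]
  smul c x hc hx := by rw [hf.smul c x hc hx]
  continuousOn := (continuousOn_const.mul hf.continuousOn).mul continuousOn_const

theorem mul_self (hf : IsLineMap f) {x : EuclideanSpace 𝕜 (Fin n)} (hx : x ≠ 0) :
    f x * f x = f x := (hf.rankOne x hx).mul_self

theorem add_ne_zero_of_inner {x y : EuclideanSpace 𝕜 (Fin n)} (hx : x ≠ 0)
    (h : inner 𝕜 x y = 0) : x + y ≠ 0 := fun h0 => by
  have h1 : inner 𝕜 x (x + y) = 0 := by rw [h0, inner_zero_right]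
  rw [inner_add_right, h, add_zero, inner_self_eq_zero] at h1
  exact hx h1

/-- Components of `y + r` along a vector orthogonal to `r` factor through `y`. -/
theorem mul_add_eq (hf : IsLineMap f) {a y r : EuclideanSpace 𝕜 (Fin n)} (ha : a ≠ 0) (hy : y ≠ 0)
    (hyr : inner 𝕜 y r = 0) (har : inner 𝕜 a r = 0) : f a * f (y + r) = f a * f y * f (y + r) := by
  by_cases hr : r = 0
  · rw [hr, add_zero, mul_assoc, hf.mul_self hy]
  · conv_lhs => rw [← hf.sum_mul y r hy hr hyr]
    rw [← mul_assoc, mul_add, hf.orthogonal a r ha hr har, add_zero]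

theorem exists_ne_zero_orthogonal (hn : 3 ≤ n) (a b : EuclideanSpace 𝕜 (Fin n)) :
    ∃ c : EuclideanSpace 𝕜 (Fin n), c ≠ 0 ∧ inner 𝕜 a c = 0 ∧ inner 𝕜 b c = 0 := by
  have hlt : Submodule.span 𝕜 (Set.range ![a, b]) ≠ ⊤ := by
    intro h
    have h1 := finrank_range_le_card (R := 𝕜) ![a, b]
    rw [Set.finrank, h, finrank_top, finrank_euclideanSpace] at h1
    simp at h1
    omega
  have hne : (Submodule.span 𝕜 (Set.range ![a, b]))ᗮ ≠ ⊥ := fun h =>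
    hlt (Submodule.orthogonal_eq_bot_iff.1 h)
  obtain ⟨c, hcW, hc⟩ := (Submodule.ne_bot_iff _).1 hne
  rw [Submodule.mem_orthogonal] at hcW
  exact ⟨c, hc, hcW a (Submodule.subset_span ⟨0, rfl⟩), hcW b (Submodule.subset_span ⟨1, rfl⟩)⟩

/-- If the line of `a + b` is mapped to the range of `f a`, then so are the lines of `a + τ c`
for all small `τ`, where `c` is orthogonal to `a` and `b`. -/
theorem eventually_mul_eq_zero (hf : IsLineMap f) {a b c : EuclideanSpace 𝕜 (Fin n)} (ha : a ≠ 0)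
    (hb : b ≠ 0) (hc : c ≠ 0) (hab : inner 𝕜 a b = 0) (hac : inner 𝕜 a c = 0)
    (hbc : inner 𝕜 b c = 0) (h : f b * f (a + b) = 0) :
    ∀ᶠ τ : ℝ in nhds 0, f c * f (a + (τ : 𝕜) • c) = 0 := by
  have hbτ : ∀ τ : 𝕜, b + τ • c ≠ 0 := fun τ =>
    add_ne_zero_of_inner hb (by rw [inner_smul_right, hbc, mul_zero])
  have hcont : Continuous fun τ : ℝ => f b * f (b + (τ : 𝕜) • c) := by
    refine continuous_const.mul (hf.continuousOn.comp_continuous ?_ fun τ => hbτ _)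
    exact continuous_const.add (by fun_prop)
  have hne : ∀ᶠ τ : ℝ in nhds 0, f b * f (b + (τ : 𝕜) • c) ≠ 0 := by
    refine hcont.continuousAt.eventually_ne ?_
    simp only [RCLike.ofReal_zero, zero_smul, add_zero]
    rw [hf.mul_self hb]
    exact (hf.rankOne b hb).ne_zero
  filter_upwards [hne] with τ hτ
  by_cases hτ0 : τ = 0
  · rw [hτ0, RCLike.ofReal_zero, zero_smul, add_zero]
    exact hf.orthogonal c a hc ha (inner_eq_zero_symm.1 hac)
  have hτ' : (τ : 𝕜) ≠ 0 := by simpa using hτ0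
  set d := (τ : 𝕜) • c with hd
  have hd0 : d ≠ 0 := smul_ne_zero hτ' hc
  have had : inner 𝕜 a d = 0 := by rw [hd, inner_smul_right, hac, mul_zero]
  have hbd : inner 𝕜 b d = 0 := by rw [hd, inner_smul_right, hbc, mul_zero]
  have hca : inner 𝕜 c a = 0 := inner_eq_zero_symm.1 hac
  have hcb : inner 𝕜 c b = 0 := inner_eq_zero_symm.1 hbc
  have hba : inner 𝕜 b a = 0 := inner_eq_zero_symm.1 hab
  have hda : inner 𝕜 d a = 0 := inner_eq_zero_symm.1 had
  have hdb : inner 𝕜 d b = 0 := inner_eq_zero_symm.1 hbd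
  have hab0 : a + b ≠ 0 := add_ne_zero_of_inner ha hab
  have habd : inner 𝕜 (a + b) d = 0 := by rw [inner_add_left, had, hbd, add_zero]
  have hx0 : a + b + d ≠ 0 := add_ne_zero_of_inner hab0 habd
  have had0 : a + d ≠ 0 := add_ne_zero_of_inner ha had
  have hxr := hf.rankOne _ hx0
  have h1 : f b * f (a + b + d) = 0 := by
    rw [hf.mul_add_eq hb hab0 habd hbd, h, zero_mul]
  have e1 : b + d + a = a + b + d := by abel
  have e2 : a + d + b = a + b + d := by abel
  have hbda : inner 𝕜 (b + d) a = 0 := by rw [inner_add_left, hba, hda, add_zero]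
  have hadb : inner 𝕜 (a + d) b = 0 := by rw [inner_add_left, hab, hdb, add_zero]
  have h2 : f (b + d) * f (a + b + d) = 0 := by
    have h3 := hf.mul_add_eq hb (hbτ τ) hbda hba
    rw [e1, h1] at h3
    exact ((hf.rankOne _ (hbτ τ)).mul_eq_zero_or h3.symm).resolve_left hτ
  have h3 : f c * f (a + b + d) = 0 := by
    have h3 := hf.mul_add_eq hc (hbτ τ) hbda hca
    rw [e1, mul_assoc, h2, mul_zero] at h3
    exact h3
  have h4 := hf.mul_add_eq hc had0 hadb hcb
  rw [e2, h3] at h4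
  refine ((hf.rankOne _ had0).mul_eq_zero_or h4.symm).resolve_right fun h5 => ?_
  have h6 : f a * f (a + b + d) = 0 := by
    have h7 := hf.mul_add_eq ha had0 hadb hab
    rw [e2, mul_assoc, h5, mul_zero] at h7
    exact h7
  have h7 : f (a + b) * f (a + b + d) = f (a + b + d) := by
    have h8 := hf.sum_mul _ _ hab0 hd0 habd
    rwa [hd, hf.smul _ _ hτ' hc, ← hd, add_mul, h3, add_zero] at h8
  refine hxr.ne_zero ?_
  rw [← h7, ← hf.sum_mul a b ha hb hab, mul_assoc, h7, add_mul, h6, h1, add_zero]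

theorem eventually_mul_eq_zero' (hf : IsLineMap f) (hn : 3 ≤ n) {a b : EuclideanSpace 𝕜 (Fin n)}
    (ha : a ≠ 0) (hb : b ≠ 0) (hab : inner 𝕜 a b = 0) (h : f b * f (a + b) = 0) :
    ∀ᶠ τ : ℝ in nhds 0, f b * f (a + (τ : 𝕜) • b) = 0 := by
  obtain ⟨c, hc, hac, hbc⟩ := exists_ne_zero_orthogonal hn a b
  obtain ⟨τ, hτ, hτ0⟩ : ∃ τ : ℝ, f c * f (a + (τ : 𝕜) • c) = 0 ∧ τ ≠ 0 := by
    have h1 := (hf.eventually_mul_eq_zero ha hb hc hab hac hbc h).filter_mono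
      (nhdsWithin_le_nhds (s := {0}ᶜ))
    exact (h1.and self_mem_nhdsWithin).exists
  have hτ' : (τ : 𝕜) ≠ 0 := by simpa using hτ0
  refine hf.eventually_mul_eq_zero ha (smul_ne_zero hτ' hc) hb ?_ hab ?_ ?_
  · rw [inner_smul_right, hac, mul_zero]
  · rw [inner_smul_left, inner_eq_zero_symm.1 hbc, mul_zero]
  · rwa [hf.smul _ _ hτ' hc]

/-- The idempotents of two orthogonal lines act as the identity on those of lines in their
plane. -/
theorem add_mul_of_mem_plane (hf : IsLineMap f) {p q : EuclideanSpace 𝕜 (Fin n)} (hp : p ≠ 0)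
    (hq : q ≠ 0) (hpq : inner 𝕜 p q = 0) (α β : 𝕜) (hx : α • p + β • q ≠ 0) :
    (f p + f q) * f (α • p + β • q) = f (α • p + β • q) := by
  by_cases hα : α = 0
  · have hβ : β ≠ 0 := fun h => hx (by simp [hα, h])
    rw [hα, zero_smul, zero_add, hf.smul _ _ hβ hq, add_mul, hf.orthogonal p q hp hq hpq,
      zero_add, hf.mul_self hq]
  by_cases hβ : β = 0
  · rw [hβ, zero_smul, add_zero, hf.smul _ _ hα hp, add_mul,
      hf.orthogonal q p hq hp (inner_eq_zero_symm.1 hpq), add_zero, hf.mul_self hp]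
  have h := hf.sum_mul (α • p) (β • q) (smul_ne_zero hα hp) (smul_ne_zero hβ hq)
    (by rw [inner_smul_left, inner_smul_right, hpq, mul_zero, mul_zero])
  rwa [hf.smul _ _ hα hp, hf.smul _ _ hβ hq] at h

/-- A line in the plane of the orthonormal vectors `a`, `b` other than the line of `a` is not sent
to the range of `f a`: the set of angles where this happens is closed, and by
`eventually_mul_eq_zero'` it would be open, hence contain a right angle. -/
theorem mul_cos_add_sin_ne_zero (hf : IsLineMap f) (hn : 3 ≤ n) {a b : EuclideanSpace 𝕜 (Fin n)}
    (ha : ‖a‖ = 1) (hb : ‖b‖ = 1) (hab : inner 𝕜 a b = 0) {θ₀ : ℝ} (hθ₀ : Real.sin θ₀ ≠ 0) :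
    f b * f ((Real.cos θ₀ : 𝕜) • a + (Real.sin θ₀ : 𝕜) • b) ≠ 0 := by
  intro h0
  have ha0 : a ≠ 0 := fun h => by simp [h] at ha
  have hb0 : b ≠ 0 := fun h => by simp [h] at hb
  have hba : inner 𝕜 b a = 0 := inner_eq_zero_symm.1 hab
  have haa : inner 𝕜 a a = (1 : 𝕜) := by rw [inner_self_eq_norm_sq_to_K, ha]; simp
  have hbb : inner 𝕜 b b = (1 : 𝕜) := by rw [inner_self_eq_norm_sq_to_K, hb]; simp
  set x : ℝ → EuclideanSpace 𝕜 (Fin n) :=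
    fun θ => (Real.cos θ : 𝕜) • a + (Real.sin θ : 𝕜) • b with hx
  have hxne : ∀ θ, x θ ≠ 0 := by
    intro θ h
    have h1 : inner 𝕜 a (x θ) = (Real.cos θ : 𝕜) := by
      simp only [hx, inner_add_right, inner_smul_right, haa, hab, mul_one, mul_zero, add_zero]
    have h2 : inner 𝕜 b (x θ) = (Real.sin θ : 𝕜) := by
      simp only [hx, inner_add_right, inner_smul_right, hbb, hba, mul_one, mul_zero, zero_add]
    rw [h, inner_zero_right] at h1 h2
    have h3 := Real.sin_sq_add_cos_sq θ
    have h1' : Real.cos θ = 0 := by exact_mod_cast h1.symm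
    have h2' : Real.sin θ = 0 := by exact_mod_cast h2.symm
    rw [h1', h2'] at h3
    norm_num at h3
  have hxc : Continuous x := by
    have h1 := Real.continuous_cos
    have h2 := Real.continuous_sin
    fun_prop
  have horth : ∀ θ, inner 𝕜 (x θ) (x (θ + Real.pi / 2)) = 0 := by
    intro θ
    simp only [hx, Real.cos_add_pi_div_two, Real.sin_add_pi_div_two, inner_add_left,
      inner_add_right, inner_smul_left, inner_smul_right, haa, hbb, hab, hba, RCLike.conj_ofReal,
      RCLike.ofReal_neg]
    ring
  have hrot : ∀ θ₁ θ, x θ = (Real.cos (θ - θ₁) : 𝕜) • x θ₁ +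
      (Real.sin (θ - θ₁) : 𝕜) • x (θ₁ + Real.pi / 2) := by
    intro θ₁ θ
    have e : θ = (θ - θ₁) + θ₁ := by ring
    have h1 : Real.cos θ = Real.cos (θ - θ₁) * Real.cos θ₁ - Real.sin (θ - θ₁) * Real.sin θ₁ := by
      conv_lhs => rw [e, Real.cos_add]
    have h2 : Real.sin θ = Real.sin (θ - θ₁) * Real.cos θ₁ + Real.cos (θ - θ₁) * Real.sin θ₁ := by
      conv_lhs => rw [e, Real.sin_add]
    simp only [hx, Real.cos_add_pi_div_two, Real.sin_add_pi_div_two, h1, h2]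
    push_cast
    module
  set A : Set ℝ := {θ | f b * f (x θ) = 0} with hA
  have hclosed : IsClosed A := by
    refine isClosed_eq (continuous_const.mul ?_) continuous_const
    exact hf.continuousOn.comp_continuous hxc hxne
  have hzeroA : (0 : ℝ) ∈ A := by
    simp only [hA, Set.mem_ofPred_eq, hx]
    simp [hf.orthogonal b a hb0 ha0 hba]
  have hθA : θ₀ ∈ A := h0
  have hfa : ∀ θ ∈ A, f a * f (x θ) = f (x θ) := by
    intro θ hθ
    have h1 := hf.add_mul_of_mem_plane ha0 hb0 hab _ _ (hxne θ)
    rw [add_mul] at h1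
    have h2 : f b * f (x θ) = 0 := hθ
    rw [h2, add_zero] at h1
    exact h1
  have hopen : IsOpen A := by
    rw [isOpen_iff_mem_nhds]
    intro θ₁ hθ₁
    set p := x θ₁ with hp
    set q := x (θ₁ + Real.pi / 2) with hq
    have hp0 : p ≠ 0 := hxne _
    have hq0 : q ≠ 0 := hxne _
    have hpq : inner 𝕜 p q = 0 := horth _
    have hqp : inner 𝕜 q p = 0 := inner_eq_zero_symm.1 hpq
    have hqa : f q * f a = 0 := by
      have h1 : f q * f a * f p = 0 := by
        rw [mul_assoc, hfa θ₁ hθ₁, hf.orthogonal q p hq0 hp0 hqp]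
      refine ((hf.rankOne a ha0).mul_eq_zero_or h1).resolve_right fun h2 => ?_
      rw [hfa θ₁ hθ₁] at h2
      exact (hf.rankOne p hp0).ne_zero h2
    have hqA : ∀ θ ∈ A, f q * f (x θ) = 0 := by
      intro θ hθ
      rw [← hfa θ hθ, ← mul_assoc, hqa, zero_mul]
    obtain ⟨θ', hθ', hsin⟩ : ∃ θ' ∈ A, Real.sin (θ' - θ₁) ≠ 0 := by
      by_cases hs : Real.sin θ₁ = 0
      · refine ⟨θ₀, hθA, ?_⟩
        rw [Real.sin_sub, hs, mul_zero, sub_zero]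
        refine mul_ne_zero hθ₀ fun hc => ?_
        have := Real.sin_sq_add_cos_sq θ₁
        rw [hs, hc] at this
        norm_num at this
      · exact ⟨0, hzeroA, by simpa using hs⟩
    have hsin' : (Real.sin (θ' - θ₁) : 𝕜) ≠ 0 := by simpa using hsin
    have hxθ' := hqA θ' hθ'
    rw [hrot θ₁ θ'] at hxθ'
    have hcos : Real.cos (θ' - θ₁) ≠ 0 := by
      intro hc
      rw [hc, RCLike.ofReal_zero, zero_smul, zero_add, hf.smul _ _ hsin' hq0,
        hf.mul_self hq0] at hxθ'
      exact (hf.rankOne q hq0).ne_zero hxθ'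
    have hcos' : (Real.cos (θ' - θ₁) : 𝕜) ≠ 0 := by simpa using hcos
    have hev := hf.eventually_mul_eq_zero' hn (smul_ne_zero hcos' hp0) (smul_ne_zero hsin' hq0)
      (by rw [inner_smul_left, inner_smul_right, hpq, mul_zero, mul_zero])
      (by rw [hf.smul _ _ hsin' hq0]; exact hxθ')
    rw [hf.smul _ _ hsin' hq0] at hev
    -- `x θ` is proportional to the vector of the previous line with parameter `κ θ`
    set κ : ℝ → ℝ := fun θ => Real.sin (θ - θ₁) * Real.cos (θ' - θ₁) /
      (Real.cos (θ - θ₁) * Real.sin (θ' - θ₁)) with hκ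
    have hκ0 : κ θ₁ = 0 := by simp [hκ]
    have hκc : ContinuousAt κ θ₁ := by
      refine ContinuousAt.div (by fun_prop) (by fun_prop) ?_
      simpa using hsin
    have hcosne : ∀ᶠ θ in nhds θ₁, Real.cos (θ - θ₁) ≠ 0 := by
      have : Continuous fun θ => Real.cos (θ - θ₁) := by fun_prop
      exact this.continuousAt.eventually_ne (by simp)
    have hκt : Filter.Tendsto κ (nhds θ₁) (nhds 0) := by
      have := hκc.tendsto
      rwa [hκ0] at this
    filter_upwards [hκt.eventually hev, hcosne] with θ h1 h2
    have h2' : (Real.cos (θ - θ₁) : 𝕜) ≠ 0 := by simpa using h2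
    have h3 : x θ = ((Real.cos (θ - θ₁) : 𝕜) / (Real.cos (θ' - θ₁) : 𝕜)) •
        ((Real.cos (θ' - θ₁) : 𝕜) • p + (κ θ : 𝕜) • (Real.sin (θ' - θ₁) : 𝕜) • q) := by
      have h4 : (κ θ : 𝕜) = Real.sin (θ - θ₁) * Real.cos (θ' - θ₁) /
          (Real.cos (θ - θ₁) * Real.sin (θ' - θ₁)) := by simp only [hκ]; push_cast; rfl
      rw [hrot θ₁ θ, h4, ← hp, ← hq]
      match_scalars <;> field_simp
    have h4 : f q * f (x θ) = 0 := by
      have h5 : (Real.cos (θ' - θ₁) : 𝕜) • p + (κ θ : 𝕜) • (Real.sin (θ' - θ₁) : 𝕜) • q ≠ 0 := by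
        intro h6
        rw [h6, smul_zero] at h3
        exact hxne θ h3
      rw [h3, hf.smul _ _ (div_ne_zero h2' hcos') h5]
      exact h1
    have h5 : (f p + f q) * f (x θ) = f (x θ) := by
      have := hf.add_mul_of_mem_plane hp0 hq0 hpq _ _ (hrot θ₁ θ ▸ hxne θ)
      rwa [← hrot] at this
    rw [add_mul, h4, add_zero] at h5
    have h6 : f b * f p = 0 := hθ₁
    change f b * f (x θ) = 0
    rw [← h5, ← mul_assoc, h6, zero_mul]
  have huniv := (show IsClopen A from ⟨hclosed, hopen⟩).eq_univ ⟨0, hzeroA⟩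
  have h1 : Real.pi / 2 ∈ A := huniv ▸ Set.mem_univ _
  simp only [hA, Set.mem_ofPred_eq, hx, Real.cos_pi_div_two, Real.sin_pi_div_two,
    RCLike.ofReal_zero, RCLike.ofReal_one, zero_smul, zero_add, one_smul, hf.mul_self hb0] at h1
  exact (hf.rankOne b hb0).ne_zero h1

theorem mul_add_ne_zero (hf : IsLineMap f) (hn : 3 ≤ n) {a b : EuclideanSpace 𝕜 (Fin n)}
    (ha : a ≠ 0) (hb : b ≠ 0) (hab : inner 𝕜 a b = 0) : f b * f (a + b) ≠ 0 := by
  have ha' : (‖a‖ : 𝕜) ≠ 0 := by simpa using ha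
  have hb' : (‖b‖ : 𝕜) ≠ 0 := by simpa using hb
  set a' := (‖a‖ : 𝕜)⁻¹ • a with haa
  set b' := (‖b‖ : 𝕜)⁻¹ • b with hbb
  set z : ℂ := ⟨‖a‖, ‖b‖⟩ with hz
  have hz0 : ‖z‖ ≠ 0 := by
    rw [norm_ne_zero_iff]
    intro h
    have := congrArg Complex.im h
    simp [hz] at this
    exact hb this
  have hcos : ‖z‖ * Real.cos z.arg = ‖a‖ := Complex.norm_mul_cos_arg z
  have hsin : ‖z‖ * Real.sin z.arg = ‖b‖ := Complex.norm_mul_sin_arg z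
  have hsin0 : Real.sin z.arg ≠ 0 := fun h => by
    rw [h, mul_zero] at hsin
    exact hb (norm_eq_zero.1 hsin.symm)
  have h := hf.mul_cos_add_sin_ne_zero hn (norm_smul_inv_norm (𝕜 := 𝕜) ha)
    (norm_smul_inv_norm (𝕜 := 𝕜) hb)
    (by rw [inner_smul_left, inner_smul_right, hab, mul_zero, mul_zero]) hsin0
  have hzK : (‖z‖ : 𝕜) ≠ 0 := by exact_mod_cast hz0
  have e : a + b = (‖z‖ : 𝕜) • ((Real.cos z.arg : 𝕜) • a' + (Real.sin z.arg : 𝕜) • b') := by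
    rw [smul_add, smul_smul _ _ a', smul_smul _ _ b', ← RCLike.ofReal_mul, ← RCLike.ofReal_mul,
      hcos, hsin, haa, hbb, smul_smul, smul_smul, mul_inv_cancel₀ ha', mul_inv_cancel₀ hb',
      one_smul, one_smul]
  have hab0 : a + b ≠ 0 := add_ne_zero_of_inner ha hab
  have hne : (Real.cos z.arg : 𝕜) • a' + (Real.sin z.arg : 𝕜) • b' ≠ 0 := fun h0 => by
    rw [h0, smul_zero] at e
    exact hab0 e
  rw [hf.smul _ _ (inv_ne_zero hb') hb] at h
  rw [e, hf.smul _ _ hzK hne]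
  exact h

/-- Idempotents of non-orthogonal lines have a nonzero product. -/
theorem mul_ne_zero (hf : IsLineMap f) (hn : 3 ≤ n) {x y : EuclideanSpace 𝕜 (Fin n)}
    (hx : x ≠ 0) (hxy : inner 𝕜 x y ≠ 0) : f x * f y ≠ 0 := by
  have hxx : inner 𝕜 x x ≠ 0 := fun h => hx (inner_self_eq_zero.1 h)
  set α : 𝕜 := inner 𝕜 x y / inner 𝕜 x x with hα
  have hα0 : α ≠ 0 := div_ne_zero hxy hxx
  set r := y - α • x with hr
  have hxr : inner 𝕜 x r = 0 := by
    rw [hr, inner_sub_right, inner_smul_right, hα, div_mul_cancel₀ _ hxx, sub_self]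
  have hy : y = r + α • x := by rw [hr]; abel
  by_cases hr0 : r = 0
  · rw [hy, hr0, zero_add, hf.smul _ _ hα0 hx, hf.mul_self hx]
    exact (hf.rankOne x hx).ne_zero
  · have h := hf.mul_add_ne_zero hn hr0 (smul_ne_zero hα0 hx)
      (by rw [inner_smul_right, inner_eq_zero_symm.1 hxr, mul_zero])
    rwa [hf.smul _ _ hα0 hx, ← hy] at h

end IsLineMap

/-! ### Ring homomorphisms into the complex numbers -/

/-- A multiplicative map with `m p + m (1 - p) = 1`, as a ring homomorphism: such a map is
additive. -/
def ringHomOfMul (m : 𝕜 → ℂ) (h0 : m 0 = 0) (h1 : m 1 = 1) (hmul : ∀ x y, m (x * y) = m x * m y)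
    (hadd : ∀ p, m p + m (1 - p) = 1) : 𝕜 →+* ℂ where
  toFun := m
  map_one' := h1
  map_mul' := hmul
  map_zero' := h0
  map_add' x y := by
    have hneg : m (-1) = -1 := by
      have hsq : (m (-1) - 1) * (m (-1) + 1) = 0 := by
        have : m (-1) * m (-1) = 1 := by rw [← hmul]; simp [h1]
        linear_combination this
      rcases mul_eq_zero.1 hsq with h | h
      · -- then `m 2 = 0`, although `2` is invertible
        have h2 : m (1 - -1) = 0 := by
          have := hadd (-1)
          linear_combination this - h
        have h3 : m ((1 - -1) * 2⁻¹) = 0 := by rw [hmul, h2, zero_mul]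
        have h4 : ((1 : 𝕜) - -1) * 2⁻¹ = 1 := by norm_num
        rw [h4, h1] at h3
        exact absurd h3 one_ne_zero
      · linear_combination h
    by_cases hxy : x + y = 0
    · have hy : y = -1 * x := by linear_combination hxy
      rw [hxy, h0, hy, hmul, hneg]
      ring
    · have hx : x = (x + y) * (x / (x + y)) := by field_simp
      have hy : y = (x + y) * (1 - x / (x + y)) := by field_simp; ring
      have h2 := hadd (x / (x + y))
      have h3 : m x = m (x + y) * m (x / (x + y)) := by rw [← hmul, ← hx]
      have h4 : m y = m (x + y) * m (1 - x / (x + y)) := by rw [← hmul, ← hy]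
      rw [h3, h4, ← mul_add, h2, mul_one]

/-- A continuous ring homomorphism `𝕜 → ℂ` is the canonical embedding or its conjugate. -/
theorem ringHom_eq_or (m : 𝕜 →+* ℂ) (hm : Continuous m) :
    (∀ z, m z = complexEmbedding 𝕜 z) ∨ (∀ z, m z = complexEmbedding 𝕜 (star z)) := by
  have hreal : ∀ r : ℝ, m (r : 𝕜) = r := by
    intro r
    have h := map_real_smul (m : 𝕜 →+ ℂ) hm r (1 : 𝕜)
    simpa [RCLike.real_smul_eq_coe_mul] using h
  have hz : ∀ z, m z = RCLike.re z + RCLike.im z * m RCLike.I := by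
    intro z
    conv_lhs => rw [← RCLike.re_add_im z]
    rw [map_add, map_mul, hreal, hreal]
  rcases RCLike.I_mul_I (K := 𝕜) with h | h
  · left
    intro z
    have him : RCLike.im z = 0 := RCLike.im_eq_zero h z
    rw [hz, complexEmbedding_apply, RCLike.map_apply, him]
    simp
  · have h2 : (m RCLike.I - Complex.I) * (m RCLike.I + Complex.I) = 0 := by
      have h3 : m RCLike.I * m RCLike.I = -1 := by rw [← map_mul, h, map_neg, map_one]
      have h4 := Complex.I_mul_I
      linear_combination h3 - h4
    rcases mul_eq_zero.1 h2 with h3 | h3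
    · left
      intro z
      rw [hz, sub_eq_zero.1 h3, complexEmbedding_apply, RCLike.map_apply]
      simp
    · right
      intro z
      rw [hz, eq_neg_of_add_eq_zero_left h3, complexEmbedding_apply, RCLike.map_apply]
      simp

namespace IsLineMap

/-! ### Coordinates of orthogonality-preserving maps on lines -/

variable {f : EuclideanSpace 𝕜 (Fin n) → Matrix (Fin n) (Fin n) ℂ}

theorem apply_ne_zero (hf : IsLineMap f) (hn : 3 ≤ n)
    (he : ∀ i, f (EuclideanSpace.single i 1) = Matrix.diagonal (Pi.single i 1))
    {x : EuclideanSpace 𝕜 (Fin n)} {i : Fin n} (hx : x i ≠ 0) : f x i i ≠ 0 := by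
  have hx0 : x ≠ 0 := fun h => hx (by rw [h]; rfl)
  have hi0 : EuclideanSpace.single i (1 : 𝕜) ≠ 0 := by simp
  have hin : inner 𝕜 (EuclideanSpace.single i (1 : 𝕜)) x ≠ 0 := by
    simpa [EuclideanSpace.inner_single_left] using hx
  have h1 := hf.mul_ne_zero hn hi0 hin
  have h2 := hf.mul_ne_zero hn hx0 (fun h => hin (inner_eq_zero_symm.1 h))
  obtain ⟨u, v, huv, -⟩ := hf.rankOne x hx0
  rw [he, huv] at h1 h2
  rw [huv, Matrix.vecMulVec_apply]
  refine _root_.mul_ne_zero (fun hu => h1 ?_) fun hv => h2 ?_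
  · ext a b
    rw [Matrix.diagonal_mul, Matrix.vecMulVec_apply]
    by_cases hai : a = i
    · simp [hai, hu]
    · simp [hai]
  · ext a b
    rw [Matrix.mul_diagonal, Matrix.vecMulVec_apply]
    by_cases hbi : b = i
    · simp [hbi, hv]
    · simp [hbi]

theorem apply_eq_zero (hf : IsLineMap f)
    (he : ∀ i, f (EuclideanSpace.single i 1) = Matrix.diagonal (Pi.single i 1))
    {x : EuclideanSpace 𝕜 (Fin n)} (hx0 : x ≠ 0) {i : Fin n} (hx : x i = 0) (k : Fin n) :
    f x i k = 0 := by
  have hi0 : EuclideanSpace.single i (1 : 𝕜) ≠ 0 := by simp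
  have h := hf.orthogonal _ x hi0 hx0 (by simpa [EuclideanSpace.inner_single_left] using hx)
  have h1 := congrFun (congrFun h i) k
  rw [he, Matrix.diagonal_mul] at h1
  simpa using h1

/-- The ratio of the `i`-th and `j`-th component of the line assigned to `y + r` is the one for
`y`, if the `i`-th and `j`-th component of `r` vanish. -/
theorem apply_mul_apply (hf : IsLineMap f)
    (he : ∀ i, f (EuclideanSpace.single i 1) = Matrix.diagonal (Pi.single i 1))
    {y r : EuclideanSpace 𝕜 (Fin n)} (hy : y ≠ 0) (hyr : inner 𝕜 y r = 0) {i j : Fin n}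
    (hi : r i = 0) (hj : r j = 0) (k l : Fin n) :
    f (y + r) i k * f y j l = f (y + r) j k * f y i l := by
  have key : ∀ a : Fin n, r a = 0 → f (y + r) a k = (f y * f (y + r)) a k := by
    intro a ha
    have ha0 : EuclideanSpace.single a (1 : 𝕜) ≠ 0 := by simp
    have h := hf.mul_add_eq ha0 hy hyr (by simpa [EuclideanSpace.inner_single_left] using ha)
    have h1 := congrFun (congrFun h a) k
    rw [he, mul_assoc, Matrix.diagonal_mul, Matrix.diagonal_mul] at h1
    simpa using h1
  rw [key i hi, key j hj]
  obtain ⟨u, v, huv, -⟩ := hf.rankOne y hy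
  rw [huv, Matrix.vecMulVec_mul]
  simp only [Matrix.vecMulVec_apply]
  ring

/-- The ratio of the `j`-th and the `o`-th coordinate of the line assigned to
`e_o + z e_j`. -/
noncomputable def coordRatio (f : EuclideanSpace 𝕜 (Fin n) → Matrix (Fin n) (Fin n) ℂ)
    (o j : Fin n) (z : 𝕜) : ℂ :=
  f (EuclideanSpace.single o 1 + EuclideanSpace.single j z) j o /
    f (EuclideanSpace.single o 1 + EuclideanSpace.single j z) o o

theorem ne_zero_of_apply {x : EuclideanSpace 𝕜 (Fin n)} {i : Fin n} (h : x i ≠ 0) : x ≠ 0 :=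
  fun h0 => h (by rw [h0]; rfl)

theorem apply_eq_mul_coordRatio (hf : IsLineMap f) (hn : 3 ≤ n)
    (he : ∀ i, f (EuclideanSpace.single i 1) = Matrix.diagonal (Pi.single i 1))
    {o j : Fin n} (hoj : o ≠ j) {x : EuclideanSpace 𝕜 (Fin n)} (hx : x o = 1) :
    f x j o = f x o o * coordRatio f o j (x j) := by
  set y := EuclideanSpace.single o (1 : 𝕜) + EuclideanSpace.single j (x j) with hy
  have hyo : y o = 1 := by simp [hy, hoj]
  have hyj : y j = x j := by simp [hy, hoj.symm]
  have hyo' : y o ≠ 0 := by rw [hyo]; exact one_ne_zero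
  have hro : (x - y) o = 0 := by rw [PiLp.sub_apply, hx, hyo, sub_self]
  have hrj : (x - y) j = 0 := by rw [PiLp.sub_apply, hyj, sub_self]
  have hyr : inner 𝕜 y (x - y) = 0 := by
    conv_lhs => rw [hy]
    rw [inner_add_left, EuclideanSpace.inner_single_left, EuclideanSpace.inner_single_left, hro,
      hrj, mul_zero, mul_zero, add_zero]
  have h := hf.apply_mul_apply he (ne_zero_of_apply hyo') hyr hrj hro o o
  rw [add_sub_cancel] at h
  have hne := hf.apply_ne_zero hn he hyo'
  rw [coordRatio, ← hy, mul_div_assoc', eq_div_iff hne, h]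

theorem coordRatio_zero (hf : IsLineMap f)
    (he : ∀ i, f (EuclideanSpace.single i 1) = Matrix.diagonal (Pi.single i 1))
    {o j : Fin n} (hoj : o ≠ j) : coordRatio f o j 0 = 0 := by
  rw [coordRatio, hf.apply_eq_zero he, zero_div]
  · exact ne_zero_of_apply (i := o) (by simp [hoj])
  · simp [hoj.symm]

theorem transpose_single
    (he : ∀ i, f (EuclideanSpace.single i 1) = Matrix.diagonal (Pi.single i 1)) (i : Fin n) :
    (f (EuclideanSpace.single i 1)).transpose = Matrix.diagonal (Pi.single i 1) := by
  rw [he, Matrix.diagonal_transpose]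

/-- Orthogonality of `e_o + z e_j + w e_k` and `e_o + z' e_j + w' e_k`, in terms of coordinate
ratios. -/
theorem coordRatio_orthogonal (hf : IsLineMap f) (hn : 3 ≤ n)
    (he : ∀ i, f (EuclideanSpace.single i 1) = Matrix.diagonal (Pi.single i 1))
    {o j k : Fin n} (hoj : o ≠ j) (hok : o ≠ k) (hjk : j ≠ k) {z w z' w' : 𝕜}
    (h : 1 + star z * z' + star w * w' = 0) :
    1 + coordRatio (fun x => (f x).transpose) o j z * coordRatio f o j z' +
      coordRatio (fun x => (f x).transpose) o k w * coordRatio f o k w' = 0 := by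
  set V : 𝕜 → 𝕜 → EuclideanSpace 𝕜 (Fin n) := fun z w =>
    EuclideanSpace.single o 1 + EuclideanSpace.single j z + EuclideanSpace.single k w with hV
  have hVo : ∀ z w, V z w o = 1 := fun z w => by simp [hV, hoj, hok]
  have hVj : ∀ z w, V z w j = z := fun z w => by simp [hV, hoj.symm, hjk]
  have hVk : ∀ z w, V z w k = w := fun z w => by simp [hV, hok.symm, hjk.symm]
  have hVl : ∀ z w l, l ≠ o → l ≠ j → l ≠ k → V z w l = 0 := fun z w l h1 h2 h3 => by
    simp [hV, h1, h2, h3]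
  have hVo' : ∀ z w, V z w o ≠ 0 := fun z w => by rw [hVo]; exact one_ne_zero
  have hV0 : ∀ z w, V z w ≠ 0 := fun z w => ne_zero_of_apply (hVo' z w)
  have hin : inner 𝕜 (V z w) (V z' w') = 0 := by
    conv_lhs => rw [hV]
    simp only []
    rw [inner_add_left, inner_add_left, EuclideanSpace.inner_single_left,
      EuclideanSpace.inner_single_left, EuclideanSpace.inner_single_left]
    have e1 := hVo z' w'
    have e2 := hVj z' w'
    have e3 := hVk z' w'
    simp only [hV] at e1 e2 e3
    rw [e1, e2, e3, map_one, mul_one]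
    exact h
  have hmul := hf.orthogonal _ _ (hV0 z w) (hV0 z' w') hin
  have hent := congrFun (congrFun hmul o) o
  rw [Matrix.mul_apply, ← Finset.sum_subset (Finset.subset_univ {o, j, k}), Finset.sum_insert,
    Finset.sum_insert, Finset.sum_singleton] at hent
  rotate_left
  · simpa using hjk
  · simp [hoj, hok]
  · intro l _ hl
    simp only [Finset.mem_insert, Finset.mem_singleton, not_or] at hl
    rw [hf.apply_eq_zero he (hV0 z' w') (hVl z' w' l hl.1 hl.2.1 hl.2.2), mul_zero]
  have hT := hf.transpose
  have heT := transpose_single he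
  have h1 := hf.apply_eq_mul_coordRatio hn he hoj (hVo z' w')
  have h2 := hf.apply_eq_mul_coordRatio hn he hok (hVo z' w')
  have h3 := hT.apply_eq_mul_coordRatio hn heT hoj (hVo z w)
  have h4 := hT.apply_eq_mul_coordRatio hn heT hok (hVo z w)
  simp only [Matrix.transpose_apply, hVj, hVk] at h1 h2 h3 h4
  rw [h1, h2, h3, h4] at hent
  have hne1 := hf.apply_ne_zero hn he (hVo' z w)
  have hne2 := hf.apply_ne_zero hn he (hVo' z' w')
  refine (mul_eq_zero.1 (?_ : (f (V z w) o o * f (V z' w') o o) * _ = 0)).resolve_left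
    (_root_.mul_ne_zero hne1 hne2)
  simp only [Matrix.zero_apply] at hent
  linear_combination hent

theorem coordRatio_neg_inv (hf : IsLineMap f) (hn : 3 ≤ n)
    (he : ∀ i, f (EuclideanSpace.single i 1) = Matrix.diagonal (Pi.single i 1))
    {o j : Fin n} (hoj : o ≠ j) {z : 𝕜} (hz : z ≠ 0) :
    coordRatio (fun x => (f x).transpose) o j (-(star z)⁻¹) * coordRatio f o j z = -1 := by
  obtain ⟨k, hk⟩ : ∃ k : Fin n, k ∉ ({o, j} : Finset (Fin n)) := by
    by_contra! h
    have h1 : Finset.univ ⊆ ({o, j} : Finset (Fin n)) := fun k _ => h k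
    have h2 := (Finset.card_le_card h1).trans Finset.card_le_two
    simp at h2
    omega
  simp only [Finset.mem_insert, Finset.mem_singleton, not_or] at hk
  have h := hf.coordRatio_orthogonal hn he hoj (Ne.symm hk.1) (Ne.symm hk.2)
    (z := -(star z)⁻¹) (z' := z) (w := 0) (w' := 0)
    (by simp [hz])
  rw [hf.coordRatio_zero he (Ne.symm hk.1), mul_zero, add_zero] at h
  linear_combination h

theorem coordRatio_ne_zero (hf : IsLineMap f) (hn : 3 ≤ n)
    (he : ∀ i, f (EuclideanSpace.single i 1) = Matrix.diagonal (Pi.single i 1))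
    {o j : Fin n} (hoj : o ≠ j) {z : 𝕜} (hz : z ≠ 0) : coordRatio f o j z ≠ 0 := fun h => by
  have := hf.coordRatio_neg_inv hn he hoj hz
  rw [h, mul_zero] at this
  norm_num at this

/-- The basic functional equation: orthogonality to `e_o - (1 / conj A) e_j - (1 / conj B) e_k`
of the point `e_o + p A e_j + (1 - p) B e_k`. -/
theorem coordRatio_div_add_div (hf : IsLineMap f) (hn : 3 ≤ n)
    (he : ∀ i, f (EuclideanSpace.single i 1) = Matrix.diagonal (Pi.single i 1))
    {o j k : Fin n} (hoj : o ≠ j) (hok : o ≠ k) (hjk : j ≠ k) {A B : 𝕜} (hA : A ≠ 0) (hB : B ≠ 0)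
    (p : 𝕜) : coordRatio f o j (p * A) / coordRatio f o j A +
      coordRatio f o k ((1 - p) * B) / coordRatio f o k B = 1 := by
  have h := hf.coordRatio_orthogonal hn he hoj hok hjk
    (z := -(star A)⁻¹) (z' := p * A) (w := -(star B)⁻¹) (w' := (1 - p) * B) (by
      simp only [star_neg, star_inv₀, star_star]
      field_simp
      ring)
  have hA1 := hf.coordRatio_neg_inv hn he hoj hA
  have hB1 := hf.coordRatio_neg_inv hn he hok hB
  have hA2 := hf.coordRatio_ne_zero hn he hoj hA
  have hB2 := hf.coordRatio_ne_zero hn he hok hB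
  rw [eq_div_of_mul_eq hA2 hA1, eq_div_of_mul_eq hB2 hB1] at h
  field_simp at h ⊢
  linear_combination -h

theorem coordRatio_comm (hf : IsLineMap f) (hn : 3 ≤ n)
    (he : ∀ i, f (EuclideanSpace.single i 1) = Matrix.diagonal (Pi.single i 1))
    {o j k : Fin n} (hoj : o ≠ j) (hok : o ≠ k) (hjk : j ≠ k) (s : 𝕜) :
    coordRatio f o k 1 * coordRatio f o j s = coordRatio f o k s * coordRatio f o j 1 := by
  by_cases hs : s = 0
  · rw [hs, hf.coordRatio_zero he hoj, hf.coordRatio_zero he hok, mul_zero, zero_mul]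
  set y := EuclideanSpace.single j (1 : 𝕜) + EuclideanSpace.single k (1 : 𝕜) with hy
  have hyj : y j = 1 := by simp [hy, hjk]
  have hyk : y k = 1 := by simp [hy, hjk.symm]
  have hyo : y o = 0 := by simp [hy, hoj, hok]
  have hyj' : y j ≠ 0 := by rw [hyj]; exact one_ne_zero
  have hy0 : y ≠ 0 := ne_zero_of_apply hyj'
  -- both sides are determined by the line of `e_j + e_k`, the part of `e_o + s e_j + s e_k`
  -- orthogonal to `e_o`
  have key : ∀ s : 𝕜, s ≠ 0 →
      coordRatio f o k s * f y j j = coordRatio f o j s * f y k j := by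
    intro s hs
    set x := s • y + EuclideanSpace.single o (1 : 𝕜) with hx
    have hxo : x o = 1 := by simp [hx, hyo]
    have hxj : x j = s := by simp [hx, hyj, hoj.symm]
    have hxk : x k = s := by simp [hx, hyk, hok.symm]
    have hin : inner 𝕜 (s • y) (EuclideanSpace.single o (1 : 𝕜)) = 0 := by
      rw [EuclideanSpace.inner_single_right]; simp [hyo]
    have h := hf.apply_mul_apply he (smul_ne_zero hs hy0) hin (i := k) (j := j)
      (by simp [hok.symm]) (by simp [hoj.symm]) o j
    rw [← hx, hf.smul _ _ hs hy0, hf.apply_eq_mul_coordRatio hn he hoj hxo,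
      hf.apply_eq_mul_coordRatio hn he hok hxo, hxj, hxk, mul_assoc, mul_assoc] at h
    exact mul_left_cancel₀ (hf.apply_ne_zero hn he (by rw [hxo]; exact one_ne_zero)) h
  have h1 := key 1 one_ne_zero
  have h2 := key s hs
  have hne := hf.apply_ne_zero hn he hyj'
  refine mul_right_cancel₀ hne ?_
  linear_combination coordRatio f o j s * h1 - coordRatio f o j 1 * h2

theorem continuous_coordRatio (hf : IsLineMap f) (hn : 3 ≤ n)
    (he : ∀ i, f (EuclideanSpace.single i 1) = Matrix.diagonal (Pi.single i 1))
    {o j : Fin n} (hoj : o ≠ j) : Continuous (coordRatio f o j) := by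
  have hne : ∀ z : 𝕜, (EuclideanSpace.single o (1 : 𝕜) + EuclideanSpace.single j z :
      EuclideanSpace 𝕜 (Fin n)) o ≠ 0 := fun z => by simp [hoj]
  have hc : Continuous fun z : 𝕜 =>
      f (EuclideanSpace.single o (1 : 𝕜) + EuclideanSpace.single j z) := by
    refine hf.continuousOn.comp_continuous (continuous_const.add ?_) fun z =>
      ne_zero_of_apply (hne z)
    exact (Isometry.of_dist_eq fun a b => PiLp.dist_single_same 2 (fun _ => 𝕜) j a b).continuous
  exact (hc.matrix_elem j o).div (hc.matrix_elem o o) fun z => hf.apply_ne_zero hn he (hne z)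

/-- The coordinate ratios are multiples of one and the same field embedding: by
`coordRatio_div_add_div` and `coordRatio_comm` they are multiplicative and satisfy the equation of
`ringHomOfMul` after normalization at `1`. -/
theorem exists_ringHom (hf : IsLineMap f) (hn : 3 ≤ n)
    (he : ∀ i, f (EuclideanSpace.single i 1) = Matrix.diagonal (Pi.single i 1)) (o : Fin n) :
    ∃ m : 𝕜 →+* ℂ, Continuous m ∧ ∃ c : Fin n → ℂ, (∀ i, c i ≠ 0) ∧ c o = 1 ∧
      ∀ j, o ≠ j → ∀ z, coordRatio f o j z = c j * m z := by
  obtain ⟨j, hoj⟩ : ∃ j : Fin n, o ≠ j := by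
    have : Nontrivial (Fin n) := Fin.nontrivial_iff_two_le.2 (by omega)
    obtain ⟨j, hj⟩ := exists_ne o
    exact ⟨j, hj.symm⟩
  obtain ⟨k, hk⟩ : ∃ k : Fin n, k ∉ ({o, j} : Finset (Fin n)) := by
    by_contra! h
    have h1 : Finset.univ ⊆ ({o, j} : Finset (Fin n)) := fun k _ => h k
    have h2 := (Finset.card_le_card h1).trans Finset.card_le_two
    simp at h2
    omega
  simp only [Finset.mem_insert, Finset.mem_singleton, not_or] at hk
  have hok : o ≠ k := Ne.symm hk.1
  have hjk : j ≠ k := Ne.symm hk.2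
  set g := coordRatio f o j with hg
  have hg1 : g 1 ≠ 0 := hf.coordRatio_ne_zero hn he hoj one_ne_zero
  have hk1 : coordRatio f o k 1 ≠ 0 := hf.coordRatio_ne_zero hn he hok one_ne_zero
  have hkg : ∀ s, coordRatio f o k s / coordRatio f o k 1 = g s / g 1 := fun s => by
    rw [div_eq_div_iff hk1 hg1, ← hf.coordRatio_comm hn he hoj hok hjk, mul_comm]
  have hadd : ∀ p, g p / g 1 + g (1 - p) / g 1 = 1 := fun p => by
    have := hf.coordRatio_div_add_div hn he hoj hok hjk one_ne_zero one_ne_zero p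
    rwa [mul_one, mul_one, hkg] at this
  have hmul : ∀ p A, g (p * A) / g 1 = g p / g 1 * (g A / g 1) := fun p A => by
    by_cases hA : A = 0
    · rw [hA, mul_zero, hg, hf.coordRatio_zero he hoj]; simp
    have h1 := hf.coordRatio_div_add_div hn he hoj hok hjk hA one_ne_zero p
    rw [mul_one, hkg, ← hadd p] at h1
    have h2 := add_right_cancel h1
    have hA' : g A ≠ 0 := hf.coordRatio_ne_zero hn he hoj hA
    rw [div_eq_iff hA'] at h2
    have h3 : g (p * A) = g p / g 1 * g A := h2
    rw [h3]
    ring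
  refine ⟨ringHomOfMul (fun z => g z / g 1) ?_ (div_self hg1) hmul hadd, ?_,
    fun i => if o = i then 1 else coordRatio f o i 1, ?_, if_pos rfl, ?_⟩
  · simp only [hg]; rw [hf.coordRatio_zero he hoj, zero_div]
  · exact (hf.continuous_coordRatio hn he hoj).div_const _
  · intro i
    by_cases hi : o = i
    · simp [hi]
    · simp only [hi, if_false]; exact hf.coordRatio_ne_zero hn he hi one_ne_zero
  · intro i hi z
    change _ = _ * (g z / g 1)
    simp only [hi, if_false]
    by_cases hij : i = j
    · rw [hij, ← hg]; field_simp
    · have := hf.coordRatio_comm hn he hoj hi (Ne.symm hij) z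
      rw [← hg] at this
      field_simp
      linear_combination -this

theorem norm_sq_eq_sum (x : EuclideanSpace 𝕜 (Fin n)) :
    ((‖x‖ ^ 2 : ℝ) : 𝕜) = ∑ i, x i * star (x i) := by
  have h : inner 𝕜 x x = ((‖x‖ ^ 2 : ℝ) : 𝕜) := by
    rw [inner_self_eq_norm_sq_to_K]; push_cast; rfl
  rw [← h, PiLp.inner_apply]
  exact Finset.sum_congr rfl fun i _ => by rw [RCLike.inner_apply]; rfl

/-- A line map fixing the coordinate lines is given by a field embedding up to a diagonal change of
basis. -/
theorem exists_apply_eq (hf : IsLineMap f) (hn : 3 ≤ n)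
    (he : ∀ i, f (EuclideanSpace.single i 1) = Matrix.diagonal (Pi.single i 1)) :
    ∃ m : 𝕜 →+* ℂ, Continuous m ∧ ∃ c : Fin n → ℂ, (∀ i, c i ≠ 0) ∧
      ∀ x, ‖x‖ = 1 → ∀ i j, f x i j = c i * m (x i * star (x j)) * (c j)⁻¹ := by
  set o : Fin n := ⟨0, by omega⟩
  obtain ⟨m, hm, c, hc, hco, hg⟩ := hf.exists_ringHom hn he o
  have hreal : ∀ r : ℝ, m (r : 𝕜) = r := fun r => by
    have h := map_real_smul (m : 𝕜 →+ ℂ) hm r (1 : 𝕜)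
    simpa [RCLike.real_smul_eq_coe_mul] using h
  have hh : ∀ j, o ≠ j → ∀ z, coordRatio (fun x => (f x).transpose) o j z =
      (c j)⁻¹ * m (star z) := by
    intro j hj z
    by_cases hz : z = 0
    · rw [hz, hf.transpose.coordRatio_zero (transpose_single he) hj, star_zero, map_zero, mul_zero]
    have h1 := hf.coordRatio_neg_inv hn he hj (z := -(star z)⁻¹) (by simp [hz])
    have h2 : -(star (-(star z)⁻¹))⁻¹ = z := by simp
    rw [h2, hg j hj, map_neg, map_inv₀] at h1
    have h3 : m (star z) ≠ 0 := (map_ne_zero m).2 (star_ne_zero.2 hz)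
    have h4 := hc j
    field_simp at h1 ⊢
    linear_combination -h1
  have hcol : ∀ x : EuclideanSpace 𝕜 (Fin n), x o = 1 →
      ∀ i, f x i o = f x o o * (c i * m (x i)) := by
    intro x hx i
    by_cases hi : o = i
    · rw [← hi, hx, hco, map_one, mul_one, mul_one]
    · rw [hf.apply_eq_mul_coordRatio hn he hi hx, hg i hi]
  have hrow : ∀ x : EuclideanSpace 𝕜 (Fin n), x o = 1 →
      ∀ j, f x o j = f x o o * ((c j)⁻¹ * m (star (x j))) := by
    intro x hx j
    by_cases hj : o = j
    · rw [← hj, hx, hco, star_one, map_one, inv_one, mul_one, mul_one]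
    · have h := hf.transpose.apply_eq_mul_coordRatio hn (transpose_single he) hj hx
      rw [hh j hj] at h
      exact h
  -- the claim, without normalization, for vectors with nonzero coordinate at `o`
  have hgen : ∀ x : EuclideanSpace 𝕜 (Fin n), x o ≠ 0 → ∀ i j,
      ((‖x‖ ^ 2 : ℝ) : ℂ) * f x i j = c i * m (x i * star (x j)) * (c j)⁻¹ := by
    intro x hx i j
    set y := (x o)⁻¹ • x with hy
    have hyo : y o = 1 := by simp [hy, hx]
    have hx0 := ne_zero_of_apply hx
    have hfy : f y = f x := hf.smul _ _ (inv_ne_zero hx) hx0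
    have hxy : ∀ i, x i = x o * y i := fun i => by simp [hy, hx]
    have hyo' : y o ≠ 0 := by rw [hyo]; exact one_ne_zero
    have hne := hf.apply_ne_zero hn he hyo'
    have hent : ∀ i j, f y i j = f y o o * (c i * m (y i * star (y j)) * (c j)⁻¹) := by
      intro i j
      obtain ⟨u, v, huv, -⟩ := hf.rankOne y (ne_zero_of_apply hyo')
      have h1 := hcol y hyo i
      have h2 := hrow y hyo j
      have h3 : f y i j * f y o o = f y i o * f y o j := by
        rw [huv]; simp only [Matrix.vecMulVec_apply]; ring
      rw [h1, h2] at h3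
      rw [map_mul]
      refine mul_right_cancel₀ hne ?_
      linear_combination h3
    have htr : f y o o * m (∑ i, y i * star (y i)) = 1 := by
      have h1 := (hf.rankOne y (ne_zero_of_apply hyo')).trace_eq_one
      rw [← h1, Matrix.trace, map_sum, Finset.mul_sum]
      refine Finset.sum_congr rfl fun i _ => ?_
      rw [Matrix.diag_apply, hent i i, mul_assoc, mul_comm (m _), ← mul_assoc (c i),
        mul_inv_cancel₀ (hc i), one_mul]
    have hnorm : ((‖x‖ ^ 2 : ℝ) : ℂ) = m (x o * star (x o)) * m (∑ i, y i * star (y i)) := by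
      rw [← hreal, norm_sq_eq_sum, ← map_mul, Finset.mul_sum]
      congr 1
      refine Finset.sum_congr rfl fun i _ => ?_
      rw [hxy i, star_mul']
      ring
    rw [hnorm, ← hfy, hent i j, hxy i, hxy j, star_mul']
    have h5 : x o * y i * (star (x o) * star (y j)) =
        x o * star (x o) * (y i * star (y j)) := by ring
    rw [h5, map_mul m (x o * star (x o))]
    linear_combination (m (x o * star (x o)) * (c i * m (y i * star (y j)) * (c j)⁻¹)) * htr
  refine ⟨m, hm, c, hc, fun x hx i j => ?_⟩
  have hx0 : x ≠ 0 := fun h => by simp [h] at hx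
  by_cases hxo : x o = 0
  · -- approximate by `x + τ e_o`
    set p : ℝ → EuclideanSpace 𝕜 (Fin n) :=
      fun τ => x + (τ : 𝕜) • EuclideanSpace.single o (1 : 𝕜) with hp
    have hpc : Continuous p := by fun_prop
    have hpo : ∀ τ, p τ o = (τ : 𝕜) := fun τ => by
      simp [hp, hxo, RCLike.real_smul_eq_coe_mul]
    have hp0 : p 0 = x := by simp [hp]
    have hpne : ∀ τ, p τ ≠ 0 := by
      intro τ
      by_cases hτ : τ = 0
      · rw [hτ, hp0]; exact hx0
      · exact ne_zero_of_apply (i := o) (by rw [hpo]; simpa using hτ)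
    have hl : Continuous fun τ => ((‖p τ‖ ^ 2 : ℝ) : ℂ) * f (p τ) i j :=
      (Complex.continuous_ofReal.comp (hpc.norm.pow 2)).mul
        ((hf.continuousOn.comp_continuous hpc hpne).matrix_elem i j)
    have hr : Continuous fun τ => c i * m (p τ i * star (p τ j)) * (c j)⁻¹ := by
      have h1 : Continuous fun τ => p τ i * star (p τ j) := by fun_prop
      exact (continuous_const.mul (hm.comp h1)).mul continuous_const
    have heq : (fun τ => ((‖p τ‖ ^ 2 : ℝ) : ℂ) * f (p τ) i j) =
        fun τ => c i * m (p τ i * star (p τ j)) * (c j)⁻¹ := by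
      refine Continuous.ext_on (dense_compl_singleton (0 : ℝ)) hl hr fun τ hτ => ?_
      exact hgen _ (by rw [hpo]; simpa using hτ) i j
    have h0 := congrFun heq 0
    simp only [hp0, hx] at h0
    simpa using h0
  · have h0 := hgen x hxo i j
    rw [hx] at h0
    simpa using h0

/-- A line map that maps the members of some frame to the coordinate idempotents of a basis is, up
to conjugation, the identity or the transposition. -/
theorem exists_conj (hf : IsLineMap f) (hn : 3 ≤ n) {S : (Matrix (Fin n) (Fin n) ℂ)ˣ}
    (hS : ∀ i, f (EuclideanSpace.single i 1) =
      S.1 * Matrix.diagonal (Pi.single i 1) * S⁻¹.1) :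
    ∃ T : (Matrix (Fin n) (Fin n) ℂ)ˣ,
      (∀ x, ‖x‖ = 1 → f x = T.1 * toC (dyad x) * T⁻¹.1) ∨
      (∀ x, ‖x‖ = 1 → f x = T.1 * (toC (dyad x)).transpose * T⁻¹.1) := by
  have he : ∀ i, S⁻¹.1 * f (EuclideanSpace.single i 1) * S.1 = Matrix.diagonal (Pi.single i 1) := by
    intro i
    rw [hS]
    simp [mul_assoc]
  obtain ⟨m, hm, c, hc, hfm⟩ := (hf.conj S).exists_apply_eq hn he
  have hCC : Matrix.diagonal c * Matrix.diagonal (fun i => (c i)⁻¹) = 1 := by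
    rw [Matrix.diagonal_mul_diagonal]
    simp [hc]
  let C : (Matrix (Fin n) (Fin n) ℂ)ˣ := ⟨Matrix.diagonal c, Matrix.diagonal fun i => (c i)⁻¹, hCC,
    mul_eq_one_comm.1 hCC⟩
  have hfC : ∀ x, ‖x‖ = 1 → f x = (S * C).1 * (dyad x).map m * (S * C)⁻¹.1 := by
    intro x hx
    have h1 : S⁻¹.1 * f x * S.1 = C.1 * (dyad x).map m * C⁻¹.1 := by
      ext i j
      rw [hfm x hx]
      change _ = (Matrix.diagonal c * (dyad x).map m * Matrix.diagonal fun i => (c i)⁻¹) i j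
      rw [Matrix.mul_diagonal, Matrix.diagonal_mul]
      rfl
    have h2 : f x = S.1 * (S⁻¹.1 * f x * S.1) * S⁻¹.1 := by simp [mul_assoc]
    rw [h2, h1, mul_inv_rev]
    simp [mul_assoc]
  refine ⟨S * C, ?_⟩
  rcases ringHom_eq_or m hm with h | h
  · refine Or.inl fun x hx => ?_
    have : (dyad x).map m = toC (dyad x) := by
      ext i j
      simp [toC_eq_mapMatrix, h]
    rw [hfC x hx, this]
  · refine Or.inr fun x hx => ?_
    have : (dyad x).map m = (toC (dyad x)).transpose := by
      ext i j
      simp only [toC_eq_mapMatrix, Matrix.map_apply, h, Matrix.transpose_apply,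
        RingHom.mapMatrix_apply, dyad, Matrix.of_apply, star_mul', star_star, mul_comm]
    rw [hfC x hx, this]

end IsLineMap

/-! ### From preservers to maps of flags -/

section Forward

variable {I : Set ℝ} {γ : I → 𝕜}

open scoped Classical in
theorem exists_isPreserver {φ : normalMatrices n (Set.range γ) → Matrix (Fin n) (Fin n) ℂ}
    (hc : Continuous φ) (hcomm : PreservesCommutativity φ) (hspec : PreservesSpectrum φ) :
    ∃ ψ : Matrix (Fin n) (Fin n) 𝕜 → Matrix (Fin n) (Fin n) ℂ, IsPreserver γ ψ ∧
      ∀ X, φ X = ψ X.1 := by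
  set ψ : Matrix (Fin n) (Fin n) 𝕜 → Matrix (Fin n) (Fin n) ℂ :=
    fun X => if h : X ∈ normalMatrices n (Set.range γ) then φ ⟨X, h⟩ else 0 with hψ
  have h : ∀ X : normalMatrices n (Set.range γ), φ X = ψ X.1 := fun X => by simp [hψ]
  refine ⟨ψ, ⟨?_, fun X hX Y hY hXY => ?_, fun X hX => ?_⟩, h⟩
  · rw [continuousOn_iff_continuous_domRestrict]
    convert hc using 1
    ext1 X
    exact (h X).symm
  · have := hcomm ⟨X, hX⟩ ⟨Y, hY⟩ hXY
    rwa [h, h] at this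
  · have := hspec ⟨X, hX⟩
    rwa [h] at this

/-- The map on projections obtained from `ψ` by transporting matrices with the two eigenvalues
`γ a` and `γ b` affinely to matrices with the eigenvalues `1` and `0`. -/
noncomputable def projMap (γ : I → 𝕜) (ψ : Matrix (Fin n) (Fin n) 𝕜 → Matrix (Fin n) (Fin n) ℂ)
    (a b : I) (P : Matrix (Fin n) (Fin n) 𝕜) : Matrix (Fin n) (Fin n) ℂ :=
  (complexEmbedding 𝕜 (γ a - γ b))⁻¹ •
    (ψ (γ b • (1 : Matrix (Fin n) (Fin n) 𝕜) + (γ a - γ b) • P) -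
      complexEmbedding 𝕜 (γ b) • (1 : Matrix (Fin n) (Fin n) ℂ))

/-- The parameters of a matrix with the first `k` eigenvalues `γ a` and the others `γ b`. -/
def twoStep (n : ℕ) (a b : I) (k : ℕ) (i : Fin n) : I := if (i : ℕ) < k then a else b

theorem monotone_twoStep {a b : I} (hab : a ≤ b) (k : ℕ) : Monotone (twoStep n a b k) := by
  intro i j hij
  have : (i : ℕ) ≤ j := hij
  unfold twoStep
  split_ifs with h1 h2
  · exact le_rfl
  · exact hab
  · omega
  · exact le_rfl

theorem affine_initialProj (γ : I → 𝕜) (a b : I) {U : Fin n → EuclideanSpace 𝕜 (Fin n)}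
    (hU : Orthonormal 𝕜 U) (k : ℕ) :
    γ b • (1 : Matrix (Fin n) (Fin n) 𝕜) + (γ a - γ b) • initialProj U k =
      frameDiag U fun i => γ (twoStep n a b k i) := by
  rw [← frameDiag_one hU, initialProj, ← frameDiag_smul, ← frameDiag_smul, ← frameDiag_add]
  congr 1
  ext i
  unfold twoStep
  split_ifs <;> ring

theorem IsPreserver.exists_conj_projMap (hI : I.OrdConnected) (hI' : I.Nontrivial)
    (hγ : Continuous γ) (hγ' : Function.Injective γ)
    {ψ : Matrix (Fin n) (Fin n) 𝕜 → Matrix (Fin n) (Fin n) ℂ} (hψ : IsPreserver γ ψ)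
    {a b : I} (hab : a < b) {U : Fin n → EuclideanSpace 𝕜 (Fin n)} (hU : Orthonormal 𝕜 U) :
    ∃ S : (Matrix (Fin n) (Fin n) ℂ)ˣ,
      (∀ k : ℕ, projMap γ ψ a b (initialProj U k) =
        S.1 * Matrix.diagonal (fun i : Fin n => if (i : ℕ) < k then 1 else 0) * S⁻¹.1) ∧
      ∀ t : Fin n → I, Monotone t → ψ (frameDiag U fun i => γ (t i)) =
        S.1 * Matrix.diagonal (fun i => complexEmbedding 𝕜 (γ (t i))) * S⁻¹.1 := by
  obtain ⟨S, hS⟩ := hψ.exists_diagonalization hI hI' hγ hγ' hU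
  refine ⟨S, fun k => ?_, hS⟩
  have hne : complexEmbedding 𝕜 (γ a - γ b) ≠ 0 := by
    rw [_root_.map_ne_zero, sub_ne_zero]
    exact fun h => hab.ne (hγ' h)
  have h1 : complexEmbedding 𝕜 (γ b) • (1 : Matrix (Fin n) (Fin n) ℂ) =
      S.1 * (complexEmbedding 𝕜 (γ b) • (1 : Matrix (Fin n) (Fin n) ℂ)) * S⁻¹.1 := by
    rw [Matrix.mul_smul, mul_one, Matrix.smul_mul, Units.mul_inv]
  rw [projMap, affine_initialProj γ a b hU, hS _ (monotone_twoStep hab.le k), h1, ← sub_mul,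
    ← mul_sub, ← Matrix.smul_mul, ← Matrix.mul_smul]
  congr 2
  ext i j
  by_cases hij : i = j
  · subst hij
    simp only [Matrix.smul_apply, Matrix.sub_apply, Matrix.diagonal_apply_eq, Matrix.one_apply_eq,
      smul_eq_mul, mul_one, twoStep]
    rw [← map_sub]
    split_ifs
    · exact inv_mul_cancel₀ hne
    · simp
  · simp [hij]

/-- On two-eigenvalue matrices a preserver is a flag map. -/
theorem IsPreserver.isFlagMap (hI : I.OrdConnected) (hI' : I.Nontrivial)
    (hγ : Continuous γ) (hγ' : Function.Injective γ)
    {ψ : Matrix (Fin n) (Fin n) 𝕜 → Matrix (Fin n) (Fin n) ℂ} (hψ : IsPreserver γ ψ)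
    {a b : I} (hab : a < b) : IsFlagMap (projMap γ ψ a b) where
  exists_conj U hU := by
    obtain ⟨S, hS, -⟩ := hψ.exists_conj_projMap hI hI' hγ hγ' hab hU
    exact ⟨S, hS⟩
  continuousOn := by
    have hlin : Continuous fun P : Matrix (Fin n) (Fin n) 𝕜 =>
        γ b • (1 : Matrix (Fin n) (Fin n) 𝕜) + (γ a - γ b) • P := by fun_prop
    refine ContinuousOn.const_smul ((hψ.continuousOn.comp hlin.continuousOn ?_).sub
      continuousOn_const) (complexEmbedding 𝕜 (γ a - γ b))⁻¹
    rintro _ ⟨U, hU, k, rfl⟩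
    simp only
    rw [affine_initialProj γ a b hU]
    exact frameDiag_mem_normalMatrices hU fun i => ⟨_, rfl⟩
  commute U V hU hV k l h := by
    have hmem : ∀ {W : Fin n → EuclideanSpace 𝕜 (Fin n)}, Orthonormal 𝕜 W → ∀ k : ℕ,
        γ b • (1 : Matrix (Fin n) (Fin n) 𝕜) + (γ a - γ b) • initialProj W k ∈
          normalMatrices n (Set.range γ) := fun hW k => by
      rw [affine_initialProj γ a b hW]
      exact frameDiag_mem_normalMatrices hW fun i => ⟨_, rfl⟩
    have h1 := hψ.commute _ (hmem hU k) _ (hmem hV l)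
      (((Commute.one_left _).smul_left _).add_left
        (((Commute.one_right _).smul_right _).add_right ((h.smul_right _).smul_left _)))
    exact ((h1.sub_left ((Commute.one_left _).smul_left _)).sub_right
      ((((Commute.one_right _).smul_right _)).sub_left
        ((Commute.one_left _).smul_left _))).smul_left _ |>.smul_right _

theorem IsPreserver.apply_frameDiag (hI : I.OrdConnected) (hI' : I.Nontrivial)
    (hγ : Continuous γ) (hγ' : Function.Injective γ)
    {ψ : Matrix (Fin n) (Fin n) 𝕜 → Matrix (Fin n) (Fin n) ℂ} (hψ : IsPreserver γ ψ)
    {a b : I} (hab : a < b) {U : Fin n → EuclideanSpace 𝕜 (Fin n)} (hU : Orthonormal 𝕜 U)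
    {t : Fin n → I} (ht : Monotone t) :
    ψ (frameDiag U fun i => γ (t i)) =
      ∑ i, complexEmbedding 𝕜 (γ (t i)) • flagStep (projMap γ ψ a b) U i := by
  obtain ⟨S, hS, hS'⟩ := hψ.exists_conj_projMap hI hI' hγ hγ' hab hU
  simp only [flagStep_eq_conj hS]
  have hd : Matrix.diagonal (fun i => complexEmbedding 𝕜 (γ (t i))) =
      ∑ i, complexEmbedding 𝕜 (γ (t i)) • Matrix.diagonal (Pi.single i (1 : ℂ)) := by
    ext i j
    rw [Matrix.sum_apply]
    by_cases hij : i = j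
    · subst hij
      rw [Finset.sum_eq_single i]
      · simp
      · intro k _ hk; simp [hk]
      · simp
    · simp [hij]
  rw [hS' t ht, hd, Finset.mul_sum, Finset.sum_mul]
  simp only [Matrix.mul_smul, Matrix.smul_mul]

/-! ### The two types of preservers -/

theorem isSpectrumOrdering_of_flag_const (hI : I.OrdConnected) (hI' : I.Nontrivial)
    (hγ : Continuous γ) (hγ' : Function.Injective γ)
    {φ : normalMatrices n (Set.range γ) → Matrix (Fin n) (Fin n) ℂ}
    {ψ : Matrix (Fin n) (Fin n) 𝕜 → Matrix (Fin n) (Fin n) ℂ} (hψ : IsPreserver γ ψ)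
    (hφ : ∀ X, φ X = ψ X.1) {a b : I} (hab : a < b)
    (h : ∀ U V, Orthonormal 𝕜 U → Orthonormal 𝕜 V → ∀ k,
      projMap γ ψ a b (initialProj U k) = projMap γ ψ a b (initialProj V k)) :
    IsSpectrumOrdering γ φ := by
  have he : Orthonormal 𝕜 fun i : Fin n => EuclideanSpace.single i (1 : 𝕜) :=
    EuclideanSpace.orthonormal_single
  obtain ⟨S, hS⟩ := hψ.exists_diagonalization hI hI' hγ hγ' he
  refine ⟨S, fun X => ?_⟩
  obtain ⟨U, hU, t, ht, hX⟩ := exists_monotone_frameDiag_eq X.2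
  refine ⟨t, ht, by rw [hX, charpoly_frameDiag hU], ?_⟩
  have h1 := hS t ht
  rw [hψ.apply_frameDiag hI hI' hγ hγ' hab he ht] at h1
  rw [hφ, hX, hψ.apply_frameDiag hI hI' hγ hγ' hab hU ht]
  refine Eq.trans ?_ h1
  refine Finset.sum_congr rfl fun i _ => ?_
  rw [flagStep, flagStep, h U _ hU he, h U _ hU he]

theorem dyad_normalize (x : EuclideanSpace 𝕜 (Fin n)) {c : 𝕜} (hc : c ≠ 0) :
    dyad (((‖c • x‖ : ℝ) : 𝕜)⁻¹ • c • x) = dyad (((‖x‖ : ℝ) : 𝕜)⁻¹ • x) := by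
  rw [dyad_smul, dyad_smul, dyad_smul, smul_smul]
  congr 1
  have h1 : (c * star c : 𝕜) = (‖c‖ : 𝕜) ^ 2 := RCLike.mul_conj c
  have h2 : (‖c‖ : 𝕜) ≠ 0 := by simpa using hc
  rw [h1, norm_smul]
  simp only [star_inv₀, RCLike.star_def, RCLike.conj_ofReal, map_mul]
  field_simp

/-- If the steps of a flag map depend only on the line added, then the flag map induces a map of
lines. -/
theorem IsFlagMap.isLineMap {Ψ : Matrix (Fin n) (Fin n) 𝕜 → Matrix (Fin n) (Fin n) ℂ}
    (hΨ : IsFlagMap Ψ) (hn : 2 ≤ n)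
    (h : ∀ U, Orthonormal 𝕜 U → ∀ j, flagStep Ψ U j = Ψ (dyad (U j))) :
    IsLineMap fun x : EuclideanSpace 𝕜 (Fin n) => Ψ (dyad (((‖x‖ : ℝ) : 𝕜)⁻¹ • x)) := by
  set f : EuclideanSpace 𝕜 (Fin n) → Matrix (Fin n) (Fin n) ℂ :=
    fun x => Ψ (dyad (((‖x‖ : ℝ) : 𝕜)⁻¹ • x)) with hf
  have hn0 : 0 < n := by omega
  have hpair : ∀ x y, x ≠ 0 → y ≠ 0 → inner 𝕜 x y = (0 : 𝕜) →
      ∃ U : Fin n → EuclideanSpace 𝕜 (Fin n), Orthonormal 𝕜 U ∧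
        U ⟨0, hn0⟩ = ((‖x‖ : ℝ) : 𝕜)⁻¹ • x ∧ U ⟨1, hn⟩ = ((‖y‖ : ℝ) : 𝕜)⁻¹ • y := by
    intro x y hx hy hxy
    have hyx : inner 𝕜 y x = (0 : 𝕜) := inner_eq_zero_symm.1 hxy
    have hx1 := norm_smul_inv_norm (𝕜 := 𝕜) hx
    have hy1 := norm_smul_inv_norm (𝕜 := 𝕜) hy
    obtain ⟨U, hU, h1⟩ := exists_frame
      (fun i : Fin n => if i = ⟨0, hn0⟩ then ((‖x‖ : ℝ) : 𝕜)⁻¹ • x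
        else ((‖y‖ : ℝ) : 𝕜)⁻¹ • y) {⟨0, hn0⟩, ⟨1, hn⟩} (by
        rintro _ (rfl | rfl) _ (rfl | rfl)
        · simp only [if_true]; rw [inner_self_eq_norm_sq_to_K, hx1]; simp
        · simp [inner_smul_left, inner_smul_right, hxy]
        · simp [inner_smul_left, inner_smul_right, hyx]
        · simp only [if_true, Fin.mk.injEq, one_ne_zero, if_false]
          rw [inner_self_eq_norm_sq_to_K, hy1]; simp)
    exact ⟨U, hU, by rw [h1 _ (by simp)]; simp, by rw [h1 _ (by simp)]; simp⟩
  have hsingle : ∀ x, x ≠ 0 → ∃ U : Fin n → EuclideanSpace 𝕜 (Fin n), Orthonormal 𝕜 U ∧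
        U ⟨0, hn0⟩ = ((‖x‖ : ℝ) : 𝕜)⁻¹ • x := by
    intro x hx
    have hx1 := norm_smul_inv_norm (𝕜 := 𝕜) hx
    obtain ⟨U, hU, h1⟩ := exists_frame
      (fun i : Fin n => ((‖x‖ : ℝ) : 𝕜)⁻¹ • x) {⟨0, hn0⟩} (by
        rintro _ rfl _ rfl
        rw [inner_self_eq_norm_sq_to_K, hx1]; simp)
    exact ⟨U, hU, h1 _ rfl⟩
  have hfU : ∀ {U : Fin n → EuclideanSpace 𝕜 (Fin n)}, Orthonormal 𝕜 U → ∀ i,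
      f (U i) = flagStep Ψ U i := fun {U} hU i => by
    rw [h U hU, hf]
    simp [hU.norm_eq_one i]
  have horth : ∀ x y, x ≠ 0 → y ≠ 0 → inner 𝕜 x y = (0 : 𝕜) → f x * f y = 0 := by
    intro x y hx hy hxy
    obtain ⟨U, hU, h0, h1⟩ := hpair x y hx hy hxy
    have h2 := hΨ.flagStep_mul_flagStep hU (i := ⟨0, hn0⟩) (j := ⟨1, hn⟩) (by simp)
    rwa [h U hU, h U hU, h0, h1] at h2
  -- the sum over the two lines is complementary to lines orthogonal to `x + y`
  have hsum : ∀ x y, x ≠ 0 → y ≠ 0 → inner 𝕜 x y = (0 : 𝕜) →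
      ∃ s : Finset (Fin n), ∃ U : Fin n → EuclideanSpace 𝕜 (Fin n),
        f x + f y = 1 - ∑ i ∈ s, f (U i) ∧
        ∀ i ∈ s, U i ≠ 0 ∧ inner 𝕜 (U i) (x + y) = (0 : 𝕜) := by
    intro x y hx hy hxy
    obtain ⟨U, hU, h0, h1⟩ := hpair x y hx hy hxy
    refine ⟨(Finset.univ.erase ⟨0, hn0⟩).erase ⟨1, hn⟩, U, ?_, fun i hi => ?_⟩
    · have h2 := hΨ.sum_flagStep hU
      rw [← Finset.add_sum_erase _ _ (Finset.mem_univ ⟨0, hn0⟩),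
        ← Finset.add_sum_erase _ _ (a := ⟨1, hn⟩) (by simp)] at h2
      simp only [hfU hU]
      rw [h U hU, h U hU ⟨1, hn⟩, h0, h1] at h2
      rw [← h2, hf]
      abel
    · simp only [Finset.mem_erase, Finset.mem_univ, and_true] at hi
      refine ⟨hU.ne_zero i, ?_⟩
      have h3 : inner 𝕜 (U i) x = (0 : 𝕜) := by
        have : inner 𝕜 (U i) (U ⟨0, hn0⟩) = (0 : 𝕜) := hU.2 hi.2
        rw [h0, inner_smul_right, mul_eq_zero] at this
        exact this.resolve_left (by simpa using hx)
      have h4 : inner 𝕜 (U i) y = (0 : 𝕜) := by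
        have : inner 𝕜 (U i) (U ⟨1, hn⟩) = (0 : 𝕜) := hU.2 hi.1
        rw [h1, inner_smul_right, mul_eq_zero] at this
        exact this.resolve_left (by simpa using hy)
      rw [inner_add_right, h3, h4, add_zero]
  refine ⟨fun x hx => ?_, horth, fun x y hx hy hxy => ?_, fun x y hx hy hxy => ?_,
    fun c x hc _ => ?_, ?_⟩
  · obtain ⟨U, hU, h0⟩ := hsingle x hx
    have h1 := hΨ.isRankOneIdempotent_flagStep hU ⟨0, hn0⟩
    rwa [h U hU, h0] at h1
  · obtain ⟨s, U, h1, h2⟩ := hsum x y hx hy hxy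
    rw [h1, sub_mul, one_mul, Finset.sum_mul, Finset.sum_eq_zero, sub_zero]
    exact fun i hi => horth _ _ (h2 i hi).1 (IsLineMap.add_ne_zero_of_inner hx hxy) (h2 i hi).2
  · obtain ⟨s, U, h1, h2⟩ := hsum x y hx hy hxy
    rw [h1, mul_sub, mul_one, Finset.mul_sum, Finset.sum_eq_zero, sub_zero]
    exact fun i hi => horth _ _ (IsLineMap.add_ne_zero_of_inner hx hxy) (h2 i hi).1
      (inner_eq_zero_symm.1 (h2 i hi).2)
  · simp only [hf, dyad_normalize x hc]
  · refine hΨ.continuousOn.comp (continuous_dyad.comp_continuousOn ?_) ?_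
    · have h1 : ContinuousOn (fun x : EuclideanSpace 𝕜 (Fin n) => ((‖x‖ : ℝ) : 𝕜)⁻¹) {0}ᶜ :=
        (RCLike.continuous_ofReal.comp continuous_norm).continuousOn.inv₀ fun x hx => by
          simpa using hx
      exact h1.smul continuousOn_id
    · intro x hx
      obtain ⟨U, hU, h0⟩ := hsingle x hx
      exact ⟨U, hU, 1, by rw [initialProj_one U (by omega), h0]⟩

theorem isConjOrTransposeConj_of_flagStep (hn : 3 ≤ n) (hI : I.OrdConnected) (hI' : I.Nontrivial)
    (hγ : Continuous γ) (hγ' : Function.Injective γ)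
    {φ : normalMatrices n (Set.range γ) → Matrix (Fin n) (Fin n) ℂ}
    {ψ : Matrix (Fin n) (Fin n) 𝕜 → Matrix (Fin n) (Fin n) ℂ} (hψ : IsPreserver γ ψ)
    (hφ : ∀ X, φ X = ψ X.1) {a b : I} (hab : a < b)
    (h : ∀ U, Orthonormal 𝕜 U → ∀ j,
      flagStep (projMap γ ψ a b) U j = projMap γ ψ a b (dyad (U j))) :
    IsConjOrTransposeConj φ := by
  have hΨ := hψ.isFlagMap hI hI' hγ hγ' hab
  have he : Orthonormal 𝕜 fun i : Fin n => EuclideanSpace.single i (1 : 𝕜) :=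
    EuclideanSpace.orthonormal_single
  obtain ⟨S, hS⟩ := hΨ.exists_conj _ he
  have hunit : ∀ x : EuclideanSpace 𝕜 (Fin n), ‖x‖ = 1 →
      projMap γ ψ a b (dyad (((‖x‖ : ℝ) : 𝕜)⁻¹ • x)) = projMap γ ψ a b (dyad x) := fun x hx => by
    rw [hx]; simp
  obtain ⟨T, hT⟩ := (hΨ.isLineMap (by omega) h).exists_conj (S := S) hn fun i => by
    rw [hunit _ (he.norm_eq_one i), ← flagStep_eq_conj hS]
    exact (h _ he i).symm
  refine ⟨T, hT.imp (fun hT X => ?_) fun hT X => ?_⟩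
  all_goals
    obtain ⟨U, hU, t, ht, hX⟩ := exists_monotone_frameDiag_eq X.2
    rw [hφ, hX, hψ.apply_frameDiag hI hI' hγ hγ' hab hU ht, frameDiag_eq_sum, toC_sum]
    simp only [toC_smul, h U hU, Matrix.transpose_sum, Matrix.transpose_smul, Finset.mul_sum,
      Finset.sum_mul]
    refine Finset.sum_congr rfl fun i _ => ?_
    rw [← hunit _ (hU.norm_eq_one i), hT _ (hU.norm_eq_one i), Matrix.mul_smul, Matrix.smul_mul]

/-- The classification of continuous preservers. -/
theorem isConjOrTransposeConj_or_isSpectrumOrdering (hn : 3 ≤ n) (hI : I.OrdConnected)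
    (hI' : I.Nontrivial) (hγ : Continuous γ) (hγ' : Function.Injective γ)
    {φ : normalMatrices n (Set.range γ) → Matrix (Fin n) (Fin n) ℂ}
    (hc : Continuous φ) (hcomm : PreservesCommutativity φ) (hspec : PreservesSpectrum φ) :
    IsConjOrTransposeConj φ ∨ IsSpectrumOrdering γ φ := by
  obtain ⟨ψ, hψ, hφ⟩ := exists_isPreserver hc hcomm hspec
  obtain ⟨a, ha, b, hb, hab⟩ := hI'.exists_lt
  have hab' : (⟨a, ha⟩ : I) < ⟨b, hb⟩ := hab
  rcases (hψ.isFlagMap hI hI' hγ hγ' hab').dichotomy hn with h | h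
  · exact Or.inr (isSpectrumOrdering_of_flag_const hI hI' hγ hγ' hψ hφ hab' h)
  · exact Or.inl (isConjOrTransposeConj_of_flagStep hn hI hI' hγ hγ' hψ hφ hab' h)

end Forward

/-! ### Ordered eigenvalues -/

section Ordered

variable {I : Set ℝ} {γ : I → 𝕜}

/-- The eigenvalues, as a tuple ordered along the curve, are determined by the characteristic
polynomial. -/
theorem eq_of_monotone_of_prod_eq (hγ' : Function.Injective γ) {t t' : Fin n → I}
    (ht : Monotone t) (ht' : Monotone t')
    (h : ∏ i, (X - C (γ (t i))) = ∏ i, (X - C (γ (t' i)))) : t = t' := by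
  have key : ∀ s : Fin n → I, (∏ i, (X - C (γ (s i)))).roots =
      ((List.ofFn s : Multiset I).map γ) := fun s => by
    rw [← Fin.univ_val_map, Multiset.map_map, ← roots_multiset_prod_X_sub_C (Multiset.map _ _),
      Multiset.map_map]
    rfl
  have h1 := congrArg roots h
  rw [key, key] at h1
  exact List.ofFn_injective ((Multiset.coe_eq_coe.1 (Multiset.map_injective hγ' h1)).eq_of_sortedLE
    ht.sortedLE_ofFn ht'.sortedLE_ofFn)

theorem range_eq_of_prod_eq (hγ' : Function.Injective γ) {t t' : Fin n → I}
    (h : ∏ i, (X - C (γ (t i))) = ∏ i, (X - C (γ (t' i)))) : Set.range t = Set.range t' := by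
  have key : ∀ (s : Fin n → I) x, x ∈ Set.range s ↔ (∏ i, (X - C (γ (s i)))).eval (γ x) = 0 := by
    intro s x
    rw [eval_prod, Finset.prod_eq_zero_iff]
    simp [sub_eq_zero, hγ'.eq_iff, eq_comm]
  ext x
  rw [key, key, h]

/-- A crude bound for the eigenvalues, from Gershgorin's theorem. -/
theorem norm_le_of_charpoly {M : Matrix (Fin n) (Fin n) 𝕜} {d : Fin n → 𝕜}
    (h : M.charpoly = ∏ i, (X - C (d i))) (i : Fin n) : ‖d i‖ ≤ ∑ a, ∑ b, ‖M a b‖ := by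
  have h1 : d i ∈ spectrum 𝕜 M := by
    rw [Matrix.mem_spectrum_iff_isRoot_charpoly, h, IsRoot, eval_prod]
    exact Finset.prod_eq_zero (Finset.mem_univ i) (by simp)
  rw [← Matrix.spectrum_toLin', ← Module.End.hasEigenvalue_iff_mem_spectrum] at h1
  obtain ⟨k, hk⟩ := eigenvalue_mem_ball h1
  rw [Metric.mem_closedBall, dist_eq_norm] at hk
  calc ‖d i‖ ≤ ‖M k k‖ + ‖d i - M k k‖ := by
        have := norm_add_le (M k k) (d i - M k k)
        rwa [add_sub_cancel] at this
    _ ≤ ∑ b, ‖M k b‖ := by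
        rw [← Finset.add_sum_erase _ _ (Finset.mem_univ k)]
        gcongr
    _ ≤ _ := Finset.single_le_sum (f := fun a => ∑ b, ‖M a b‖)
        (fun a _ => Finset.sum_nonneg fun b _ => norm_nonneg _) (Finset.mem_univ k)

/-- If `γ` is an embedding, the ordered eigenvalues are continuous: by compactness they converge
along ultrafilters, the limits are the roots of the limiting characteristic polynomial, and their
order is preserved because it can be read off continuously from the eigenvalues. -/
theorem continuous_orderedEigenvalues (hγ : Topology.IsEmbedding γ)
    {t : normalMatrices n (Set.range γ) → Fin n → I} (ht : ∀ X, Monotone (t X))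
    (hX : ∀ M, M.1.charpoly = ∏ i, (X - C (γ (t M i)))) (i : Fin n) :
    Continuous fun M => γ (t M i) := by
  refine continuous_iff_ultrafilter.2 fun M₀ g hg => ?_
  have hcoe : Filter.Tendsto (fun M : normalMatrices n (Set.range γ) => M.1) g (nhds M₀.1) :=
    (continuous_subtype_val.tendsto M₀).mono_left hg
  set F : Matrix (Fin n) (Fin n) 𝕜 → ℝ := fun M => ∑ a, ∑ b, ‖M a b‖ with hF
  have hFc : Continuous F :=
    continuous_finsetSum _ fun a _ => continuous_finsetSum _ fun b _ =>
      (continuous_id.matrix_elem a b).norm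
  have hbd : ∀ᶠ M : normalMatrices n (Set.range γ) in g, F M.1 < F M₀.1 + 1 :=
    ((hFc.tendsto _).comp hcoe).eventually (gt_mem_nhds (lt_add_one _))
  have hlim : ∀ j, ∃ c, Filter.Tendsto (fun M => γ (t M j)) g (nhds c) := by
    intro j
    have h1 : ↑(g.map fun M => γ (t M j)) ≤
        Filter.principal (Metric.closedBall (0 : 𝕜) (F M₀.1 + 1)) := by
      rw [Filter.le_principal_iff, Ultrafilter.mem_coe, Ultrafilter.mem_map]
      filter_upwards [hbd] with M hM
      simpa using (norm_le_of_charpoly (hX M) j).trans hM.le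
    obtain ⟨c, -, hc⟩ := (isCompact_closedBall (0 : 𝕜) (F M₀.1 + 1)).ultrafilter_le_nhds _ h1
    exact ⟨c, hc⟩
  choose c hc using hlim
  have hprod : ∏ j, (X - C (γ (t M₀ j))) = ∏ j, (X - C (c j)) := by
    refine Polynomial.funext fun z => ?_
    have h1 : Filter.Tendsto (fun M : normalMatrices n (Set.range γ) => M.1.charpoly.eval z) g
        (nhds (M₀.1.charpoly.eval z)) := by
      have h2 : Continuous fun M : Matrix (Fin n) (Fin n) 𝕜 => M.charpoly.eval z := by
        simp only [Matrix.eval_charpoly]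
        exact (continuous_const.sub continuous_id).matrix_det
      exact (h2.tendsto _).comp hcoe
    have h3 : Filter.Tendsto (fun M : normalMatrices n (Set.range γ) => M.1.charpoly.eval z) g
        (nhds (∏ j, (z - c j))) := by
      simp only [hX, eval_prod, eval_sub, eval_X, eval_C]
      exact tendsto_finsetProd _ fun j _ => tendsto_const_nhds.sub (hc j)
    have h4 := tendsto_nhds_unique h1 h3
    rw [hX] at h4
    simpa [eval_prod] using h4
  have hcΛ : ∀ j, ∃ s, γ s = c j := by
    intro j
    have h1 := congrArg (eval (c j)) hprod
    rw [eval_prod, eval_prod, Finset.prod_eq_zero (f := fun k => eval (c j) (X - C (c k)))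
      (Finset.mem_univ j) (by simp), Finset.prod_eq_zero_iff] at h1
    obtain ⟨k, -, hk⟩ := h1
    refine ⟨t M₀ k, ?_⟩
    rw [eval_sub, eval_X, eval_C, sub_eq_zero] at hk
    exact hk.symm
  choose s hs using hcΛ
  have hts : ∀ j, Filter.Tendsto (fun M => t M j) g (nhds (s j)) := fun j =>
    hγ.tendsto_nhds_iff.2 (by rw [hs]; exact hc j)
  have hmono : Monotone s := fun j k hjk =>
    le_of_tendsto_of_tendsto' (hts j) (hts k) fun M => ht M hjk
  have hst : t M₀ = s := by
    refine eq_of_monotone_of_prod_eq hγ.injective (ht M₀) hmono ?_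
    simp only [hprod, hs]
  rw [hst, hs]
  exact hc i

/-- If the ordered eigenvalues are continuous, then `γ` is an embedding: `t > r` holds if and only
if the largest eigenvalue of `diag (γ t, γ r, …, γ r)` differs from `γ r`, which is an open
condition on `γ t`; symmetrically for `t < r`. -/
theorem isEmbedding_of_continuous_orderedEigenvalues (hn : 2 ≤ n) (hI : I.OrdConnected)
    (hγ : Continuous γ) (hγ' : Function.Injective γ)
    {t : normalMatrices n (Set.range γ) → Fin n → I} (ht : ∀ X, Monotone (t X))
    (hX : ∀ M, M.1.charpoly = ∏ i, (X - C (γ (t M i))))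
    (hc : ∀ i, Continuous fun M => γ (t M i)) : Topology.IsEmbedding γ := by
  have hn0 : 0 < n := by omega
  have he : Orthonormal 𝕜 fun i : Fin n => EuclideanSpace.single i (1 : 𝕜) :=
    EuclideanSpace.orthonormal_single
  set d : I → I → Fin n → I := fun r u i => if i = ⟨0, hn0⟩ then u else r with hd
  have hrange : ∀ r u, Set.range (d r u) = {u, r} := by
    intro r u
    ext x
    simp only [Set.mem_range, Set.mem_insert_iff, Set.mem_singleton_iff]
    constructor
    · rintro ⟨i, rfl⟩
      simp only [hd]
      split_ifs <;> simp
    · rintro (rfl | rfl)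
      · exact ⟨⟨0, hn0⟩, by simp [hd]⟩
      · exact ⟨⟨1, hn⟩, by simp [hd]⟩
  let Y : I → I → normalMatrices n (Set.range γ) := fun r u =>
    ⟨frameDiag _ fun i => γ (d r u i), frameDiag_mem_normalMatrices he fun i => ⟨_, rfl⟩⟩
  have htY : ∀ r u, Set.range (t (Y r u)) = {u, r} := fun r u => by
    rw [← hrange r u]
    refine range_eq_of_prod_eq hγ' ?_
    rw [← hX, charpoly_frameDiag he]
  have hlast : ∀ r u, t (Y r u) ⟨n - 1, by omega⟩ = max u r := by
    intro r u
    have hle : ∀ x ∈ Set.range (t (Y r u)), x ≤ t (Y r u) ⟨n - 1, by omega⟩ := by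
      rintro _ ⟨i, rfl⟩
      exact ht _ (Fin.mk_le_mk.2 (by omega))
    have hmem : t (Y r u) ⟨n - 1, by omega⟩ ∈ Set.range (t (Y r u)) := ⟨_, rfl⟩
    rw [htY] at hle hmem
    refine le_antisymm ?_ (max_le (hle _ (by simp)) (hle _ (by simp)))
    rcases hmem with h | h <;> rw [h] <;> simp
  have hfirst : ∀ r u, t (Y r u) ⟨0, hn0⟩ = min u r := by
    intro r u
    have hle : ∀ x ∈ Set.range (t (Y r u)), t (Y r u) ⟨0, hn0⟩ ≤ x := by
      rintro _ ⟨i, rfl⟩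
      exact ht _ (Fin.mk_le_mk.2 (Nat.zero_le _))
    have hmem : t (Y r u) ⟨0, hn0⟩ ∈ Set.range (t (Y r u)) := ⟨_, rfl⟩
    rw [htY] at hle hmem
    refine le_antisymm (le_min (hle _ (by simp)) (hle _ (by simp))) ?_
    rcases hmem with h | h <;> rw [h] <;> simp
  have hY : ∀ r s, Filter.Tendsto (Y r) (Filter.comap γ (nhds (γ s))) (nhds (Y r s)) := by
    intro r s
    rw [tendsto_subtype_rng]
    have hG : Continuous fun z : 𝕜 => frameDiag (fun i : Fin n => EuclideanSpace.single i (1 : 𝕜))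
        fun i => if i = ⟨0, hn0⟩ then z else γ r := by
      simp only [frameDiag_eq_sum]
      refine continuous_finsetSum _ fun i _ => ?_
      split_ifs <;> fun_prop
    have h1 := (hG.tendsto (γ s)).comp (Filter.tendsto_comap (f := γ))
    have h2 : ∀ u, (Y r u).1 = frameDiag (fun i : Fin n => EuclideanSpace.single i (1 : 𝕜))
        fun i => if i = ⟨0, hn0⟩ then γ u else γ r := by
      intro u
      simp only [Y, hd, apply_ite γ]
    simp only [h2]
    exact h1
  refine ⟨Topology.isInducing_iff_nhds.2 fun s => le_antisymm (hγ.tendsto s).le_comap ?_, hγ'⟩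
  have hid : Filter.Tendsto id (Filter.comap γ (nhds (γ s))) (nhds s) := by
    refine tendsto_order.2 ⟨fun r hr => ?_, fun r hr => ?_⟩
    · have h1 := ((hc ⟨n - 1, by omega⟩).tendsto (Y r s)).comp (hY r s)
      simp only [Function.comp_def, hlast, max_eq_left hr.le] at h1
      filter_upwards [h1.eventually_ne (hγ'.ne hr.ne')] with u hu
      by_contra hur
      exact hu (congrArg γ (max_eq_right (not_lt.1 hur)))
    · have h1 := ((hc ⟨0, hn0⟩).tendsto (Y r s)).comp (hY r s)
      simp only [Function.comp_def, hfirst, min_eq_left hr.le] at h1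
      filter_upwards [h1.eventually_ne (hγ'.ne hr.ne)] with u hu
      by_contra hur
      exact hu (congrArg γ (min_eq_right (not_lt.1 hur)))
  exact hid

end Ordered

/-! ### Properties of the two types of maps -/

theorem continuous_conj_iff {S : Type*} [TopologicalSpace S]
    (T : (Matrix (Fin n) (Fin n) ℂ)ˣ) {f : S → Matrix (Fin n) (Fin n) ℂ} :
    (Continuous fun s => T.1 * f s * T⁻¹.1) ↔ Continuous f := by
  constructor
  · intro h
    have h1 := (continuous_const (y := T⁻¹.1)).matrix_mul
      (h.matrix_mul (continuous_const (y := T.1)))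
    refine h1.congr fun s => ?_
    simp [mul_assoc]
  · exact fun h => (continuous_const.matrix_mul h).matrix_mul continuous_const

theorem commute_conj (T : (Matrix (Fin n) (Fin n) ℂ)ˣ) {M N : Matrix (Fin n) (Fin n) ℂ}
    (h : Commute M N) : Commute (T.1 * M * T⁻¹.1) (T.1 * N * T⁻¹.1) := by
  have h1 : ∀ A B : Matrix (Fin n) (Fin n) ℂ,
      T.1 * A * T⁻¹.1 * (T.1 * B * T⁻¹.1) = T.1 * (A * B) * T⁻¹.1 := fun A B => by
    simp [mul_assoc]
  rw [Commute, SemiconjBy, h1, h1, h.eq]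

theorem spectrum_transpose (M : Matrix (Fin n) (Fin n) ℂ) :
    spectrum ℂ M.transpose = spectrum ℂ M := by
  ext z
  rw [Matrix.mem_spectrum_iff_isRoot_charpoly, Matrix.mem_spectrum_iff_isRoot_charpoly,
    Matrix.charpoly_transpose]

theorem IsConjOrTransposeConj.preserves {Λ : Set 𝕜}
    {φ : normalMatrices n Λ → Matrix (Fin n) (Fin n) ℂ} (h : IsConjOrTransposeConj φ) :
    Continuous φ ∧ PreservesCommutativity φ ∧ PreservesSpectrum φ := by
  obtain ⟨T, h | h⟩ := h
  · obtain rfl : φ = fun X => T.1 * toC X.1 * T⁻¹.1 := funext h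
    refine ⟨(continuous_conj_iff T).2 (continuous_toC.comp continuous_subtype_val),
      fun X Y hXY => commute_conj T ?_, fun X => spectrum_conj T _⟩
    rw [Commute, SemiconjBy, ← toC_mul, ← toC_mul, hXY.eq]
  · obtain rfl : φ = fun X => T.1 * (toC X.1).transpose * T⁻¹.1 := funext h
    refine ⟨(continuous_conj_iff T).2
      (continuous_toC.comp continuous_subtype_val).matrix_transpose,
      fun X Y hXY => commute_conj T ?_, fun X => (spectrum_conj T _).trans (spectrum_transpose _)⟩
    rw [Commute, SemiconjBy, ← Matrix.transpose_mul, ← Matrix.transpose_mul, ← toC_mul, ← toC_mul,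
      hXY.eq]

theorem isInducing_complexEmbedding : Topology.IsInducing (complexEmbedding 𝕜) := by
  refine Topology.IsInducing.of_comp continuous_complexEmbedding (RCLike.map ℂ 𝕜).continuous ?_
  have : RCLike.map ℂ 𝕜 ∘ complexEmbedding 𝕜 = id := by
    ext x
    simp [complexEmbedding_apply, RCLike.re_add_im]
  rw [this]
  exact Topology.IsInducing.id

theorem IsSpectrumOrdering.preserves (hn : 2 ≤ n) {I : Set ℝ} (hI : I.OrdConnected) {γ : I → 𝕜}
    (hγ : Continuous γ) (hγ' : Function.Injective γ)
    {φ : normalMatrices n (Set.range γ) → Matrix (Fin n) (Fin n) ℂ}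
    (h : IsSpectrumOrdering γ φ) :
    PreservesCommutativity φ ∧ PreservesSpectrum φ ∧
      (Continuous φ ↔ Topology.IsEmbedding γ) := by
  obtain ⟨T, h⟩ := h
  choose t ht hX hφ using h
  refine ⟨fun X Y _ => ?_, fun X => ?_, ?_⟩
  · rw [hφ, hφ]
    exact commute_conj T (Matrix.commute_diagonal _ _)
  · rw [hφ, spectrum_conj, spectrum_diagonal, spectrum_toC_of_charpoly (hX X)]
    rfl
  · have h1 : Continuous φ ↔ ∀ i, Continuous fun X => γ (t X i) := by
      obtain rfl : φ = _ := funext hφ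
      rw [continuous_conj_iff]
      constructor
      · intro hc i
        refine isInducing_complexEmbedding.continuous_iff.2 ?_
        refine (hc.matrix_elem i i).congr fun X => ?_
        simp [complexEmbedding_apply]
      · intro hc
        exact Continuous.matrix_diagonal (continuous_pi fun i =>
          (continuous_complexEmbedding (𝕜 := 𝕜)).comp (hc i))
    rw [h1]
    exact ⟨isEmbedding_of_continuous_orderedEigenvalues hn hI hγ hγ' ht hX,
      fun hγe i => continuous_orderedEigenvalues hγe ht hX i⟩

end CurveSpectrum

theorem theorem1 {𝕜 : Type*} [RCLike 𝕜] (n : ℕ) (hn : 3 ≤ n)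
    (I : Set ℝ) (hI : I.OrdConnected) (hI' : I.Nontrivial)
    (γ : I → 𝕜) (hγ : Continuous γ) (hγ' : Function.Injective γ) :
    (∀ φ : CurveSpectrum.normalMatrices n (Set.range γ) → Matrix (Fin n) (Fin n) ℂ,
      (Continuous φ ∧ CurveSpectrum.PreservesCommutativity φ ∧
          CurveSpectrum.PreservesSpectrum φ) ↔
        (CurveSpectrum.IsConjOrTransposeConj φ ∨
          (Topology.IsEmbedding γ ∧ CurveSpectrum.IsSpectrumOrdering γ φ))) ∧
    (∀ φ : CurveSpectrum.normalMatrices n (Set.range γ) → Matrix (Fin n) (Fin n) ℂ,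
      CurveSpectrum.IsSpectrumOrdering γ φ →
        CurveSpectrum.PreservesCommutativity φ ∧ CurveSpectrum.PreservesSpectrum φ ∧
          (Continuous φ ↔ Topology.IsEmbedding γ)) := by
  have hb := fun (φ : CurveSpectrum.normalMatrices n (Set.range γ) → Matrix (Fin n) (Fin n) ℂ)
    (h : CurveSpectrum.IsSpectrumOrdering γ φ) => h.preserves (by omega) hI hγ hγ'
  refine ⟨fun φ => ⟨?_, ?_⟩, hb⟩
  · rintro ⟨hc, hcomm, hspec⟩
    refine (CurveSpectrum.isConjOrTransposeConj_or_isSpectrumOrdering hn hI hI' hγ hγ' hc hcomm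
      hspec).imp_right fun h => ⟨(hb φ h).2.2.1 hc, h⟩
  · rintro (h | ⟨hγe, h⟩)
    · exact h.preserves
    · exact ⟨(hb φ h).2.2.2 hγe, (hb φ h).1, (hb φ h).2.1⟩
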